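/- For an even integer $k\ge 4$ and $z$ in the upper half plane $\mathbb{H}$, let $E_k(z)=\frac12\sum_{(c,d)=1}(cz+d)^{-k}$, where the sum is over all coprime pairs of integers $(c,d)$, and let $$E^*_{k,7}(z)=\frac{1}{7^{k/2}+1}\left(7^{k/2}E_k(7z)+E_k(z)\right)$$ be the Eisenstein series of weight $k$ for the Fricke group $\Gamma_0^*(7)$. Let $\mathbb{F}^*(7)\subset\mathbb{H}$ be the fundamental domain $$\left\{|z|\ge\tfrac1{\sqrt7},\ |z+\tfrac12|\ge\tfrac1{2\sqrt7},\ -\tfrac12\le\mathrm{Re}\,z\le0\right\}\cup\left\{|z|>\tfrac1{\sqrt7},\ |z-\tfrac12|>\tfrac1{2\sqrt7},\ 0\le\mathrm{Re}\,z<\tfrac12\right\}.$$ Put $\rho_{7,1}=-\frac12+\frac{i}{2\sqrt7}$ and $\rho_{7,2}=-\frac5{14}+\frac{\sqrt3\,i}{14}$, let $\alpha_7\in[0,\pi]$ be the angle with $\tan\alpha_7=5/\sqrt3$, and let $$A^*_{7,1}=\left\{z\in\mathbb{H} : |z|=\tfrac1{\sqrt7},\ \tfrac\pi2<\mathrm{Arg}(z)<\tfrac\pi2+\alpha_7\right\},$$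 $$A^*_{7,2}=\left\{z\in\mathbb{H} : |z+\tfrac12|=\tfrac1{2\sqrt7},\ \alpha_7-\tfrac\pi6<\mathrm{Arg}(z+\tfrac12)<\tfrac\pi2\right\}.$$ Write $v_p$ for the order of vanishing of $E^*_{k,7}$ at $p\in\mathbb{H}$, $v_\infty$ for the order at $\infty$ of its expansion in powers of $q=e^{2\pi iz}$, and $V_7^*$ for the number of simple zeros of $E^*_{k,7}$ on $A^*_{7,1}\cup A^*_{7,2}$. Then for $k=4,6,12$ these numbers are $$\begin{array}{c|ccccc}k&v_\infty&v_{i/\sqrt7}&v_{\rho_{7,1}}&v_{\rho_{7,2}}&V_7^*\\\hline4&0&0&0&1&1\\6&0&1&1&0&1\\12&0&0&0&0&4\end{array}$$ and in each case $E^*_{k,7}$ has no further zeros in $\mathbb{F}^*(7)$: every zero in $\mathbb{F}^*(7)$ is one of $i/\sqrt7,\rho_{7,1},\rho_{7,2}$ or a simple zero on $A^*_{7,1}\cup A^*_{7,2}$. -/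

import Mathlib

noncomputable section

namespace Fricke7

open UpperHalfPlane

open scoped Manifold

/-- The point `7 z` of the upper half plane. -/
def mulSeven (z : ℍ) : ℍ := ⟨7 * (z : ℂ), by simpa using z.im_pos⟩

/-- The Eisenstein series `E*_{k,7}(z) = (7^{k/2} E_k(7z) + E_k(z)) / (7^{k/2} + 1)` of even
weight `k` for the Fricke group of level 7, where
`E_k(z) = (1/2) ∑_{(c,d)=1} (c z + d)^{-k}` is Mathlib's `ModularForm.E`.
It is only used for even `k`, so that the natural-number quotient `k / 2` is exact. -/
def eisenstein (k : ℕ) (hk : 3 ≤ k) (z : ℍ) : ℂ :=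
  (1 / ((7 : ℂ) ^ (k / 2) + 1)) *
    ((7 : ℂ) ^ (k / 2) * ModularForm.E hk (mulSeven z) + ModularForm.E hk z)

/-- `E*_{k,7}` is holomorphic on the upper half plane, so that its orders of vanishing are
meaningful. -/
theorem mdifferentiable_eisenstein (k : ℕ) (hk : 3 ≤ k) : MDiff (eisenstein k hk) := by
  have hE : MDiff (ModularForm.E hk : ℍ → ℂ) := (ModularForm.E hk).holo'
  rw [UpperHalfPlane.mdifferentiable_iff] at hE ⊢
  have h7 : DifferentiableOn ℂ
      (fun w : ℂ => ((ModularForm.E hk : ℍ → ℂ) ∘ ofComplex) (7 * w)) {z | 0 < z.im} := by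
    have hmul : DifferentiableOn ℂ (fun w : ℂ => 7 * w) {z | 0 < z.im} := by fun_prop
    exact DifferentiableOn.comp (g := (ModularForm.E hk : ℍ → ℂ) ∘ ofComplex) hE hmul
      (fun w hw => by simpa using hw)
  refine DifferentiableOn.congr
    (((h7.const_mul ((7 : ℂ) ^ (k / 2))).add hE).const_mul (1 / ((7 : ℂ) ^ (k / 2) + 1))) ?_
  intro w hw
  have hw' : 0 < w.im := hw
  have h7w : 0 < (7 * w).im := by simpa using hw'
  simp only [Function.comp_apply, eisenstein, Pi.add_apply,
    ofComplex_apply_of_im_pos hw', ofComplex_apply_of_im_pos h7w]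
  rfl

/-- The order of vanishing `v_z(f)` at a point `z` of the upper half plane. -/
def orderAt (f : ℍ → ℂ) (z : ℍ) : ℕ∞ := analyticOrderAt (f ∘ ofComplex) (z : ℂ)

/-- The order of vanishing `v_∞(f)` at the cusp `∞` (of width `1`): the order of the expansion
of `f` in powers of `q = exp (2 π i z)`. -/
def orderAtInfty (f : ℍ → ℂ) : ℕ∞ := (qExpansion 1 f).order

/-- The elliptic point `i / √7`. -/
def ellI : ℍ := ⟨⟨0, 1 / √7⟩, by positivity⟩

/-- The elliptic point `ρ_{7,1} = -1/2 + i / (2 √7)`. -/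
def rho1 : ℍ := ⟨⟨-1 / 2, 1 / (2 * √7)⟩, by positivity⟩

/-- The elliptic point `ρ_{7,2} = -5/14 + √3 i / 14`. -/
def rho2 : ℍ := ⟨⟨-5 / 14, √3 / 14⟩, by positivity⟩

/-- The angle `α_7 ∈ [0, π]` with `tan α_7 = 5 / √3`. -/
def alpha : ℝ := Real.arctan (5 / √3)

/-- The fundamental domain `F*(7)` of the Fricke group of level 7. -/
def fundDomain : Set ℍ :=
  {z | 1 / √7 ≤ ‖(z : ℂ)‖ ∧ 1 / (2 * √7) ≤ ‖(z : ℂ) + 1 / 2‖ ∧ -1 / 2 ≤ z.re ∧ z.re ≤ 0} ∪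
  {z | 1 / √7 < ‖(z : ℂ)‖ ∧ 1 / (2 * √7) < ‖(z : ℂ) - 1 / 2‖ ∧ 0 ≤ z.re ∧ z.re < 1 / 2}

/-- The open arc `A*_{7,1}` of the circle `|z| = 1 / √7`, from `i / √7` to `ρ_{7,2}`. -/
def arc1 : Set ℍ :=
  {z | ‖(z : ℂ)‖ = 1 / √7 ∧
    Real.pi / 2 < Complex.arg (z : ℂ) ∧ Complex.arg (z : ℂ) < Real.pi / 2 + alpha}

/-- The open arc `A*_{7,2}` of the circle `|z + 1/2| = 1 / (2 √7)`, from `ρ_{7,2}` to `ρ_{7,1}`;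
the angle is measured at the centre `-1/2` of the circle. -/
def arc2 : Set ℍ :=
  {z | ‖(z : ℂ) + 1 / 2‖ = 1 / (2 * √7) ∧
    alpha - Real.pi / 6 < Complex.arg ((z : ℂ) + 1 / 2) ∧
    Complex.arg ((z : ℂ) + 1 / 2) < Real.pi / 2}

/-- The location of the zeros of `f` in `F*(7)`: `f` has order `nInf` at the cusp `∞` and orders
`n0`, `n1`, `n2` at `i / √7`, `ρ_{7,1}`, `ρ_{7,2}`, it has exactly `N` simple zeros on
`A*_{7,1} ∪ A*_{7,2}`, and it has no other zeros in `F*(7)`. -/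
structure ZeroLocation (f : ℍ → ℂ) (nInf n0 n1 n2 N : ℕ) : Prop where
  order_infty : orderAtInfty f = nInf
  order_ellI : orderAt f ellI = n0
  order_rho1 : orderAt f rho1 = n1
  order_rho2 : orderAt f rho2 = n2
  simple_zeros : {z : ℍ | z ∈ arc1 ∪ arc2 ∧ orderAt f z = 1}.ncard = N
  no_other_zeros : ∀ z ∈ fundDomain, f z = 0 →
    z = ellI ∨ z = rho1 ∨ z = rho2 ∨ (z ∈ arc1 ∪ arc2 ∧ orderAt f z = 1)

end Fricke7

end

noncomputable section

namespace Fricke7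

open UpperHalfPlane Filter Topology Asymptotics

/-! The proof turns every zero into a value of one function. Let t = (η(z)/η(7z))⁴ and h = t + 13 +
49/t. The involutions W: z ↦ -1/(7z) and V, fixing i/√7 and ρ_{7,1}, send t to 49/t, so h is
invariant under both and under translation, and h = 1/q + 9 + O(q). The product P = (η(z)η(7z))¹²
has no zero in the upper half plane, vanishes to order 4 at infinity, and transforms with weight 12.
Hence E₄³/P, E₆²/P and E₁₂/P (for the Fricke Eisenstein series) are invariant with a pole of order
at most 4 in q, and subtracting a suitable quartic polynomial in h leaves an invariant function on
the disc vanishing at q = 0. Such a function is zero (`eq_zero_of_invariant`): by invariance its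
modulus has a maximum over a closed disc in the interior. Comparing five coefficients
(`eq_quartic_of_hasJet`) gives E₄³ = P h (h - 16/5)³, E₆² = P (h - 27)(h + 1)(h - 20/43)², and E₁₂ =
P times an explicit quartic in h.

It remains to know where h takes real values in [-1, 27]. On the boundary of the left half of the
fundamental domain h is real, because each edge is fixed pointwise by an antiholomorphic symmetry.
The maximum principle for exp(ih) gives Im h ≥ 0 inside (`haupt_im_nonneg`). A local argument
(`order_mul_lt_of_im_nonneg`) bounds the multiplicity of a real value by 2π over the opening of a
sector leading into the domain: so Im h > 0 inside, multiplicity is 1 on the open edges, and it is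
limited at the corners. Rolle's theorem makes h injective along each edge. Since h(ρ_{7,1}) = -1 and
h(i/√7) = 27, the two arcs are mapped bijectively onto (-1, 27) without h(ρ_{7,2}), which is 0
(`haupt_ptRho`).

Zeros and orders are then read off from the roots of the three polynomials (`zeroLocation_of`). -/

section

/-! ### Jets of order four at q = 0 -/

/-- `f` agrees with the polynomial `a + b q + c q² + d q³ + e q⁴` up to `O(q⁵)` at `0`. -/
def HasJet (f : ℂ → ℂ) (a b c d e : ℂ) : Prop :=
  (fun q => f q - (a + b * q + c * q ^ 2 + d * q ^ 3 + e * q ^ 4)) =O[𝓝 0] (fun q => q ^ 5)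

theorem isBigO_pow_of_continuousAt_mul {f : ℂ → ℂ} (hf : ContinuousAt f 0) (n : ℕ) :
    (fun q => q ^ n * f q) =O[𝓝 0] (fun q => q ^ n) := by
  simpa using (isBigO_refl (fun q : ℂ => q ^ n) (𝓝 0)).mul (hf.isBigO_one ℂ)

namespace HasJet

variable {f g : ℂ → ℂ} {a b c d e a' b' c' d' e' : ℂ}

theorem polynomial (a b c d e : ℂ) :
    HasJet (fun q => a + b * q + c * q ^ 2 + d * q ^ 3 + e * q ^ 4) a b c d e := by
  simpa [HasJet] using isBigO_zero _ _

theorem id : HasJet (fun q => q) 0 1 0 0 0 := by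
  simpa using polynomial 0 1 0 0 0

theorem isBigO_one (hf : HasJet f a b c d e) : f =O[𝓝 0] (fun _ => (1 : ℂ)) := by
  have h1 : (fun q : ℂ => q ^ 5) =O[𝓝 0] (fun _ => (1 : ℂ)) := by
    have : ContinuousAt (fun q : ℂ => q ^ 5) 0 := by fun_prop
    exact this.isBigO_one ℂ
  have h2 : (fun q : ℂ => a + b * q + c * q ^ 2 + d * q ^ 3 + e * q ^ 4)
      =O[𝓝 0] (fun _ => (1 : ℂ)) := by
    have : ContinuousAt (fun q : ℂ => a + b * q + c * q ^ 2 + d * q ^ 3 + e * q ^ 4) 0 := by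
      fun_prop
    exact this.isBigO_one ℂ
  simpa using (IsBigO.trans hf h1).add h2

theorem add (hf : HasJet f a b c d e) (hg : HasJet g a' b' c' d' e') :
    HasJet (fun q => f q + g q) (a + a') (b + b') (c + c') (d + d') (e + e') :=
  (IsBigO.add hf hg).congr_left fun q => by ring

theorem sub (hf : HasJet f a b c d e) (hg : HasJet g a' b' c' d' e') :
    HasJet (fun q => f q - g q) (a - a') (b - b') (c - c') (d - d') (e - e') :=
  (IsBigO.sub hf hg).congr_left fun q => by ring

theorem mul (hf : HasJet f a b c d e) (hg : HasJet g a' b' c' d' e') :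
    HasJet (fun q => f q * g q) (a * a') (a * b' + b * a') (a * c' + b * b' + c * a')
      (a * d' + b * c' + c * b' + d * a') (a * e' + b * d' + c * c' + d * b' + e * a') := by
  have h1 := IsBigO.mul hf hg.isBigO_one
  have h2 := IsBigO.mul (polynomial a b c d e).isBigO_one hg
  have h3 : (fun q : ℂ => q ^ 5 * ((b * e' + c * d' + d * c' + e * b') +
      (c * e' + d * d' + e * c') * q + (d * e' + e * d') * q ^ 2 + e * e' * q ^ 3))
      =O[𝓝 0] (fun q => q ^ 5) := isBigO_pow_of_continuousAt_mul (by fun_prop) 5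
  simp only [mul_one, one_mul] at h1 h2
  exact ((h1.add h2).add h3).congr_left fun q => by ring

theorem const_mul (k : ℂ) (hf : HasJet f a b c d e) :
    HasJet (fun q => k * f q) (k * a) (k * b) (k * c) (k * d) (k * e) :=
  (IsBigO.const_mul_left hf k).congr_left fun q => by ring

theorem congr_coeff (hf : HasJet f a b c d e) (ha : a = a') (hb : b = b') (hc : c = c')
    (hd : d = d') (he : e = e') : HasJet f a' b' c' d' e' := by
  subst ha hb hc hd he; exact hf

theorem congr_fun (hf : HasJet f a b c d e) (h : ∀ q, g q = f q) : HasJet g a b c d e :=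
  funext h ▸ hf

/-- Only the constant term survives, since 7 exceeds the order of the jet; this is why level 7
contributes nothing to the first coefficients. -/
theorem comp_pow_seven (hf : HasJet f a b c d e) :
    HasJet (fun q => f (q ^ 7)) a 0 0 0 0 := by
  have ht : Tendsto (fun q : ℂ => q ^ 7) (𝓝 0) (𝓝 0) := by
    have : ContinuousAt (fun q : ℂ => q ^ 7) 0 := by fun_prop
    simpa [ContinuousAt] using this
  have h1 := IsBigO.comp_tendsto hf ht
  have h2 : (fun q : ℂ => q ^ 5 * q ^ 30) =O[𝓝 0] (fun q => q ^ 5) :=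
    isBigO_pow_of_continuousAt_mul (by fun_prop) 5
  have h3 : (fun q : ℂ => q ^ 5 * (b * q ^ 2 + c * q ^ 9 + d * q ^ 16 + e * q ^ 23))
      =O[𝓝 0] (fun q => q ^ 5) := isBigO_pow_of_continuousAt_mul (by fun_prop) 5
  refine ((h1.trans (h2.congr_left fun q => ?_)).add h3).congr_left fun q => ?_
  · simp only [Function.comp_apply]; ring
  · simp only [Function.comp_apply]; ring

/-- A function with vanishing jet is `O(q⁵)`. -/
theorem isBigO_pow_five (hf : HasJet f 0 0 0 0 0) : f =O[𝓝 0] (fun q => q ^ 5) := by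
  simpa [HasJet] using hf

end HasJet

/-! ### The Euler function -/

theorem norm_tprod_one_add_sub_one_le {f : ℕ → ℂ} (hf : Summable fun n => ‖f n‖) :
    ‖∏' n, (1 + f n) - 1‖ ≤ Real.exp (∑' n, ‖f n‖) - 1 := by
  have h1 : Tendsto (fun s : Finset ℕ => ‖∏ n ∈ s, (1 + f n) - 1‖) atTop
      (𝓝 ‖∏' n, (1 + f n) - 1‖) :=
    (((multipliable_one_add_of_summable hf).hasProd).sub_const 1).norm
  refine le_of_tendsto h1 (Eventually.of_forall fun s => ?_)
  refine (s.norm_prod_one_add_sub_one_le f).trans ?_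
  gcongr
  exact hf.sum_le_tsum s fun _ _ => norm_nonneg _

/-- The Euler function `∏ (1 - qⁿ)`. -/
def euler (q : ℂ) : ℂ := ∏' n : ℕ, (1 - q ^ (n + 1))

theorem summable_norm_neg_pow_add {q : ℂ} (hq : ‖q‖ < 1) (k : ℕ) :
    Summable fun n : ℕ => ‖-q ^ (n + k)‖ := by
  simpa using (summable_nat_add_iff k).mpr (summable_geometric_of_lt_one (norm_nonneg _) hq)

theorem euler_ne_zero {q : ℂ} (hq : ‖q‖ < 1) : euler q ≠ 0 := by
  have := tprod_one_add_ne_zero_of_summable (f := fun n : ℕ => -q ^ (n + 1)) ?_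
    (summable_norm_neg_pow_add hq 1)
  · simpa [euler, sub_eq_add_neg] using this
  · intro n h
    have h1 : q ^ (n + 1) = 1 := by linear_combination -h
    have h2 : ‖q‖ ^ (n + 1) < 1 := pow_lt_one₀ (norm_nonneg _) hq (by omega)
    rw [← norm_pow, h1] at h2
    simp at h2

theorem differentiableOn_euler : DifferentiableOn ℂ euler (Metric.ball 0 1) :=
  ModularForm.differentiableOn_tprod_one_sub_pow

theorem euler_conj (q : ℂ) : euler ((starRingEnd ℂ) q) = (starRingEnd ℂ) (euler q) := by
  unfold euler
  rw [Function.LeftInverse.map_tprod (g := starRingEnd ℂ) (g' := starRingEnd ℂ) _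
    Complex.continuous_conj Complex.continuous_conj Complex.conj_conj]
  simp

/-- The factors with n ≥ 5 multiply to 1 + O(q⁵), so only the first four factors matter. -/
theorem hasJet_euler : HasJet euler 1 (-1) (-1) 0 0 := by
  have htail : (fun q : ℂ => (∏' n : ℕ, (1 + -q ^ (n + 4 + 1))) - 1) =O[𝓝 0]
      (fun q => q ^ 5) := by
    -- For |q| < 1/2 the geometric tail is at most 2|q|⁵, and exp x - 1 ≤ 2x for 0 ≤ x ≤ 1; together
    -- these give the constant 4.
    refine IsBigO.of_bound 4 ?_
    have : ∀ᶠ q : ℂ in 𝓝 0, ‖q‖ < 1 / 2 := by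
      filter_upwards [Metric.ball_mem_nhds (0 : ℂ) (by norm_num : (0 : ℝ) < 1 / 2)] with q hq
      simpa using hq
    filter_upwards [this] with q hq
    have hq1 : ‖q‖ < 1 := by linarith
    have hs := summable_norm_neg_pow_add hq1 5
    have hle := norm_tprod_one_add_sub_one_le hs
    have hval : ∑' n : ℕ, ‖-q ^ (n + 5)‖ = ‖q‖ ^ 5 * (1 - ‖q‖)⁻¹ := by
      rw [← tsum_geometric_of_lt_one (norm_nonneg _) hq1, ← tsum_mul_left]
      refine tsum_congr fun n => ?_
      rw [norm_neg, norm_pow]; ring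
    have hinv : (1 - ‖q‖)⁻¹ ≤ 2 := by
      rw [inv_le_comm₀ (by linarith) (by norm_num)]; linarith
    have h5 : ‖q‖ ^ 5 ≤ (1 / 2) ^ 5 := pow_le_pow_left₀ (norm_nonneg _) hq.le 5
    have hb : ∑' n : ℕ, ‖-q ^ (n + 5)‖ ≤ 2 * ‖q‖ ^ 5 := by
      rw [hval, mul_comm 2]
      exact mul_le_mul_of_nonneg_left hinv (by positivity)
    have hnn : 0 ≤ ∑' n : ℕ, ‖-q ^ (n + 5)‖ := tsum_nonneg fun _ => norm_nonneg _
    have hexp := Real.abs_exp_sub_one_le (x := ∑' n : ℕ, ‖-q ^ (n + 5)‖)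
      (by rw [abs_of_nonneg hnn]; norm_num at h5; linarith)
    rw [abs_of_nonneg hnn] at hexp
    simp only [add_assoc, Nat.reduceAdd, norm_pow]
    linarith [le_abs_self (Real.exp (∑' n : ℕ, ‖-q ^ (n + 5)‖) - 1)]
  have hR : HasJet (fun q : ℂ => ∏' n : ℕ, (1 + -q ^ (n + 4 + 1))) 1 0 0 0 0 := by
    simpa [HasJet] using htail
  have h12 := (HasJet.polynomial 1 (-1) 0 0 0).mul (HasJet.polynomial 1 0 (-1) 0 0)
  have h34 := (HasJet.polynomial 1 0 0 (-1) 0).mul (HasJet.polynomial 1 0 0 0 (-1))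
  have h := ((h12.mul h34).mul hR).congr_coeff (a' := 1) (b' := -1) (c' := -1) (d' := 0) (e' := 0)
    (by norm_num) (by norm_num) (by norm_num) (by norm_num) (by norm_num)
  refine IsBigO.congr' h ?_ EventuallyEq.rfl
  filter_upwards [Metric.ball_mem_nhds (0 : ℂ) one_pos] with q hq
  have hq1 : ‖q‖ < 1 := by simpa using hq
  have hm : Multipliable fun n : ℕ => 1 - q ^ (n + 4 + 1) := by
    simpa [sub_eq_add_neg] using
      multipliable_one_add_of_summable (summable_norm_neg_pow_add hq1 5)
  have := hm.prod_mul_tprod_nat_mul' (f := fun n : ℕ => 1 - q ^ (n + 1))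
  rw [euler, ← this]
  simp only [Finset.prod_range_succ, Finset.prod_range_zero, ← sub_eq_add_neg]
  ring

/-! ### Expansions of the Eisenstein series -/

theorem bernoulli_four : bernoulli 4 = -1 / 30 := by
  rw [bernoulli_eq_bernoulli'_of_ne_one (by norm_num), bernoulli'_four]

theorem bernoulli_six : bernoulli 6 = 1 / 42 := by
  rw [bernoulli_eq_bernoulli'_of_ne_one (by norm_num), bernoulli'_def]
  simp [Finset.sum_range_succ, bernoulli'_eq_zero_of_odd (n := 5) (by decide) (by norm_num),
    Nat.choose]
  norm_num

theorem bernoulli_twelve : bernoulli 12 = -691 / 2730 := by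
  have h6 : bernoulli' 6 = 1 / 42 := by
    rw [← bernoulli_eq_bernoulli'_of_ne_one (by norm_num), bernoulli_six]
  have h5 := bernoulli'_eq_zero_of_odd (n := 5) (by decide) (by norm_num)
  have h7 := bernoulli'_eq_zero_of_odd (n := 7) (by decide) (by norm_num)
  have h9 := bernoulli'_eq_zero_of_odd (n := 9) (by decide) (by norm_num)
  have h11 := bernoulli'_eq_zero_of_odd (n := 11) (by decide) (by norm_num)
  have h8 : bernoulli' 8 = -1 / 30 := by
    rw [bernoulli'_def]; simp [Finset.sum_range_succ, h5, h6, h7, Nat.choose]; norm_num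
  have h10 : bernoulli' 10 = 5 / 66 := by
    rw [bernoulli'_def]; simp [Finset.sum_range_succ, h5, h6, h7, h8, h9, Nat.choose]; norm_num
  rw [bernoulli_eq_bernoulli'_of_ne_one (by norm_num), bernoulli'_def]
  simp [Finset.sum_range_succ, h5, h6, h7, h8, h9, h10, h11, Nat.choose]
  norm_num

/-- The level one Eisenstein series as a function of `q`. -/
def eisQ (k : ℕ) (hk : 3 ≤ k) : ℂ → ℂ := cuspFunction 1 (ModularForm.E hk)

theorem eisQ_qParam {k : ℕ} (hk : 3 ≤ k) (z : ℍ) :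
    eisQ k hk (Function.Periodic.qParam 1 z) = ModularForm.E hk z :=
  SlashInvariantFormClass.eq_cuspFunction (ModularForm.E hk) z one_mem_strictPeriods_SL one_ne_zero

theorem differentiableOn_eisQ {k : ℕ} (hk : 3 ≤ k) :
    DifferentiableOn ℂ (eisQ k hk) (Metric.ball 0 1) := fun q hq =>
  (ModularFormClass.differentiableAt_cuspFunction (ModularForm.E hk) one_pos
    one_mem_strictPeriods_SL (by simpa using hq)).differentiableWithinAt

/-- The coefficients are β σ_{k-1}(n) for n ≤ 4, with the divisor sums written out so that they
become numerals once k is fixed. -/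
theorem hasJet_eisQ {k : ℕ} (hk : 3 ≤ k) (hk2 : Even k) (β : ℂ)
    (hβ : -(2 * k / bernoulli k : ℂ) = β) :
    HasJet (eisQ k hk) 1 β (β * (1 + 2 ^ (k - 1))) (β * (1 + 3 ^ (k - 1)))
      (β * (1 + 2 ^ (k - 1) + 4 ^ (k - 1))) := by
  have : Fact (IsCusp OnePoint.infty (MonoidHom.range
      (Matrix.SpecialLinearGroup.mapGL ℝ : Matrix.SpecialLinearGroup (Fin 2) ℤ →* _))) :=
    ⟨Subgroup.isCusp_of_mem_strictPeriods one_pos one_mem_strictPeriods_SL⟩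
  have hps := (hasFPowerSeries_cuspFunction (ModularForm.E hk) one_pos
    (ModularFormClass.analyticAt_cuspFunction_zero (ModularForm.E hk) one_pos
      one_mem_strictPeriods_SL)
    (fun τ => ModularForm.hasSum_qExpansion (ModularForm.E hk) one_pos
      one_mem_strictPeriods_SL τ)).hasFPowerSeriesAt.isBigO_sub_partialSum_pow 5
  have h5 : (fun y : ℂ => ‖y‖ ^ 5) =O[𝓝 0] (fun y : ℂ => y ^ 5) :=
    IsBigO.of_bound 1 (Eventually.of_forall fun y => by simp)
  have hs2 : ArithmeticFunction.sigma (k - 1) 2 = 1 + 2 ^ (k - 1) := by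
    rw [ArithmeticFunction.sigma_apply, show Nat.divisors 2 = {1, 2} by decide]; simp
  have hs3 : ArithmeticFunction.sigma (k - 1) 3 = 1 + 3 ^ (k - 1) := by
    rw [ArithmeticFunction.sigma_apply, show Nat.divisors 3 = {1, 3} by decide]; simp
  have hs4 : ArithmeticFunction.sigma (k - 1) 4 = 1 + 2 ^ (k - 1) + 4 ^ (k - 1) := by
    rw [ArithmeticFunction.sigma_apply, show Nat.divisors 4 = {1, 2, 4} by decide]
    simp; ring
  refine (hps.trans h5).congr_left fun q => ?_
  simp only [zero_add, FormalMultilinearSeries.partialSum, Finset.sum_range_succ,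
    Finset.sum_range_zero, FormalMultilinearSeries.apply_eq_pow_smul_coeff,
    qExpansionFormalMultilinearSeries_coeff, EisensteinSeries.E_qExpansion_coeff hk hk2, hβ,
    hs2, hs3, hs4, ArithmeticFunction.sigma_one]
  simp [eisQ]
  ring

/-- The Fricke Eisenstein series as a function of `q`. -/
def frickeQ (k : ℕ) (hk : 3 ≤ k) (q : ℂ) : ℂ :=
  (1 / ((7 : ℂ) ^ (k / 2) + 1)) * ((7 : ℂ) ^ (k / 2) * eisQ k hk (q ^ 7) + eisQ k hk q)

theorem hasJet_frickeQ {k : ℕ} (hk : 3 ≤ k) (hk2 : Even k) (β : ℂ)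
    (hβ : -(2 * k / bernoulli k : ℂ) = β) :
    HasJet (frickeQ k hk) 1 (β / ((7 : ℂ) ^ (k / 2) + 1))
      (β * (1 + 2 ^ (k - 1)) / ((7 : ℂ) ^ (k / 2) + 1))
      (β * (1 + 3 ^ (k - 1)) / ((7 : ℂ) ^ (k / 2) + 1))
      (β * (1 + 2 ^ (k - 1) + 4 ^ (k - 1)) / ((7 : ℂ) ^ (k / 2) + 1)) := by
  have h := hasJet_eisQ hk hk2 β hβ
  have h7 : (7 : ℂ) ^ (k / 2) + 1 ≠ 0 := by exact_mod_cast Nat.succ_ne_zero (7 ^ (k / 2))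
  refine (((h.comp_pow_seven.const_mul ((7 : ℂ) ^ (k / 2))).add h).const_mul
    (1 / ((7 : ℂ) ^ (k / 2) + 1))).congr_coeff ?_ ?_ ?_ ?_ ?_ <;> field_simp <;> ring

end

/-! ### The nome and the transformation laws under W and V -/

/-- The nome `q = exp (2 π i z)`. -/
def nome (z : ℂ) : ℂ := Function.Periodic.qParam 1 z

theorem nome_eq (z : ℂ) : nome z = Complex.exp (2 * Real.pi * Complex.I * z) := by
  simp [nome, Function.Periodic.qParam]

theorem nome_ne_zero (z : ℂ) : nome z ≠ 0 := by rw [nome_eq]; exact Complex.exp_ne_zero _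

theorem norm_nome (z : ℂ) : ‖nome z‖ = Real.exp (-2 * Real.pi * z.im) := by
  rw [nome_eq, Complex.norm_exp]; simp

theorem norm_nome_lt_one {z : ℂ} (hz : 0 < z.im) : ‖nome z‖ < 1 := by
  rw [norm_nome, Real.exp_lt_one_iff]
  have := Real.pi_pos
  nlinarith [mul_pos this hz]

theorem nome_mem_ball {z : ℂ} (hz : 0 < z.im) : nome z ∈ Metric.ball (0 : ℂ) 1 := by
  simpa using norm_nome_lt_one hz

theorem nome_seven_mul (z : ℂ) : nome (7 * z) = nome z ^ 7 := by
  rw [nome_eq, nome_eq, ← Complex.exp_nat_mul]; congr 1; push_cast; ring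

theorem nome_add_one (z : ℂ) : nome (z + 1) = nome z := by
  rw [nome_eq, nome_eq, mul_add, Complex.exp_add, mul_one, Complex.exp_two_pi_mul_I, mul_one]

theorem nome_sub_one (z : ℂ) : nome (z - 1) = nome z := by
  rw [← nome_add_one (z - 1), sub_add_cancel]

theorem differentiable_nome : Differentiable ℂ nome := by
  have : nome = fun z => Complex.exp (2 * Real.pi * Complex.I * z) := funext nome_eq
  rw [this]; fun_prop

theorem pow_seven_norm_lt_one {q : ℂ} (hq : ‖q‖ < 1) : ‖q ^ 7‖ < 1 := by
  rw [norm_pow]; exact pow_lt_one₀ (norm_nonneg _) hq (by norm_num)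

theorem exists_nome_eq {q : ℂ} (hq0 : q ≠ 0) (hq : ‖q‖ < 1) : ∃ z : ℂ, 0 < z.im ∧ nome z = q :=
  ⟨Function.Periodic.invQParam 1 q, Function.Periodic.im_invQParam_pos_of_norm_lt_one one_pos hq hq0,
    Function.Periodic.qParam_right_inv one_ne_zero hq0⟩

/-- The discriminant as a function of `q`. -/
def deltaQ (q : ℂ) : ℂ := q * euler q ^ 24

theorem deltaQ_nome (z : ℍ) : deltaQ (nome z) = ModularForm.discriminant z := by
  rw [ModularForm.discriminant_eq_q_prod, deltaQ, euler]
  congr 1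
  exact ((ModularForm.multipliable_one_sub_pow (norm_nome_lt_one z.2)).tprod_pow 24).symm

/-- Serves both the Eisenstein series and the discriminant, with the matrix action unfolded into an
explicit fraction. -/
theorem level_one_moebius {F : Type*} [FunLike F ℍ ℂ] {k : ℤ}
    [SlashInvariantFormClass F (MonoidHom.range
      (Matrix.SpecialLinearGroup.mapGL ℝ : Matrix.SpecialLinearGroup (Fin 2) ℤ →* _)) k]
    (f : F) (a b c d : ℤ) (h : a * d - b * c = 1) (z : ℍ) :
    ∃ w : ℍ, (w : ℂ) = (a * z + b) / (c * z + d) ∧ f w = (c * z + d : ℂ) ^ k * f z := by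
  let γ : Matrix.SpecialLinearGroup (Fin 2) ℤ := ⟨!![a, b; c, d], by simp [Matrix.det_fin_two, h]⟩
  refine ⟨γ • z, ?_, ?_⟩
  · rw [specialLinearGroup_apply]; simp [γ]
  · have h1 := SlashInvariantForm.slash_action_eqn'' f (γ := Matrix.SpecialLinearGroup.mapGL ℝ γ)
      (MonoidHom.mem_range.mpr ⟨γ, rfl⟩) z
    have h2 : γ • z = Matrix.SpecialLinearGroup.mapGL ℝ γ • z := rfl
    rw [h2, h1]
    rw [denom, Matrix.SpecialLinearGroup.mapGL_coe_matrix,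
      Matrix.SpecialLinearGroup.map_apply_coe]
    simp [γ]

theorem eisQ_moebius {k : ℕ} (hk : 3 ≤ k) (a b c d : ℤ) (h : a * d - b * c = 1) {z : ℂ}
    (hz : 0 < z.im) :
    eisQ k hk (nome ((a * z + b) / (c * z + d))) = (c * z + d) ^ k * eisQ k hk (nome z) := by
  obtain ⟨w, hw, hf⟩ := level_one_moebius (ModularForm.E hk) a b c d h ⟨z, hz⟩
  have h1 := eisQ_qParam hk w
  have h2 := eisQ_qParam hk ⟨z, hz⟩
  simp only [hw] at h1
  rw [nome, nome, h1, h2, hf, zpow_natCast]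

theorem deltaQ_moebius (a b c d : ℤ) (h : a * d - b * c = 1) {z : ℂ} (hz : 0 < z.im) :
    deltaQ (nome ((a * z + b) / (c * z + d))) = (c * z + d) ^ 12 * deltaQ (nome z) := by
  obtain ⟨w, hw, hf⟩ := level_one_moebius CuspForm.discriminant a b c d h ⟨z, hz⟩
  have h1 := deltaQ_nome w
  have h2 := deltaQ_nome ⟨z, hz⟩
  simp only [hw] at h1
  rw [h1, h2]
  exact_mod_cast hf

/-- The Fricke involution `z ↦ -1 / (7 z)`. -/
def invW (z : ℂ) : ℂ := -1 / (7 * z)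

/-- The involution of `Γ₀*(7)` fixing `ρ_{7,1}`. -/
def invV (z : ℂ) : ℂ := -(7 * z + 4) / (14 * z + 7)

theorem ne_zero_of_im_pos {z : ℂ} (hz : 0 < z.im) : z ≠ 0 := by
  rintro rfl; simp at hz

theorem im_seven_mul_pos {z : ℂ} (hz : 0 < z.im) : 0 < (7 * z).im := by simpa using hz

theorem two_mul_add_one_ne_zero {z : ℂ} (hz : 0 < z.im) : 2 * z + 1 ≠ 0 :=
  ne_zero_of_im_pos (by simpa using hz)

/-- In the coordinate z + 1/2 centred on the second circle, V has the same shape as W with 28 in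
place of 7, so one computation covers both involutions. -/
theorem invV_add_half {z : ℂ} (hz : 0 < z.im) : invV z + 1 / 2 = -1 / (28 * (z + 1 / 2)) := by
  have h := two_mul_add_one_ne_zero hz
  rw [invV, show 14 * z + 7 = 7 * (2 * z + 1) by ring,
    show 28 * (z + 1 / 2) = 14 * (2 * z + 1) by ring]
  obtain ⟨w, hw⟩ : ∃ w, w = 2 * z + 1 := ⟨_, rfl⟩
  rw [← hw] at h ⊢
  obtain rfl : z = (w - 1) / 2 := by rw [hw]; ring
  field_simp
  ring

theorem im_neg_one_div (c : ℝ) (w : ℂ) : (-1 / (c * w)).im = w.im / (c * ‖w‖ ^ 2) := by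
  rw [← Complex.normSq_eq_norm_sq, neg_div, one_div, mul_inv, Complex.neg_im]
  rw [← Complex.ofReal_inv, Complex.im_ofReal_mul, Complex.inv_im]
  rw [div_eq_mul_inv, div_eq_mul_inv, mul_inv]
  ring

theorem im_invW (z : ℂ) : (invW z).im = z.im / (7 * ‖z‖ ^ 2) := by
  simpa [invW] using im_neg_one_div 7 z

theorem im_invV {z : ℂ} (hz : 0 < z.im) : (invV z).im = z.im / (28 * ‖z + 1 / 2‖ ^ 2) := by
  have h : (invV z).im = (invV z + 1 / 2).im := by simp
  rw [h, invV_add_half hz]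
  simpa using im_neg_one_div 28 (z + 1 / 2)

theorem im_invW_pos {z : ℂ} (hz : 0 < z.im) : 0 < (invW z).im := by
  rw [im_invW]
  have := norm_pos_iff.mpr (ne_zero_of_im_pos hz)
  positivity

theorem im_invV_pos {z : ℂ} (hz : 0 < z.im) : 0 < (invV z).im := by
  rw [im_invV hz]
  have : 0 < ‖z + 1 / 2‖ := norm_pos_iff.mpr (ne_zero_of_im_pos (by simpa using hz))
  positivity

section transformations

variable {z : ℂ}

theorem eisQ_invW {k : ℕ} (hk : 3 ≤ k) (hz : 0 < z.im) :
    eisQ k hk (nome (invW z)) = (7 * z) ^ k * eisQ k hk (nome z ^ 7) := by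
  have := eisQ_moebius hk 0 (-1) 1 0 (by norm_num) (im_seven_mul_pos hz)
  simpa [invW, nome_seven_mul] using this

theorem eisQ_invW_pow {k : ℕ} (hk : 3 ≤ k) (hz : 0 < z.im) :
    eisQ k hk (nome (invW z) ^ 7) = z ^ k * eisQ k hk (nome z) := by
  have := eisQ_moebius hk 0 (-1) 1 0 (by norm_num) hz
  have h := ne_zero_of_im_pos hz
  rw [← nome_seven_mul, show 7 * invW z = -1 / z by rw [invW]; field_simp]
  simpa using this

theorem deltaQ_invW (hz : 0 < z.im) :
    deltaQ (nome (invW z)) = (7 * z) ^ 12 * deltaQ (nome z ^ 7) := by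
  have := deltaQ_moebius 0 (-1) 1 0 (by norm_num) (im_seven_mul_pos hz)
  simpa [invW, nome_seven_mul] using this

theorem deltaQ_invW_pow (hz : 0 < z.im) :
    deltaQ (nome (invW z) ^ 7) = z ^ 12 * deltaQ (nome z) := by
  have := deltaQ_moebius 0 (-1) 1 0 (by norm_num) hz
  have h := ne_zero_of_im_pos hz
  rw [← nome_seven_mul, show 7 * invW z = -1 / z by rw [invW]; field_simp]
  simpa using this

/-- With `invV_eq`: 7·V(z) is an SL₂(ℤ)-image of z, and V(z) is an SL₂(ℤ)-image of 7z. Thus V, like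
W, interchanges the values of a level one form at z and at 7z up to automorphy factors. -/
theorem seven_mul_invV : 7 * invV z = (-7 * z + -4) / (2 * z + 1) := by
  rw [invV, show 14 * z + 7 = 7 * (2 * z + 1) by ring]
  by_cases h : 2 * z + 1 = 0
  · simp [h]
  · field_simp; ring

theorem invV_eq : invV z = (-1 * (7 * z) + -4) / (2 * (7 * z) + 7) := by
  rw [invV]; congr 1 <;> ring

theorem eisQ_invV {k : ℕ} (hk : 3 ≤ k) (hz : 0 < z.im) :
    eisQ k hk (nome (invV z)) = (7 * (2 * z + 1)) ^ k * eisQ k hk (nome z ^ 7) := by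
  have := eisQ_moebius hk (-1) (-4) 2 7 (by norm_num) (im_seven_mul_pos hz)
  push_cast at this
  rw [invV_eq, this, nome_seven_mul]
  ring_nf

theorem eisQ_invV_pow {k : ℕ} (hk : 3 ≤ k) (hz : 0 < z.im) :
    eisQ k hk (nome (invV z) ^ 7) = (2 * z + 1) ^ k * eisQ k hk (nome z) := by
  have := eisQ_moebius hk (-7) (-4) 2 1 (by norm_num) hz
  push_cast at this
  rw [← nome_seven_mul, seven_mul_invV, this]

theorem deltaQ_invV (hz : 0 < z.im) :
    deltaQ (nome (invV z)) = (7 * (2 * z + 1)) ^ 12 * deltaQ (nome z ^ 7) := by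
  have := deltaQ_moebius (-1) (-4) 2 7 (by norm_num) (im_seven_mul_pos hz)
  push_cast at this
  rw [invV_eq, this, nome_seven_mul]
  ring_nf

theorem deltaQ_invV_pow (hz : 0 < z.im) :
    deltaQ (nome (invV z) ^ 7) = (2 * z + 1) ^ 12 * deltaQ (nome z) := by
  have := deltaQ_moebius (-7) (-4) 2 1 (by norm_num) hz
  push_cast at this
  rw [← nome_seven_mul, seven_mul_invV, this]

/-- W swaps the two summands; the weight 7^{k/2} is what makes the swapped sum proportional to the
original one. -/
theorem frickeQ_invW {k : ℕ} (hk : 3 ≤ k) (hk2 : Even k) (hz : 0 < z.im) :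
    frickeQ k hk (nome (invW z)) = 7 ^ (k / 2) * z ^ k * frickeQ k hk (nome z) := by
  have h7 : (7 : ℂ) ^ k = 7 ^ (k / 2) * 7 ^ (k / 2) := by
    rw [← pow_add]; congr 1; obtain ⟨m, rfl⟩ := hk2; omega
  rw [frickeQ, frickeQ, eisQ_invW hk hz, eisQ_invW_pow hk hz, mul_pow, h7]
  ring

theorem frickeQ_invV {k : ℕ} (hk : 3 ≤ k) (hk2 : Even k) (hz : 0 < z.im) :
    frickeQ k hk (nome (invV z)) = 7 ^ (k / 2) * (2 * z + 1) ^ k * frickeQ k hk (nome z) := by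
  have h7 : (7 : ℂ) ^ k = 7 ^ (k / 2) * 7 ^ (k / 2) := by
    rw [← pow_add]; congr 1; obtain ⟨m, rfl⟩ := hk2; omega
  rw [frickeQ, frickeQ, eisQ_invV hk hz, eisQ_invV_pow hk hz, mul_pow, h7]
  ring

end transformations

theorem eisenstein_eq_frickeQ {k : ℕ} (hk : 3 ≤ k) (z : ℍ) :
    eisenstein k hk z = frickeQ k hk (nome z) := by
  rw [eisenstein, frickeQ, nome, eisQ_qParam hk z, ← nome, ← nome_seven_mul]
  have := eisQ_qParam hk (mulSeven z)
  rw [← this]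
  rfl

/-! ### The eta quotient and the eta product -/

/-- `(η(z) / η(7z))⁴` as a function of `q`. -/
def quotQ (q : ℂ) : ℂ := euler q ^ 4 / (q * euler (q ^ 7) ^ 4)

/-- `(η(z) η(7z))¹²` as a function of `q`. -/
def prodQ (q : ℂ) : ℂ := q ^ 4 * euler q ^ 12 * euler (q ^ 7) ^ 12

/-- The transformation law is known for the discriminant only, so it is obtained for t⁶ first; the
ambiguity by a root of unity is removed afterwards. `prodQ_sq` plays the same part for the eta
product. -/
theorem quotQ_pow_six {q : ℂ} (hq0 : q ≠ 0) (hq : ‖q‖ < 1) :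
    quotQ q ^ 6 = deltaQ q / deltaQ (q ^ 7) := by
  have h7 := euler_ne_zero (pow_seven_norm_lt_one hq)
  rw [quotQ, deltaQ, deltaQ]
  field_simp

theorem prodQ_sq (q : ℂ) : prodQ q ^ 2 = deltaQ q * deltaQ (q ^ 7) := by
  rw [prodQ, deltaQ, deltaQ]; ring

theorem deltaQ_ne_zero {q : ℂ} (hq0 : q ≠ 0) (hq : ‖q‖ < 1) : deltaQ q ≠ 0 :=
  mul_ne_zero hq0 (pow_ne_zero _ (euler_ne_zero hq))

theorem quotQ_ne_zero {q : ℂ} (hq0 : q ≠ 0) (hq : ‖q‖ < 1) : quotQ q ≠ 0 :=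
  div_ne_zero (pow_ne_zero _ (euler_ne_zero hq))
    (mul_ne_zero hq0 (pow_ne_zero _ (euler_ne_zero (pow_seven_norm_lt_one hq))))

theorem prodQ_ne_zero {q : ℂ} (hq0 : q ≠ 0) (hq : ‖q‖ < 1) : prodQ q ≠ 0 :=
  mul_ne_zero (mul_ne_zero (pow_ne_zero _ hq0) (pow_ne_zero _ (euler_ne_zero hq)))
    (pow_ne_zero _ (euler_ne_zero (pow_seven_norm_lt_one hq)))

theorem differentiableOn_euler_pow_seven :
    DifferentiableOn ℂ (fun q => euler (q ^ 7)) (Metric.ball 0 1) :=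
  differentiableOn_euler.comp (by fun_prop) fun q hq => by
    simpa using pow_seven_norm_lt_one (by simpa using hq)

theorem differentiableOn_prodQ : DifferentiableOn ℂ prodQ (Metric.ball 0 1) := by
  have h1 := differentiableOn_euler
  have h2 := differentiableOn_euler_pow_seven
  unfold prodQ
  fun_prop

theorem differentiableOn_quotQ : DifferentiableOn ℂ quotQ (Metric.ball 0 1 \ {0}) := by
  have h1 := differentiableOn_euler.mono (Set.sdiff_subset (t := {(0 : ℂ)}))
  have h2 := differentiableOn_euler_pow_seven.mono (Set.sdiff_subset (t := {(0 : ℂ)}))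
  refine (h1.pow 4).div (differentiableOn_id.mul (h2.pow 4)) fun q hq => ?_
  exact mul_ne_zero hq.2
    (pow_ne_zero _ (euler_ne_zero (pow_seven_norm_lt_one (by simpa using hq.1))))

theorem differentiableOn_frickeQ {k : ℕ} (hk : 3 ≤ k) :
    DifferentiableOn ℂ (frickeQ k hk) (Metric.ball 0 1) := by
  have h1 := differentiableOn_eisQ hk
  have h2 : DifferentiableOn ℂ (fun q => eisQ k hk (q ^ 7)) (Metric.ball 0 1) :=
    h1.comp (by fun_prop) fun q hq => by
      simpa using pow_seven_norm_lt_one (by simpa using hq)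
  unfold frickeQ
  fun_prop

/-- The upper half plane as a subset of `ℂ`. -/
def uhp : Set ℂ := {z | 0 < z.im}

theorem isOpen_uhp : IsOpen uhp := isOpen_lt continuous_const Complex.continuous_im

theorem isPreconnected_uhp : IsPreconnected uhp := (convex_halfSpace_im_gt 0).isPreconnected

theorem differentiableOn_comp_nome {f : ℂ → ℂ} (hf : DifferentiableOn ℂ f (Metric.ball 0 1 \ {0})) :
    DifferentiableOn ℂ (fun z => f (nome z)) uhp :=
  hf.comp differentiable_nome.differentiableOn fun z hz => ⟨nome_mem_ball hz, nome_ne_zero z⟩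

theorem differentiableOn_invW : DifferentiableOn ℂ invW uhp := by
  unfold invW
  refine DifferentiableOn.div (by fun_prop) (by fun_prop) fun z hz => ?_
  exact mul_ne_zero (by norm_num) (ne_zero_of_im_pos hz)

theorem differentiableOn_invV : DifferentiableOn ℂ invV uhp := by
  unfold invV
  refine DifferentiableOn.div (by fun_prop) (by fun_prop) fun z hz => ?_
  rw [show 14 * z + 7 = 7 * (2 * z + 1) by ring]
  exact mul_ne_zero (by norm_num) (two_mul_add_one_ne_zero hz)

/-- A holomorphic function with values in the `n`-th roots of unity that equals `1` at one point
is identically `1`. -/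
theorem eq_one_of_pow_eq_one {c : ℂ → ℂ} (hc : DifferentiableOn ℂ c uhp) {n : ℕ} (hn : n ≠ 0)
    (h : ∀ z ∈ uhp, c z ^ n = 1) {z₀ : ℂ} (hz₀ : z₀ ∈ uhp) (h0 : c z₀ = 1) {z : ℂ}
    (hz : z ∈ uhp) : c z = 1 := by
  rw [← h0]
  refine isOpen_uhp.is_const_of_deriv_eq_zero isPreconnected_uhp hc (fun w hw => ?_) hz hz₀
  have hd := (hc.differentiableAt (isOpen_uhp.mem_nhds hw)).hasDerivAt.pow n
  -- Differentiating cⁿ = 1 gives n cⁿ⁻¹ c' = 0, and c has no zeros, so c' = 0.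
  have hconst : HasDerivAt (c ^ n) 0 w := by
    refine (hasDerivAt_const w (1 : ℂ)).congr_of_eventuallyEq ?_
    filter_upwards [isOpen_uhp.mem_nhds hw] with x hx using h x hx
  have h1 := hd.unique hconst
  have h2 : c w ≠ 0 := fun h' => by simpa [h', hn] using h w hw
  simpa [hn, h2] using h1

/-- The fixed point of `invW`. -/
def ptI : ℂ := ⟨0, 1 / √7⟩

/-- The fixed point of `invV`. -/
def ptR : ℂ := ⟨-1 / 2, 1 / (2 * √7)⟩

theorem ptI_mem : ptI ∈ uhp := by simp only [uhp, ptI, Set.mem_ofPred_eq]; positivity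

theorem ptR_mem : ptR ∈ uhp := by simp only [uhp, ptR, Set.mem_ofPred_eq]; positivity

theorem sqrt_seven_sq : (√7 : ℝ) * √7 = 7 := Real.mul_self_sqrt (by norm_num)

theorem seven_mul_ptI_sq : 7 * (ptI * ptI) = -1 := by
  have h := sqrt_seven_sq
  have h0 : (√7 : ℝ) ≠ 0 := by positivity
  apply Complex.ext
  · simp [ptI]; field_simp; linarith
  · simp [ptI]

theorem seven_mul_ptR_sq : 7 * ((2 * ptR + 1) * (2 * ptR + 1)) = -1 := by
  have h := sqrt_seven_sq
  have h0 : (√7 : ℝ) ≠ 0 := by positivity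
  apply Complex.ext
  · simp [ptR]; field_simp; linarith
  · simp [ptR]; norm_num

theorem invW_ptI : invW ptI = ptI := by
  have h := ne_zero_of_im_pos ptI_mem
  rw [invW, div_eq_iff (by simpa using h)]
  linear_combination -seven_mul_ptI_sq

theorem invV_ptR : invV ptR = ptR := by
  have h := two_mul_add_one_ne_zero ptR_mem
  have h1 : 14 * ptR + 7 ≠ 0 := by
    rw [show 14 * ptR + 7 = 7 * (2 * ptR + 1) by ring]; exact mul_ne_zero (by norm_num) h
  rw [invV, div_eq_iff h1]
  linear_combination -seven_mul_ptR_sq / 2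

theorem nome_conj (z : ℂ) : nome (-(starRingEnd ℂ) z) = (starRingEnd ℂ) (nome z) := by
  rw [nome_eq, nome_eq, ← Complex.exp_conj]; congr 1
  simp [map_ofNat]

theorem quotQ_conj (q : ℂ) : quotQ ((starRingEnd ℂ) q) = (starRingEnd ℂ) (quotQ q) := by
  simp only [quotQ, map_div₀, map_mul, map_pow, ← euler_conj]

/-- The eta quotient is real where the nome is. -/
theorem quotQ_im_of_im {q : ℂ} (hq : q.im = 0) : (quotQ q).im = 0 := by
  rw [← Complex.conj_eq_iff_im] at hq ⊢
  rw [← quotQ_conj, hq]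

theorem nome_im_of_re_zero {z : ℂ} (hz : z.re = 0) : (nome z).im = 0 := by
  rw [← Complex.conj_eq_iff_im, ← nome_conj]
  congr 1; apply Complex.ext <;> simp [hz]

theorem nome_im_of_re_half {z : ℂ} (hz : z.re = -1 / 2) : (nome z).im = 0 := by
  rw [← Complex.conj_eq_iff_im, ← nome_conj, ← nome_add_one z]
  congr 1; apply Complex.ext
  · simp [hz]; norm_num
  · simp

/-- The product divided by 49 is a holomorphic sixth root of unity, hence constant. At the fixed
point of s it equals t²/49 with t real, so it is nonnegative and must be 1. -/
theorem quotQ_mul_aux {s : ℂ → ℂ} (hs : DifferentiableOn ℂ s uhp) (hm : ∀ z ∈ uhp, s z ∈ uhp)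
    (h6 : ∀ z ∈ uhp, (quotQ (nome (s z)) * quotQ (nome z)) ^ 6 = 49 ^ 6) {z₀ : ℂ}
    (hz₀ : z₀ ∈ uhp) (hfix : s z₀ = z₀) (him : (quotQ (nome z₀)).im = 0) {z : ℂ}
    (hz : z ∈ uhp) : quotQ (nome (s z)) * quotQ (nome z) = 49 := by
  have hd := differentiableOn_comp_nome differentiableOn_quotQ
  have h0 : quotQ (nome z₀) * quotQ (nome z₀) / 49 = 1 := by
    have h := h6 z₀ hz₀
    rw [hfix] at h
    obtain ⟨x, hx⟩ : ∃ x : ℝ, quotQ (nome z₀) = x := ⟨_, (Complex.ext rfl (by simpa using him))⟩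
    rw [hx] at h ⊢
    norm_cast at h ⊢
    have h2 : (x * x / 49) ^ 6 = 1 := by rw [div_pow, h]; norm_num
    have h3 := (pow_eq_one_iff_of_nonneg (div_nonneg (mul_self_nonneg x) (by norm_num))
      (by norm_num)).mp h2
    exact h3
  have := eq_one_of_pow_eq_one (c := fun z => quotQ (nome (s z)) * quotQ (nome z) / 49)
    (((hd.comp hs hm).mul hd).div_const 49) (n := 6) (by norm_num)
    (fun z hz => by rw [div_pow, h6 z hz]; norm_num) hz₀ (by simpa only [hfix] using h0) hz
  rwa [div_eq_one_iff_eq (by norm_num)] at this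

theorem quotQ_invW_mul {z : ℂ} (hz : z ∈ uhp) : quotQ (nome (invW z)) * quotQ (nome z) = 49 := by
  refine quotQ_mul_aux differentiableOn_invW (fun z hz => im_invW_pos hz) (fun z hz => ?_)
    ptI_mem invW_ptI (quotQ_im_of_im (nome_im_of_re_zero rfl)) hz
  have h1 := deltaQ_ne_zero (nome_ne_zero z) (norm_nome_lt_one hz)
  have h2 := deltaQ_ne_zero (pow_ne_zero 7 (nome_ne_zero z))
    (pow_seven_norm_lt_one (norm_nome_lt_one hz))
  have h3 := ne_zero_of_im_pos hz
  rw [mul_pow, quotQ_pow_six (nome_ne_zero _) (norm_nome_lt_one (im_invW_pos hz)),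
    quotQ_pow_six (nome_ne_zero _) (norm_nome_lt_one hz), deltaQ_invW hz, deltaQ_invW_pow hz]
  field_simp
  norm_num

theorem quotQ_invV_mul {z : ℂ} (hz : z ∈ uhp) : quotQ (nome (invV z)) * quotQ (nome z) = 49 := by
  refine quotQ_mul_aux differentiableOn_invV (fun z hz => im_invV_pos hz) (fun z hz => ?_)
    ptR_mem invV_ptR (quotQ_im_of_im (nome_im_of_re_half rfl)) hz
  have h1 := deltaQ_ne_zero (nome_ne_zero z) (norm_nome_lt_one hz)
  have h2 := deltaQ_ne_zero (pow_ne_zero 7 (nome_ne_zero z))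
    (pow_seven_norm_lt_one (norm_nome_lt_one hz))
  have h3 := two_mul_add_one_ne_zero hz
  rw [mul_pow, quotQ_pow_six (nome_ne_zero _) (norm_nome_lt_one (im_invV_pos hz)),
    quotQ_pow_six (nome_ne_zero _) (norm_nome_lt_one hz), deltaQ_invV hz, deltaQ_invV_pow hz,
    mul_pow]
  field_simp
  norm_num

/-- The quotient of the two sides is a holomorphic square root of 1, hence constant; the sign is
found at the fixed point, where 7j² = -1 gives 7⁶j¹² = 1. -/
theorem prodQ_aux {s j : ℂ → ℂ} (hs : DifferentiableOn ℂ s uhp) (hm : ∀ z ∈ uhp, s z ∈ uhp)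
    (hj : DifferentiableOn ℂ j uhp) (hj0 : ∀ z ∈ uhp, j z ≠ 0)
    (h2 : ∀ z ∈ uhp, prodQ (nome (s z)) ^ 2 = (7 ^ 6 * j z ^ 12 * prodQ (nome z)) ^ 2) {z₀ : ℂ}
    (hz₀ : z₀ ∈ uhp) (hfix : s z₀ = z₀) (hjz : 7 * (j z₀ * j z₀) = -1) {z : ℂ}
    (hz : z ∈ uhp) : prodQ (nome (s z)) = 7 ^ 6 * j z ^ 12 * prodQ (nome z) := by
  have hd := differentiableOn_comp_nome (differentiableOn_prodQ.mono Set.sdiff_subset)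
  have hp : ∀ z ∈ uhp, prodQ (nome z) ≠ 0 := fun z hz =>
    prodQ_ne_zero (nome_ne_zero z) (norm_nome_lt_one hz)
  have hden : ∀ z ∈ uhp, 7 ^ 6 * j z ^ 12 * prodQ (nome z) ≠ 0 := fun z hz =>
    mul_ne_zero (mul_ne_zero (by norm_num) (pow_ne_zero _ (hj0 z hz))) (hp z hz)
  have := eq_one_of_pow_eq_one
    (c := fun z => prodQ (nome (s z)) / (7 ^ 6 * j z ^ 12 * prodQ (nome z)))
    ((hd.comp hs hm).div (((hj.pow 12).const_mul (7 ^ 6)).mul hd) hden) (n := 2) (by norm_num)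
    (fun z hz => by rw [div_pow, h2 z hz]; exact div_self (pow_ne_zero _ (hden z hz))) hz₀
    (by
      have : (7 : ℂ) ^ 6 * j z₀ ^ 12 = 1 := by
        rw [show (7 : ℂ) ^ 6 * j z₀ ^ 12 = (7 * (j z₀ * j z₀)) ^ 6 by ring, hjz]; norm_num
      simp only [hfix, this, one_mul]
      exact div_self (hp _ hz₀)) hz
  rwa [div_eq_one_iff_eq (hden z hz)] at this

theorem prodQ_invW {z : ℂ} (hz : z ∈ uhp) :
    prodQ (nome (invW z)) = 7 ^ 6 * z ^ 12 * prodQ (nome z) := by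
  refine prodQ_aux (j := fun z => z) differentiableOn_invW (fun z hz => im_invW_pos hz)
    differentiableOn_id (fun z hz => ne_zero_of_im_pos hz) (fun z hz => ?_)
    ptI_mem invW_ptI seven_mul_ptI_sq hz
  rw [prodQ_sq, mul_pow, prodQ_sq, deltaQ_invW hz, deltaQ_invW_pow hz]
  ring

theorem prodQ_invV {z : ℂ} (hz : z ∈ uhp) :
    prodQ (nome (invV z)) = 7 ^ 6 * (2 * z + 1) ^ 12 * prodQ (nome z) := by
  refine prodQ_aux (j := fun z => 2 * z + 1) differentiableOn_invV (fun z hz => im_invV_pos hz)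
    (by fun_prop) (fun z hz => two_mul_add_one_ne_zero hz) (fun z hz => ?_)
    ptR_mem invV_ptR seven_mul_ptR_sq hz
  rw [prodQ_sq, mul_pow, prodQ_sq, deltaQ_invV hz, deltaQ_invV_pow hz]
  ring

/-! ### Invariant functions vanishing at the cusp are zero -/

theorem nome_sub_int (z : ℂ) (n : ℤ) : nome (z - n) = nome z := by
  rw [nome_eq, nome_eq, mul_sub, Complex.exp_sub, mul_comm _ (n : ℂ), Complex.exp_int_mul,
    Complex.exp_two_pi_mul_I, one_zpow, div_one]

theorem norm_sq_eq (z : ℂ) : ‖z‖ ^ 2 = z.re ^ 2 + z.im ^ 2 := by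
  rw [← Complex.normSq_eq_norm_sq, Complex.normSq_apply]; ring

/-- The height 3/25 lies just below √3/14, the height of ρ_{7,2}, so after a translation the point
lies strictly inside the isometric circle of W or of V, and that involution raises it. -/
theorem exists_higher_point {z : ℂ} (hz : z.im = 3 / 25) :
    ∃ w : ℂ, 3 / 25 < w.im ∧ ∀ G : ℂ → ℂ, (∀ z ∈ uhp, G (nome (invW z)) = G (nome z)) →
      (∀ z ∈ uhp, G (nome (invV z)) = G (nome z)) → G (nome w) = G (nome z) := by
  obtain ⟨z', him, hnome, hre⟩ : ∃ z' : ℂ, z'.im = 3 / 25 ∧ nome z' = nome z ∧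
      |z'.re| ≤ 1 / 2 :=
    ⟨z - round z.re, by simpa using hz, nome_sub_int _ _, by simpa using abs_sub_round z.re⟩
  rw [abs_le] at hre
  -- W raises the point when |Re z| ≤ 0.356, as 0.356² + 0.12² < 1/7. Otherwise z or z - 1 has real
  -- part within 0.144 = 0.5 - 0.356 of -1/2, and 0.144² + 0.12² < 1/28 lets V raise it.
  have hV : ∀ w : ℂ, w.im = 3 / 25 → nome w = nome z → (w.re + 1 / 2) ^ 2 ≤ (144 / 1000) ^ 2 →
      3 / 25 < (invV w).im ∧ ∀ G : ℂ → ℂ, (∀ z ∈ uhp, G (nome (invW z)) = G (nome z)) →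
      (∀ z ∈ uhp, G (nome (invV z)) = G (nome z)) → G (nome (invV w)) = G (nome z) := by
    intro w hw hn hle
    have hpos : 0 < w.im := by rw [hw]; norm_num
    refine ⟨?_, fun G _ h => by rw [h w hpos, hn]⟩
    have h1 : ‖w + 1 / 2‖ ^ 2 = (w.re + 1 / 2) ^ 2 + (3 / 25) ^ 2 := by
      rw [norm_sq_eq]; simp [hw]
    rw [im_invV hpos, h1, hw, lt_div_iff₀ (by positivity)]
    nlinarith
  by_cases h1 : |z'.re| ≤ 356 / 1000
  · refine ⟨invW z', ?_, fun G h _ => ?_⟩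
    · rw [im_invW, norm_sq_eq, him, lt_div_iff₀ (by positivity)]
      have := sq_le_sq' (abs_le.mp h1).1 (abs_le.mp h1).2
      nlinarith
    · rw [h z' (by simp [uhp, him]), hnome]
  · rw [abs_le, not_and_or, not_le, not_le] at h1
    rcases h1 with h1 | h1
    · exact ⟨_, hV z' him hnome (by nlinarith)⟩
    · exact ⟨_, hV (z' - 1) (by simpa using him) (by rw [nome_sub_one, hnome])
        (by simp only [Complex.sub_re, Complex.one_re]; nlinarith)⟩

/-- A function of the nome that is holomorphic on the unit disc, vanishes at `0` and is invariant
under the Fricke group is zero. -/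
theorem eq_zero_of_invariant {G : ℂ → ℂ} (hG : DifferentiableOn ℂ G (Metric.ball 0 1))
    (h0 : G 0 = 0) (hW : ∀ z ∈ uhp, G (nome (invW z)) = G (nome z))
    (hV : ∀ z ∈ uhp, G (nome (invV z)) = G (nome z)) {q : ℂ} (hq : q ∈ Metric.ball (0 : ℂ) 1) :
    G q = 0 := by
  -- The circle |q| = r is the image of the line Im z = 3/25.
  obtain ⟨r, hr⟩ : ∃ r, r = Real.exp (-2 * Real.pi * (3 / 25)) := ⟨_, rfl⟩
  have hr0 : 0 < r := hr ▸ Real.exp_pos _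
  have hr1 : r < 1 := by
    rw [hr, Real.exp_lt_one_iff]; have := Real.pi_pos; nlinarith
  have hsub : Metric.closedBall (0 : ℂ) r ⊆ Metric.ball 0 1 := Metric.closedBall_subset_ball hr1
  obtain ⟨p, hp, hmax⟩ := (isCompact_closedBall (0 : ℂ) r).exists_isMaxOn
    ⟨0, Metric.mem_closedBall_self hr0.le⟩ (hG.continuousOn.mono hsub).norm
  -- If |G| is maximal at a boundary point, the higher equivalent point has a nome inside the open
  -- disc with the same value of G. The maximum principle then makes G constant.
  obtain ⟨p', hp', hpp⟩ : ∃ p' ∈ Metric.ball (0 : ℂ) r, G p' = G p := by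
    rcases lt_or_eq_of_le (mem_closedBall_zero_iff.mp hp) with h | h
    · exact ⟨p, mem_ball_zero_iff.mpr h, rfl⟩
    · obtain ⟨z, hz, rfl⟩ := exists_nome_eq (norm_pos_iff.mp (h ▸ hr0)) (h ▸ hr1)
      have him : z.im = 3 / 25 := by
        rw [norm_nome, hr, Real.exp_eq_exp] at h
        exact mul_left_cancel₀ (by have := Real.pi_pos; nlinarith) h
      obtain ⟨w, hw, hinv⟩ := exists_higher_point him
      refine ⟨nome w, ?_, hinv G hW hV⟩
      rw [mem_ball_zero_iff, norm_nome, hr, Real.exp_lt_exp]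
      have := Real.pi_pos
      nlinarith
  have hconst := Complex.eqOn_of_isPreconnected_of_isMaxOn_norm
    (convex_ball (0 : ℂ) r).isPreconnected Metric.isOpen_ball
    (hG.mono (Metric.ball_subset_closedBall.trans hsub)) hp' (fun x hx => by
      have := hmax (Metric.ball_subset_closedBall hx)
      simpa [hpp] using this)
  have hzero : G =ᶠ[𝓝 0] 0 := by
    filter_upwards [Metric.ball_mem_nhds (0 : ℂ) hr0] with x hx
    rw [hconst hx, Function.const_apply, show G p' = G 0 from
      (hconst (Metric.mem_ball_self hr0)).symm, h0, Pi.zero_apply]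
  exact (hG.analyticOnNhd Metric.isOpen_ball).eqOn_zero_of_preconnected_of_eventuallyEq_zero
    (convex_ball (0 : ℂ) 1).isPreconnected (Metric.mem_ball_self one_pos) hzero hq

/-! ### The Hauptmodul and weight twelve forms -/

/-- Numerator of the Hauptmodul. -/
def numQ (q : ℂ) : ℂ :=
  (euler q ^ 4) ^ 2 + 13 * q * (euler q ^ 4 * euler (q ^ 7) ^ 4) +
    49 * q ^ 2 * (euler (q ^ 7) ^ 4) ^ 2

/-- The Hauptmodul `t + 13 + 49 / t`, where `t = (η(z) / η(7z))⁴`, as a function of `q`. -/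
def hauptQ (q : ℂ) : ℂ := numQ q / (q * (euler q ^ 4 * euler (q ^ 7) ^ 4))

theorem hauptQ_eq {q : ℂ} (hq0 : q ≠ 0) (hq : ‖q‖ < 1) :
    hauptQ q = quotQ q + 13 + 49 / quotQ q := by
  have h1 := euler_ne_zero hq
  have h7 := euler_ne_zero (pow_seven_norm_lt_one hq)
  rw [hauptQ, numQ, quotQ]
  field_simp

theorem hauptQ_invW {z : ℂ} (hz : z ∈ uhp) : hauptQ (nome (invW z)) = hauptQ (nome z) := by
  have h0 := quotQ_ne_zero (nome_ne_zero z) (norm_nome_lt_one hz)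
  have h := eq_div_of_mul_eq h0 (quotQ_invW_mul hz)
  rw [hauptQ_eq (nome_ne_zero _) (norm_nome_lt_one (im_invW_pos hz)),
    hauptQ_eq (nome_ne_zero _) (norm_nome_lt_one hz), h]
  field_simp
  ring

theorem hauptQ_invV {z : ℂ} (hz : z ∈ uhp) : hauptQ (nome (invV z)) = hauptQ (nome z) := by
  have h0 := quotQ_ne_zero (nome_ne_zero z) (norm_nome_lt_one hz)
  have h := eq_div_of_mul_eq h0 (quotQ_invV_mul hz)
  rw [hauptQ_eq (nome_ne_zero _) (norm_nome_lt_one (im_invV_pos hz)),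
    hauptQ_eq (nome_ne_zero _) (norm_nome_lt_one hz), h]
  field_simp
  ring

theorem hasJet_euler_pow_four : HasJet (fun q => euler q ^ 4) 1 (-4) 2 8 (-5) :=
  (((hasJet_euler.mul hasJet_euler).mul (hasJet_euler.mul hasJet_euler)).congr_coeff
    (by norm_num) (by norm_num) (by norm_num) (by norm_num) (by norm_num)).congr_fun
    fun q => by ring

theorem hasJet_euler_pow_seven_pow_four :
    HasJet (fun q => euler (q ^ 7) ^ 4) 1 0 0 0 0 :=
  hasJet_euler_pow_four.comp_pow_seven

theorem hasJet_den : HasJet (fun q => euler q ^ 4 * euler (q ^ 7) ^ 4) 1 (-4) 2 8 (-5) :=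
  (hasJet_euler_pow_four.mul hasJet_euler_pow_seven_pow_four).congr_coeff
    (by norm_num) (by norm_num) (by norm_num) (by norm_num) (by norm_num)

theorem hasJet_numQ : HasJet numQ 1 5 17 26 34 := by
  have h1 := hasJet_euler_pow_four.mul hasJet_euler_pow_four
  have h2 := (HasJet.id.const_mul 13).mul hasJet_den
  have h3 := ((HasJet.id.mul HasJet.id).const_mul 49).mul
    (hasJet_euler_pow_seven_pow_four.mul hasJet_euler_pow_seven_pow_four)
  exact (((h1.add h2).add h3).congr_coeff
    (by norm_num) (by norm_num) (by norm_num) (by norm_num) (by norm_num)).congr_fun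
    fun q => by rw [numQ]; ring

/-- A weight twelve form for the Fricke group is a quartic polynomial in the Hauptmodul times
`(η(z) η(7z))¹²`, once the first five coefficients agree. -/
theorem eq_quartic_of_hasJet {f : ℂ → ℂ} (hf : DifferentiableOn ℂ f (Metric.ball 0 1))
    (hW : ∀ z ∈ uhp, f (nome (invW z)) = 7 ^ 6 * z ^ 12 * f (nome z))
    (hV : ∀ z ∈ uhp, f (nome (invV z)) = 7 ^ 6 * (2 * z + 1) ^ 12 * f (nome z))
    {c₀ c₁ c₂ c₃ c₄ : ℂ}
    (hjet : HasJet (fun q => (euler q ^ 4 * euler (q ^ 7) ^ 4) * f q -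
      (c₄ * numQ q ^ 4 + q * (c₃ * numQ q ^ 3 * (euler q ^ 4 * euler (q ^ 7) ^ 4)) +
        q ^ 2 * (c₂ * numQ q ^ 2 * (euler q ^ 4 * euler (q ^ 7) ^ 4) ^ 2) +
        q ^ 3 * (c₁ * numQ q * (euler q ^ 4 * euler (q ^ 7) ^ 4) ^ 3) +
        q ^ 4 * (c₀ * (euler q ^ 4 * euler (q ^ 7) ^ 4) ^ 4))) 0 0 0 0 0)
    {z : ℂ} (hz : z ∈ uhp) :
    f (nome z) = prodQ (nome z) * (c₄ * hauptQ (nome z) ^ 4 + c₃ * hauptQ (nome z) ^ 3 +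
      c₂ * hauptQ (nome z) ^ 2 + c₁ * hauptQ (nome z) + c₀) := by
  -- With d = euler(q)⁴ euler(q⁷)⁴, the eta product is q⁴d³ and the Hauptmodul is `numQ`/(qd). Hence
  -- L/(q⁴d⁴) is f/`prodQ` minus the quartic, with all denominators cleared from L.
  obtain ⟨L, hL⟩ : ∃ L : ℂ → ℂ, L = fun q => (euler q ^ 4 * euler (q ^ 7) ^ 4) * f q -
      (c₄ * numQ q ^ 4 + q * (c₃ * numQ q ^ 3 * (euler q ^ 4 * euler (q ^ 7) ^ 4)) +
        q ^ 2 * (c₂ * numQ q ^ 2 * (euler q ^ 4 * euler (q ^ 7) ^ 4) ^ 2) +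
        q ^ 3 * (c₁ * numQ q * (euler q ^ 4 * euler (q ^ 7) ^ 4) ^ 3) +
        q ^ 4 * (c₀ * (euler q ^ 4 * euler (q ^ 7) ^ 4) ^ 4)) := ⟨_, rfl⟩
  rw [← hL] at hjet
  have hE := differentiableOn_euler
  have hE7 := differentiableOn_euler_pow_seven
  have hN : DifferentiableOn ℂ numQ (Metric.ball 0 1) := by unfold numQ; fun_prop
  have hLd : DifferentiableOn ℂ L (Metric.ball 0 1) := by rw [hL]; fun_prop
  obtain ⟨D, hD⟩ : ∃ D : ℂ → ℂ, D = fun q => (euler q ^ 4 * euler (q ^ 7) ^ 4) ^ 4 := ⟨_, rfl⟩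
  have hDd : DifferentiableOn ℂ D (Metric.ball 0 1) := by rw [hD]; fun_prop
  have hD0 : ∀ q ∈ Metric.ball (0 : ℂ) 1, D q ≠ 0 := fun q hq => by
    have hq' : ‖q‖ < 1 := by simpa using hq
    have h1 := euler_ne_zero hq'
    have h2 := euler_ne_zero (pow_seven_norm_lt_one hq')
    simp [hD, h1, h2]
  obtain ⟨G, hG⟩ : ∃ G : ℂ → ℂ, G = fun q => L q / (q ^ 4 * D q) := ⟨_, rfl⟩
  -- This value comes from division by zero; the bound G = O(q) below shows that it is also the
  -- continuous one, so the singularity at 0 is removable.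
  have hG0 : G 0 = 0 := by simp [hG]
  have h0mem : (0 : ℂ) ∈ Metric.ball (0 : ℂ) 1 := Metric.mem_ball_self one_pos
  have hGne : ∀ q ∈ Metric.ball (0 : ℂ) 1, q ≠ 0 → DifferentiableAt ℂ G q := fun q hq hq0 => by
    have h1 := hLd.differentiableAt (Metric.isOpen_ball.mem_nhds hq)
    have h2 := hDd.differentiableAt (Metric.isOpen_ball.mem_nhds hq)
    rw [hG]
    exact h1.div ((differentiableAt_id.pow 4).mul h2) (mul_ne_zero (pow_ne_zero _ hq0) (hD0 q hq))
  have hGO : G =O[𝓝 0] (fun q => q) := by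
    have hcont : ContinuousAt (fun q => (D q)⁻¹) 0 :=
      (hDd.differentiableAt (Metric.isOpen_ball.mem_nhds h0mem)).continuousAt.inv₀ (hD0 0 h0mem)
    have h1 := (hjet.isBigO_pow_five.mul (isBigO_refl (fun q : ℂ => (q ^ 4)⁻¹) (𝓝 0))).mul
      (hcont.isBigO_one ℂ)
    refine (h1.congr_left fun q => ?_).trans (IsBigO.of_bound 1 (Eventually.of_forall fun q => ?_))
    · rw [hG]; simp only [div_eq_mul_inv, mul_inv]; ring
    · by_cases hq : q = 0
      · simp [hq]
      · rw [one_mul, mul_one, show q ^ 5 * (q ^ 4)⁻¹ = q by field_simp]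
  have hGd : DifferentiableOn ℂ G (Metric.ball 0 1) := fun q hq => by
    by_cases hq0 : q = 0
    · subst hq0
      refine (Complex.analyticAt_of_differentiable_on_punctured_nhds_of_continuousAt ?_
        ?_).differentiableAt.differentiableWithinAt
      · filter_upwards [nhdsWithin_le_nhds (Metric.isOpen_ball.mem_nhds h0mem),
          self_mem_nhdsWithin] with q hq hq0 using hGne q hq hq0
      · rw [ContinuousAt, hG0]
        exact hGO.trans_tendsto tendsto_id
    · exact (hGne q hq hq0).differentiableWithinAt
  have key : ∀ z ∈ uhp, G (nome z) = f (nome z) / prodQ (nome z) -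
      (c₄ * hauptQ (nome z) ^ 4 + c₃ * hauptQ (nome z) ^ 3 +
      c₂ * hauptQ (nome z) ^ 2 + c₁ * hauptQ (nome z) + c₀) := fun z hz => by
    have hq0 := nome_ne_zero z
    have h1 := euler_ne_zero (norm_nome_lt_one hz)
    have h2 := euler_ne_zero (pow_seven_norm_lt_one (norm_nome_lt_one hz))
    rw [hG, hL, hD]
    simp only [hauptQ, prodQ]
    field_simp
  have hzero := eq_zero_of_invariant hGd hG0 (fun z hz => by
      have h := prodQ_ne_zero (nome_ne_zero z) (norm_nome_lt_one hz)
      have h' := ne_zero_of_im_pos hz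
      rw [key _ (im_invW_pos hz), key z hz, hauptQ_invW hz, hW z hz, prodQ_invW hz]
      congr 1
      field_simp)
    (fun z hz => by
      have h := prodQ_ne_zero (nome_ne_zero z) (norm_nome_lt_one hz)
      have h' := two_mul_add_one_ne_zero hz
      rw [key _ (im_invV_pos hz), key z hz, hauptQ_invV hz, hV z hz, prodQ_invV hz]
      congr 1
      field_simp) (nome_mem_ball hz)
  rw [key z hz, sub_eq_zero, div_eq_iff
    (prodQ_ne_zero (nome_ne_zero z) (norm_nome_lt_one hz))] at hzero
  rw [hzero, mul_comm]

theorem hasJet_numQ_sq : HasJet (fun q => numQ q ^ 2) 1 10 59 222 617 :=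
  ((hasJet_numQ.mul hasJet_numQ).congr_coeff
    (by norm_num) (by norm_num) (by norm_num) (by norm_num) (by norm_num)).congr_fun
    fun q => by ring

theorem hasJet_den_sq :
    HasJet (fun q => (euler q ^ 4 * euler (q ^ 7) ^ 4) ^ 2) 1 (-8) 20 0 (-70) :=
  ((hasJet_den.mul hasJet_den).congr_coeff
    (by norm_num) (by norm_num) (by norm_num) (by norm_num) (by norm_num)).congr_fun
    fun q => by ring

/-- The jet appearing in `eq_quartic_of_hasJet`. -/
theorem hasJet_quartic {f : ℂ → ℂ} {a b c d e : ℂ} (hf : HasJet f a b c d e)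
    (c₀ c₁ c₂ c₃ c₄ : ℂ) :
    HasJet (fun q => (euler q ^ 4 * euler (q ^ 7) ^ 4) * f q -
      (c₄ * numQ q ^ 4 + q * (c₃ * numQ q ^ 3 * (euler q ^ 4 * euler (q ^ 7) ^ 4)) +
        q ^ 2 * (c₂ * numQ q ^ 2 * (euler q ^ 4 * euler (q ^ 7) ^ 4) ^ 2) +
        q ^ 3 * (c₁ * numQ q * (euler q ^ 4 * euler (q ^ 7) ^ 4) ^ 3) +
        q ^ 4 * (c₀ * (euler q ^ 4 * euler (q ^ 7) ^ 4) ^ 4)))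
      (a - c₄)
      (b - 4 * a - (c₄ * 20 + c₃))
      (c - 4 * b + 2 * a - (c₄ * 218 + c₃ * 11 + c₂))
      (d - 4 * c + 2 * b + 8 * a - (c₄ * 1624 + c₃ * 68 + c₂ * 2 + c₁))
      (e - 4 * d + 2 * c + 8 * b - 5 * a - (c₄ * 9155 + c₃ * 247 - c₂ - c₁ * 7 + c₀)) := by
  have h4 := (hasJet_numQ_sq.mul hasJet_numQ_sq).const_mul c₄
  have h3 := HasJet.id.mul (((hasJet_numQ_sq.mul hasJet_numQ).mul hasJet_den).const_mul c₃)
  have hq2 := HasJet.id.mul HasJet.id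
  have h2 := hq2.mul ((hasJet_numQ_sq.mul hasJet_den_sq).const_mul c₂)
  have h1 := (hq2.mul HasJet.id).mul
    ((hasJet_numQ.mul (hasJet_den_sq.mul hasJet_den)).const_mul c₁)
  have h0 := (hq2.mul hq2).mul ((hasJet_den_sq.mul hasJet_den_sq).const_mul c₀)
  refine (((hasJet_den.mul hf).sub ((((h4.add h3).add h2).add h1).add h0)).congr_coeff
    ?_ ?_ ?_ ?_ ?_).congr_fun fun q => ?_
  all_goals ring

/-! ### The explicit polynomials in weights 4, 6 and 12 -/

section identities

variable {z : ℂ}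

theorem frickeQ_pow_invW {k m : ℕ} (hk : 3 ≤ k) (hk2 : Even k) (hm : k * m = 12) (hz : z ∈ uhp) :
    frickeQ k hk (nome (invW z)) ^ m = 7 ^ 6 * z ^ 12 * frickeQ k hk (nome z) ^ m := by
  have h6 : k / 2 * m = 6 := by obtain ⟨l, rfl⟩ := hk2; rw [← two_mul] at hm ⊢; grind
  rw [frickeQ_invW hk hk2 hz, mul_pow, mul_pow, ← pow_mul, ← pow_mul, h6, hm]

theorem frickeQ_pow_invV {k m : ℕ} (hk : 3 ≤ k) (hk2 : Even k) (hm : k * m = 12) (hz : z ∈ uhp) :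
    frickeQ k hk (nome (invV z)) ^ m = 7 ^ 6 * (2 * z + 1) ^ 12 * frickeQ k hk (nome z) ^ m := by
  have h6 : k / 2 * m = 6 := by obtain ⟨l, rfl⟩ := hk2; rw [← two_mul] at hm ⊢; grind
  rw [frickeQ_invV hk hk2 hz, mul_pow, mul_pow, ← pow_mul, ← pow_mul, h6, hm]

/-- The five equations are triangular: they determine c₄, c₃, c₂, c₁, c₀ in turn from the first five
coefficients of the power. -/
theorem frickeQ_pow_eq {k m : ℕ} (hk : 3 ≤ k) (hk2 : Even k) (hm : k * m = 12) {a b c d e : ℂ}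
    (hjet : HasJet (fun q => frickeQ k hk q ^ m) a b c d e) {c₀ c₁ c₂ c₃ c₄ : ℂ}
    (e₀ : a - c₄ = 0) (e₁ : b - 4 * a - (c₄ * 20 + c₃) = 0)
    (e₂ : c - 4 * b + 2 * a - (c₄ * 218 + c₃ * 11 + c₂) = 0)
    (e₃ : d - 4 * c + 2 * b + 8 * a - (c₄ * 1624 + c₃ * 68 + c₂ * 2 + c₁) = 0)
    (e₄ : e - 4 * d + 2 * c + 8 * b - 5 * a - (c₄ * 9155 + c₃ * 247 - c₂ - c₁ * 7 + c₀) = 0)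
    (hz : z ∈ uhp) :
    frickeQ k hk (nome z) ^ m = prodQ (nome z) * (c₄ * hauptQ (nome z) ^ 4 +
      c₃ * hauptQ (nome z) ^ 3 + c₂ * hauptQ (nome z) ^ 2 + c₁ * hauptQ (nome z) + c₀) :=
  eq_quartic_of_hasJet ((differentiableOn_frickeQ hk).pow m)
    (fun _ hz => frickeQ_pow_invW hk hk2 hm hz) (fun _ hz => frickeQ_pow_invV hk hk2 hm hz)
    ((hasJet_quartic hjet c₀ c₁ c₂ c₃ c₄).congr_coeff e₀ e₁ e₂ e₃ e₄) hz

theorem hasJet_frickeQ_four (hk : 3 ≤ 4) :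
    HasJet (frickeQ 4 hk) 1 (24 / 5) (216 / 5) (672 / 5) (1752 / 5) := by
  refine (hasJet_frickeQ hk (by decide) 240 ?_).congr_coeff ?_ ?_ ?_ ?_ ?_
  · rw [bernoulli_four]; norm_num
  all_goals norm_num

theorem hasJet_frickeQ_six (hk : 3 ≤ 6) :
    HasJet (frickeQ 6 hk) 1 (-63 / 43) (-2079 / 43) (-15372 / 43) (-66591 / 43) := by
  refine (hasJet_frickeQ hk (by decide) (-504) ?_).congr_coeff ?_ ?_ ?_ ?_ ?_
  · rw [bernoulli_six]; norm_num
  all_goals norm_num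

theorem hasJet_frickeQ_twelve (hk : 3 ≤ 12) :
    HasJet (frickeQ 12 hk) 1 (504 / 625355) (1032696 / 625355) (89282592 / 625355)
      (2114961912 / 625355) := by
  refine (hasJet_frickeQ hk (by decide) (65520 / 691) ?_).congr_coeff ?_ ?_ ?_ ?_ ?_
  · rw [bernoulli_twelve]; norm_num
  all_goals norm_num

/-- The left side is a cube, so h vanishes to an order divisible by 3 at each of its zeros; this
later fixes the value at the order three point. -/
theorem frickeQ_four_cube (hk : 3 ≤ 4) (hz : z ∈ uhp) :
    frickeQ 4 hk (nome z) ^ 3 =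
      prodQ (nome z) * (hauptQ (nome z) * (hauptQ (nome z) - 16 / 5) ^ 3) := by
  have h := hasJet_frickeQ_four hk
  have h3 := ((h.mul h).mul h).congr_fun (g := fun q => frickeQ 4 hk q ^ 3) fun q => by ring
  rw [frickeQ_pow_eq hk (by decide) (by norm_num) h3 (c₀ := 0) (c₁ := -4096 / 125)
    (c₂ := 768 / 25) (c₃ := -48 / 5) (c₄ := 1) (by norm_num) (by norm_num) (by norm_num)
    (by norm_num) (by norm_num) hz]
  ring

/-- The simple factors belong to 27 and -1, the values at the two fixed points of order two, where h
has even multiplicity. -/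
theorem frickeQ_six_sq (hk : 3 ≤ 6) (hz : z ∈ uhp) :
    frickeQ 6 hk (nome z) ^ 2 = prodQ (nome z) *
      ((hauptQ (nome z) - 27) * ((hauptQ (nome z) - -1) * (hauptQ (nome z) - 20 / 43) ^ 2)) := by
  have h := hasJet_frickeQ_six hk
  have h2 := (h.mul h).congr_fun (g := fun q => frickeQ 6 hk q ^ 2) fun q => by ring
  rw [frickeQ_pow_eq hk (by decide) (by norm_num) h2 (c₀ := -10800 / 1849) (c₁ := 36040 / 1849)
    (c₂ := -4803 / 1849) (c₃ := -1158 / 43) (c₄ := 1) (by norm_num) (by norm_num) (by norm_num)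
    (by norm_num) (by norm_num) hz]
  ring

theorem frickeQ_twelve (hk : 3 ≤ 12) (hz : z ∈ uhp) :
    frickeQ 12 hk (nome z) = prodQ (nome z) * (hauptQ (nome z) ^ 4 +
      -15008016 / 625355 * hauptQ (nome z) ^ 3 + 31042176 / 625355 * hauptQ (nome z) ^ 2 +
      33039872 / 625355 * hauptQ (nome z) + 190080 / 125071) := by
  have h1 := (hasJet_frickeQ_twelve hk).congr_fun (g := fun q => frickeQ 12 hk q ^ 1)
    fun q => by ring
  have := frickeQ_pow_eq hk (by decide) (by norm_num) h1 (c₀ := 190080 / 125071)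
    (c₁ := 33039872 / 625355) (c₂ := 31042176 / 625355) (c₃ := -15008016 / 625355) (c₄ := 1)
    (by norm_num) (by norm_num) (by norm_num) (by norm_num) (by norm_num) hz
  rwa [pow_one, one_mul] at this

end identities

/-! ### Real values on the boundary and positivity inside -/

/-- The Hauptmodul as a function on the upper half plane. -/
def haupt (z : ℂ) : ℂ := hauptQ (nome z)

theorem differentiableOn_haupt : DifferentiableOn ℂ haupt uhp := by
  refine differentiableOn_comp_nome ?_
  have h1 := differentiableOn_euler.mono (Set.sdiff_subset (t := {(0 : ℂ)}))
  have h2 := differentiableOn_euler_pow_seven.mono (Set.sdiff_subset (t := {(0 : ℂ)}))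
  have hN : DifferentiableOn ℂ numQ (Metric.ball 0 1 \ {0}) := by unfold numQ; fun_prop
  refine hN.div (differentiableOn_id.mul ((h1.pow 4).mul (h2.pow 4))) fun q hq => ?_
  have hq1 : ‖q‖ < 1 := by simpa using hq.1
  exact mul_ne_zero hq.2 (mul_ne_zero (pow_ne_zero _ (euler_ne_zero hq1))
    (pow_ne_zero _ (euler_ne_zero (pow_seven_norm_lt_one hq1))))

theorem analyticAt_haupt {z : ℂ} (hz : z ∈ uhp) : AnalyticAt ℂ haupt z :=
  differentiableOn_haupt.analyticAt (isOpen_uhp.mem_nhds hz)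

theorem haupt_conj (z : ℂ) : haupt (-(starRingEnd ℂ) z) = (starRingEnd ℂ) (haupt z) := by
  simp only [haupt, nome_conj, hauptQ, numQ, map_div₀, map_mul, map_add, map_pow, ← euler_conj]
  simp [map_ofNat]

theorem haupt_add_one (z : ℂ) : haupt (z + 1) = haupt z := by rw [haupt, nome_add_one, haupt]

theorem haupt_im_of_re_zero {z : ℂ} (hz : z.re = 0) : (haupt z).im = 0 := by
  rw [← Complex.conj_eq_iff_im, ← haupt_conj]
  congr 1; apply Complex.ext <;> simp [hz]

theorem haupt_im_of_re_half {z : ℂ} (hz : z.re = -1 / 2) : (haupt z).im = 0 := by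
  rw [← Complex.conj_eq_iff_im, ← haupt_conj, ← haupt_add_one z]
  congr 1; apply Complex.ext
  · simp [hz]; norm_num
  · simp

/-- On its isometric circle the involution acts as the reflection w ↦ -w̄. Invariance then says that
h(z) is its own conjugate, which is how h is seen to be real on both arcs. -/
theorem neg_one_div_eq_neg_conj {c : ℝ} (hc : 0 < c) {w : ℂ} (h : c * (w.re ^ 2 + w.im ^ 2) = 1) :
    -1 / (c * w) = -(starRingEnd ℂ) w := by
  have hw : w ≠ 0 := by rintro rfl; simp at h
  have hc' : (c : ℂ) ≠ 0 := by exact_mod_cast hc.ne'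
  rw [div_eq_iff (mul_ne_zero hc' hw)]
  have h1 : (starRingEnd ℂ) w * w = ((w.re ^ 2 + w.im ^ 2 : ℝ) : ℂ) := by
    rw [← Complex.normSq_eq_conj_mul_self, Complex.normSq_apply]; push_cast; ring
  have h2 : (c : ℂ) * ((w.re ^ 2 + w.im ^ 2 : ℝ) : ℂ) = 1 := by exact_mod_cast h
  linear_combination c * h1 + h2

theorem invW_eq_neg_conj {z : ℂ} (h : z.re ^ 2 + z.im ^ 2 = 1 / 7) :
    invW z = -(starRingEnd ℂ) z := by
  have := neg_one_div_eq_neg_conj (c := 7) (by norm_num) (w := z) (by rw [h]; norm_num)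
  simpa [invW] using this

theorem invV_eq_neg_conj {z : ℂ} (hz : z ∈ uhp) (h : (z.re + 1 / 2) ^ 2 + z.im ^ 2 = 1 / 28) :
    invV z = -(starRingEnd ℂ) (z + 1) := by
  have h1 := neg_one_div_eq_neg_conj (c := 28) (by norm_num) (w := z + 1 / 2)
    (by simp only [one_div] at h ⊢; simp [h])
  have h2 := invV_add_half hz
  push_cast at h1
  rw [h1] at h2
  rw [eq_sub_of_add_eq h2, map_add, map_add]
  simp [map_ofNat]
  ring

theorem haupt_im_of_circle_one {z : ℂ} (hz : z ∈ uhp) (h : z.re ^ 2 + z.im ^ 2 = 1 / 7) :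
    (haupt z).im = 0 := by
  rw [← Complex.conj_eq_iff_im, ← haupt_conj, ← invW_eq_neg_conj h]
  exact hauptQ_invW hz

theorem haupt_im_of_circle_two {z : ℂ} (hz : z ∈ uhp)
    (h : (z.re + 1 / 2) ^ 2 + z.im ^ 2 = 1 / 28) : (haupt z).im = 0 := by
  rw [← Complex.conj_eq_iff_im, ← haupt_conj, ← haupt_add_one,
    show -(starRingEnd ℂ) z + 1 = -(starRingEnd ℂ) (z + 1) + 1 + 1 by simp,
    haupt_add_one, haupt_add_one, ← invV_eq_neg_conj hz h]
  exact hauptQ_invV hz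

theorem HasJet.isBigO_sq {f : ℂ → ℂ} {c d e : ℂ} (hf : HasJet f 0 0 c d e) :
    f =O[𝓝 0] (fun q => q ^ 2) := by
  have h1 : (fun q : ℂ => q ^ 2 * (c + d * q + e * q ^ 2)) =O[𝓝 0] (fun q => q ^ 2) :=
    isBigO_pow_of_continuousAt_mul (by fun_prop) 2
  have h2 : (fun q : ℂ => q ^ 2 * q ^ 3) =O[𝓝 0] (fun q => q ^ 2) :=
    isBigO_pow_of_continuousAt_mul (by fun_prop) 2
  exact ((IsBigO.trans hf (h2.congr_left fun q => by ring)).add h1).congr_left fun q => by ring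

/-- The constant is 9 because 1 + 5q and (1 + 9q)(1 - 4q) agree up to O(q²). -/
theorem tendsto_hauptQ_sub : Tendsto (fun q => hauptQ q - 1 / q) (𝓝[≠] 0) (𝓝 9) := by
  have h0mem : (0 : ℂ) ∈ Metric.ball (0 : ℂ) 1 := Metric.mem_ball_self one_pos
  obtain ⟨D, hD⟩ : ∃ D : ℂ → ℂ, D = fun q => euler q ^ 4 * euler (q ^ 7) ^ 4 := ⟨_, rfl⟩
  have hDd : DifferentiableOn ℂ D (Metric.ball 0 1) := by
    have h1 := differentiableOn_euler
    have h2 := differentiableOn_euler_pow_seven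
    rw [hD]; fun_prop
  have hD0 : ∀ q ∈ Metric.ball (0 : ℂ) 1, D q ≠ 0 := fun q hq => by
    have hq' : ‖q‖ < 1 := by simpa using hq
    have h1 := euler_ne_zero hq'
    have h2 := euler_ne_zero (pow_seven_norm_lt_one hq')
    simp [hD, h1, h2]
  have hcont : ContinuousAt (fun q => (D q)⁻¹) 0 :=
    (hDd.differentiableAt (Metric.isOpen_ball.mem_nhds h0mem)).continuousAt.inv₀ (hD0 0 h0mem)
  have hj := (hasJet_numQ.sub ((HasJet.polynomial 1 9 0 0 0).mul hasJet_den)).congr_coeff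
    (a' := 0) (b' := 0) (by norm_num) (by norm_num) rfl rfl rfl
  have h1 := (hj.isBigO_sq.mul (isBigO_refl (fun q : ℂ => q⁻¹) (𝓝 0))).mul (hcont.isBigO_one ℂ)
  have h2 : (fun q : ℂ => q ^ 2 * q⁻¹ * 1) =O[𝓝 0] (fun q => q) :=
    IsBigO.of_bound 1 (Eventually.of_forall fun q => by
      by_cases hq : q = 0
      · simp [hq]
      · rw [one_mul, mul_one, show q ^ 2 * q⁻¹ = q by field_simp])
  have h3 := ((h1.trans h2).trans_tendsto tendsto_id).mono_left
    (nhdsWithin_le_nhds (a := (0 : ℂ)) (s := {0}ᶜ))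
  have h4 := h3.add_const 9
  rw [zero_add] at h4
  refine h4.congr' ?_
  filter_upwards [nhdsWithin_le_nhds (Metric.isOpen_ball.mem_nhds h0mem),
    self_mem_nhdsWithin] with q hq hq0
  have hd := hD0 q hq
  have hq0' : q ≠ 0 := hq0
  have hdq : euler q ^ 4 * euler (q ^ 7) ^ 4 = D q := by rw [hD]
  simp only [hauptQ, hdq]
  field_simp
  ring

theorem tendsto_nome : Tendsto nome (comap Complex.im atTop) (𝓝[≠] 0) :=
  Function.Periodic.qParam_tendsto one_pos

/-- Near `i∞`, the imaginary part of the Hauptmodul is almost nonnegative on the left half of the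
period strip. -/
theorem haupt_im_ge_near_infty {ε : ℝ} (hε : 0 < ε) :
    ∃ Y : ℝ, ∀ z : ℂ, Y ≤ z.im → -1 / 2 ≤ z.re → z.re ≤ 0 → -ε ≤ (haupt z).im := by
  have h := tendsto_hauptQ_sub.comp tendsto_nome
  have h' : Tendsto (fun z => (hauptQ (nome z) - 1 / nome z).im) (comap Complex.im atTop) (𝓝 0) := by
    have h0 := (Complex.continuous_im.tendsto _).comp h
    rwa [show (9 : ℂ).im = 0 from rfl] at h0
  have := h'.eventually (lt_mem_nhds (neg_lt_zero.mpr hε))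
  rw [eventually_comap] at this
  obtain ⟨Y, hY⟩ := eventually_atTop.mp this
  refine ⟨Y, fun z hz h1 h2 => ?_⟩
  have h3 := hY z.im hz z rfl
  rw [Complex.sub_im] at h3
  -- This imaginary part is e^{2πy} sin(-2πx), and -2πx lies in [0, π].
  have h4 : 0 ≤ (1 / nome z).im := by
    rw [nome_eq, one_div, ← Complex.exp_neg, Complex.exp_im]
    refine mul_nonneg (Real.exp_pos _).le ?_
    have him : (-(2 * Real.pi * Complex.I * z)).im = 2 * Real.pi * -z.re := by simp
    rw [him]
    have := Real.pi_pos
    exact Real.sin_nonneg_of_nonneg_of_le_pi (by nlinarith) (by nlinarith)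
  rw [haupt]
  linarith

/-- The left half of the fundamental domain, without its boundary. -/
def halfDomain : Set ℂ :=
  {z | (-1 / 2 < z.re ∧ z.re < 0) ∧ 1 / 7 < z.re ^ 2 + z.im ^ 2 ∧
    1 / 28 < (z.re + 1 / 2) ^ 2 + z.im ^ 2 ∧ 0 < z.im}

theorem isOpen_halfDomain : IsOpen halfDomain := by
  have h1 := Complex.continuous_re
  have h2 := Complex.continuous_im
  have a1 : IsOpen {w : ℂ | -1 / 2 < w.re} := isOpen_lt (by fun_prop) (by fun_prop)
  have a2 : IsOpen {w : ℂ | w.re < 0} := isOpen_lt (by fun_prop) (by fun_prop)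
  have a3 : IsOpen {w : ℂ | 1 / 7 < w.re ^ 2 + w.im ^ 2} :=
    isOpen_lt (by fun_prop) (by fun_prop)
  have a4 : IsOpen {w : ℂ | 1 / 28 < (w.re + 1 / 2) ^ 2 + w.im ^ 2} :=
    isOpen_lt (by fun_prop) (by fun_prop)
  have a5 : IsOpen {w : ℂ | 0 < w.im} := isOpen_lt (by fun_prop) (by fun_prop)
  exact (a1.inter a2).inter (a3.inter (a4.inter a5))

/-- The circles cross at abscissa -5/14 and height √3/14 > 1/10, the lowest point of the region. The
bound keeps the closure of the half domain inside the upper half plane. -/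
theorem one_tenth_lt_im {x y : ℝ} (h1 : -1 / 2 ≤ x) (h2 : x ≤ 0) (h3 : 1 / 7 ≤ x ^ 2 + y ^ 2)
    (h4 : 1 / 28 ≤ (x + 1 / 2) ^ 2 + y ^ 2) (h5 : 0 ≤ y) : 1 / 10 < y := by
  by_contra! h
  have hy : y ^ 2 ≤ 1 / 100 := by nlinarith
  rcases le_total x (-5 / 14) with hx | hx <;> nlinarith

/-- The maximum principle is applied to exp(ih), of modulus exp(-Im h), on the half domain cut off
at a large height Y. On the frontier h is real, except on the top edge, where Im h ≥ -ε. -/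
theorem haupt_im_nonneg {z : ℂ} (hz : z ∈ halfDomain) : 0 ≤ (haupt z).im := by
  refine le_of_forall_pos_le_add fun ε hε => ?_
  obtain ⟨Y₀, hY₀⟩ := haupt_im_ge_near_infty hε
  obtain ⟨Y, hY, hzY⟩ : ∃ Y, Y₀ ≤ Y ∧ z.im < Y :=
    ⟨max Y₀ (z.im + 1), le_max_left _ _, by linarith [le_max_right Y₀ (z.im + 1)]⟩
  have hopen : IsOpen (halfDomain ∩ {w | w.im < Y}) :=
    isOpen_halfDomain.inter (isOpen_lt Complex.continuous_im continuous_const)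
  have hcl : ∀ w ∈ closure (halfDomain ∩ {w | w.im < Y}), (-1 / 2 ≤ w.re ∧ w.re ≤ 0) ∧
      1 / 7 ≤ w.re ^ 2 + w.im ^ 2 ∧ 1 / 28 ≤ (w.re + 1 / 2) ^ 2 + w.im ^ 2 ∧
      0 ≤ w.im ∧ w.im ≤ Y := by
    have h1 := Complex.continuous_re
    have h2 := Complex.continuous_im
    have a1 : IsClosed {w : ℂ | -1 / 2 ≤ w.re} := isClosed_le (by fun_prop) (by fun_prop)
    have a2 : IsClosed {w : ℂ | w.re ≤ 0} := isClosed_le (by fun_prop) (by fun_prop)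
    have a3 : IsClosed {w : ℂ | 1 / 7 ≤ w.re ^ 2 + w.im ^ 2} :=
      isClosed_le (by fun_prop) (by fun_prop)
    have a4 : IsClosed {w : ℂ | 1 / 28 ≤ (w.re + 1 / 2) ^ 2 + w.im ^ 2} :=
      isClosed_le (by fun_prop) (by fun_prop)
    have a5 : IsClosed {w : ℂ | 0 ≤ w.im} := isClosed_le (by fun_prop) (by fun_prop)
    have a6 : IsClosed {w : ℂ | w.im ≤ Y} := isClosed_le (by fun_prop) (by fun_prop)
    have hclosed := (a1.inter a2).inter (a3.inter (a4.inter (a5.inter a6)))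
    refine fun w hw => closure_minimal ?_ hclosed hw
    rintro w ⟨⟨⟨a, b⟩, c, d, e⟩, f⟩
    exact ⟨⟨a.le, b.le⟩, c.le, d.le, e.le, (show w.im < Y from f).le⟩
  have huhp : closure (halfDomain ∩ {w | w.im < Y}) ⊆ uhp := fun w hw => by
    obtain ⟨⟨a, b⟩, c, d, e, -⟩ := hcl w hw
    have := one_tenth_lt_im a b c d e
    simp only [uhp, Set.mem_ofPred_eq]; linarith
  have hbdd : Bornology.IsBounded (halfDomain ∩ {w | w.im < Y}) := by
    refine (Metric.isBounded_closedBall (x := (0 : ℂ)) (r := 1 + |Y|)).subset fun w hw => ?_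
    obtain ⟨⟨a, b⟩, -, -, e, f⟩ := hcl w (subset_closure hw)
    rw [mem_closedBall_zero_iff]
    refine (Complex.norm_le_abs_re_add_abs_im w).trans (add_le_add ?_ ?_)
    · rw [abs_le]; constructor <;> linarith
    · rw [abs_of_nonneg e]; exact f.trans (le_abs_self Y)
  have hdiff : DiffContOnCl ℂ (fun w => Complex.exp (Complex.I * haupt w))
      (halfDomain ∩ {w | w.im < Y}) :=
    ((differentiableOn_haupt.mono huhp).const_mul Complex.I).cexp.diffContOnCl
  have hnorm : ∀ w, ‖Complex.exp (Complex.I * haupt w)‖ = Real.exp (-(haupt w).im) := fun w => by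
    rw [Complex.norm_exp]; simp
  have hle := Complex.norm_le_of_forall_mem_frontier_norm_le hbdd hdiff (C := Real.exp ε)
    (fun w hw => ?_) (z := z) (subset_closure ⟨hz, hzY⟩)
  · rw [hnorm, Real.exp_le_exp] at hle
    linarith
  · rw [hnorm, Real.exp_le_exp]
    have hw1 := hw.1
    have hw2 : w ∉ halfDomain ∩ {w | w.im < Y} := by
      have := hw.2; rwa [hopen.interior_eq] at this
    obtain ⟨⟨a, b⟩, c, d, e, f⟩ := hcl w hw1
    have hwu := huhp hw1
    rcases a.lt_or_eq with a' | a'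
    swap; · rw [haupt_im_of_re_half a'.symm]; linarith
    rcases b.lt_or_eq with b' | b'
    swap; · rw [haupt_im_of_re_zero b']; linarith
    rcases c.lt_or_eq with c' | c'
    swap; · rw [haupt_im_of_circle_one hwu c'.symm]; linarith
    rcases d.lt_or_eq with d' | d'
    swap; · rw [haupt_im_of_circle_two hwu d'.symm]; linarith
    rcases f.lt_or_eq with f' | f'
    · exact absurd ⟨⟨⟨a', b'⟩, c', d', hwu⟩, f'⟩ hw2
    · have := hY₀ w (by linarith) a b
      linarith

/-! ### Multiplicities of real values -/

theorem exists_sin_neg (β : ℝ) : ∃ x ∈ Set.Ioo 0 (2 * Real.pi), Real.sin (β + x) < 0 := by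
  have hpi := Real.pi_pos
  have h1 : Real.sin (β + Real.pi / 2) = Real.cos β := Real.sin_add_pi_div_two β
  have h2 : Real.sin (β + Real.pi) = -Real.sin β := Real.sin_add_pi β
  have h3 : Real.sin (β + (Real.pi / 2 + Real.pi)) = -Real.cos β := by
    rw [← add_assoc, Real.sin_add_pi, Real.sin_add_pi_div_two]
  rcases lt_trichotomy (Real.cos β) 0 with h | h | h
  · exact ⟨Real.pi / 2, ⟨by linarith, by linarith⟩, by linarith⟩
  · have hs : Real.sin β * Real.sin β = 1 := by nlinarith [Real.sin_sq_add_cos_sq β]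
    rcases mul_self_eq_one_iff.mp hs with h' | h'
    · exact ⟨Real.pi, ⟨by linarith, by linarith⟩, by linarith⟩
    · refine ⟨Real.pi / 4, ⟨by linarith, by linarith⟩, ?_⟩
      rw [Real.sin_add, h, h', Real.cos_pi_div_four]
      have : 0 < √2 := by positivity
      linarith
  · exact ⟨Real.pi / 2 + Real.pi, ⟨by linarith, by linarith⟩, by linarith⟩

/-- An analytic function that is real at the vertex of a sector of opening `θ` and has nonnegative
imaginary part on it takes its value at the vertex with multiplicity less than `2 π / θ`. -/
theorem order_mul_lt_of_im_nonneg {f : ℂ → ℂ} {z₀ u₀ : ℂ} {θ : ℝ} {n : ℕ}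
    (hf : AnalyticAt ℂ f z₀) (him : (f z₀).im = 0)
    (hn : analyticOrderAt (fun z => f z - f z₀) z₀ = n) (hu : u₀ ≠ 0)
    (h : ∀ s ∈ Set.Ioo 0 θ, ∀ᶠ r : ℝ in 𝓝[>] 0,
      0 ≤ (f (z₀ + r * (u₀ * Complex.exp (s * Complex.I)))).im) :
    n * θ < 2 * Real.pi := by
  by_contra! hθ
  have hpi := Real.pi_pos
  have hn0 : (0 : ℝ) < n := by
    rcases Nat.eq_zero_or_pos n with h0 | h0
    · rw [h0] at hθ; norm_num at hθ; linarith
    · exact_mod_cast h0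
  obtain ⟨g, hg, hg0, hfg⟩ := ((hf.sub analyticAt_const).analyticOrderAt_eq_natCast).mp hn
  have hc : u₀ ^ n * g z₀ ≠ 0 := mul_ne_zero (pow_ne_zero _ hu) hg0
  -- Near the vertex f - f(z₀) behaves like rⁿuⁿg(z₀). If nθ ≥ 2π, turning u through the sector
  -- turns this term through a full circle, so some direction makes its imaginary part negative.
  obtain ⟨x, hx, hsin⟩ := exists_sin_neg (u₀ ^ n * g z₀).arg
  obtain ⟨s, hs⟩ : ∃ s, s = x / n := ⟨_, rfl⟩
  have hns : n * s = x := by rw [hs]; field_simp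
  have hsθ : s ∈ Set.Ioo 0 θ := by
    refine ⟨by rw [hs]; exact div_pos hx.1 hn0, ?_⟩
    have : n * s < n * θ := by rw [hns]; linarith [hx.2]
    exact lt_of_mul_lt_mul_left this hn0.le
  obtain ⟨u, hu'⟩ : ∃ u, u = u₀ * Complex.exp (s * Complex.I) := ⟨_, rfl⟩
  have hneg : (u ^ n * g z₀).im < 0 := by
    have h1 : u ^ n * g z₀ = ‖u₀ ^ n * g z₀‖ *
        Complex.exp (((u₀ ^ n * g z₀).arg + x : ℝ) * Complex.I) := by
      rw [hu', mul_pow, ← Complex.exp_nat_mul, ← hns]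
      push_cast
      rw [add_mul, Complex.exp_add, mul_assoc (n : ℂ)]
      linear_combination -Complex.exp (n * (s * Complex.I)) *
        Complex.norm_mul_exp_arg_mul_I (u₀ ^ n * g z₀)
    rw [h1, Complex.im_ofReal_mul, Complex.exp_ofReal_mul_I_im]
    exact mul_neg_of_pos_of_neg (norm_pos_iff.mpr hc) hsin
  have ht : Tendsto (fun r : ℝ => z₀ + r * u) (𝓝[>] 0) (𝓝 z₀) := by
    have : ContinuousAt (fun r : ℝ => z₀ + r * u) 0 := by fun_prop
    have := this.tendsto
    simp only [Complex.ofReal_zero, zero_mul, add_zero] at this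
    exact this.mono_left nhdsWithin_le_nhds
  have h1 : ∀ᶠ r : ℝ in 𝓝[>] 0, (u ^ n * g (z₀ + r * u)).im < 0 := by
    have hcont : Tendsto (fun w => (u ^ n * g w).im) (𝓝 z₀) (𝓝 (u ^ n * g z₀).im) :=
      (Complex.continuous_im.tendsto _).comp (hg.continuousAt.tendsto.const_mul (u ^ n))
    exact (hcont.comp ht).eventually (gt_mem_nhds hneg)
  have h2 := h s hsθ
  obtain ⟨r, hr1, hr2, hr3, hr0⟩ := (h1.and (h2.and ((ht.eventually hfg).and
    self_mem_nhdsWithin))).exists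
  rw [← hu'] at hr2
  have hr0' : (0 : ℝ) < r := hr0
  have h3 : f (z₀ + r * u) - f z₀ = ((r ^ n : ℝ) : ℂ) * (u ^ n * g (z₀ + r * u)) := by
    have h5 : f (z₀ + r * u) - f z₀ = (z₀ + r * u - z₀) ^ n • g (z₀ + r * u) := hr3
    rw [h5]; simp; ring
  have h4 := congrArg Complex.im h3
  rw [Complex.sub_im, him, sub_zero, Complex.im_ofReal_mul] at h4
  have := mul_neg_of_pos_of_neg (pow_pos hr0' n) hr1
  linarith

/-- If h were locally constant it would be constant by the identity theorem, so qh would tend to 0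
as q → 0; but h has a simple pole in q. -/
theorem haupt_order_ne_top {z : ℂ} (hz : z ∈ uhp) (c : ℂ) :
    analyticOrderAt (fun w => haupt w - c) z ≠ ⊤ := by
  intro h
  rw [analyticOrderAt_eq_top] at h
  have hd : DifferentiableOn ℂ (fun w => haupt w - c) uhp := differentiableOn_haupt.sub_const c
  have heq := (hd.analyticOnNhd isOpen_uhp).eqOn_zero_of_preconnected_of_eventuallyEq_zero
    isPreconnected_uhp hz h
  have h1 : Tendsto (fun q : ℂ => q * (hauptQ q - (hauptQ q - 1 / q))) (𝓝[≠] 0)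
      (𝓝 (0 * (c - 9))) := by
    refine (tendsto_id.mono_left nhdsWithin_le_nhds).mul (Tendsto.sub ?_ tendsto_hauptQ_sub)
    refine tendsto_const_nhds.congr' ?_
    filter_upwards [nhdsWithin_le_nhds (Metric.ball_mem_nhds (0 : ℂ) one_pos),
      self_mem_nhdsWithin] with q hq hq0
    obtain ⟨w, hw, rfl⟩ := exists_nome_eq hq0 (by simpa using hq)
    exact (sub_eq_zero.mp (heq hw)).symm
  have h2 : Tendsto (fun q : ℂ => q * (hauptQ q - (hauptQ q - 1 / q))) (𝓝[≠] 0) (𝓝 1) := by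
    refine tendsto_const_nhds.congr' ?_
    filter_upwards [self_mem_nhdsWithin] with q hq0
    have : q ≠ 0 := hq0
    field_simp
    ring
  have := tendsto_nhds_unique h1 h2
  simp at this

/-- The order of `haupt` at a point from which a sector of opening `θ` leads into the half
domain. -/
theorem exists_haupt_order {z u : ℂ} {θ : ℝ} (hz : z ∈ uhp) (him : (haupt z).im = 0) (hu : u ≠ 0)
    (h : ∀ s ∈ Set.Ioo 0 θ, ∀ᶠ r : ℝ in 𝓝[>] 0,
      z + r * (u * Complex.exp (s * Complex.I)) ∈ halfDomain) :
    ∃ n : ℕ, analyticOrderAt (fun w => haupt w - haupt z) z = n ∧ 0 < n ∧ n * θ < 2 * Real.pi := by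
  obtain ⟨n, hn⟩ := ENat.ne_top_iff_exists.mp (haupt_order_ne_top hz (haupt z))
  refine ⟨n, hn.symm, ?_, order_mul_lt_of_im_nonneg (analyticAt_haupt hz) him hn.symm hu
    fun s hs => (h s hs).mono fun r hr => haupt_im_nonneg hr⟩
  rw [Nat.pos_iff_ne_zero]
  rintro rfl
  have h0 : analyticOrderAt (fun w => haupt w - haupt z) z ≠ 0 := by
    rw [analyticOrderAt_ne_zero]
    exact ⟨(analyticAt_haupt hz).sub analyticAt_const, sub_self _⟩
  exact h0 hn.symm

/-- An interior point admits a sector of opening 2π, so a real value would have multiplicity less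
than 1. -/
theorem haupt_im_pos {z : ℂ} (hz : z ∈ halfDomain) : 0 < (haupt z).im := by
  refine (haupt_im_nonneg hz).lt_of_ne' fun h0 => ?_
  obtain ⟨n, -, hn, hlt⟩ := exists_haupt_order (u := 1) (θ := 2 * Real.pi) hz.2.2.2 h0
    one_ne_zero fun s _ => by
      have ht : ContinuousAt (fun r : ℝ => z + r * (1 * Complex.exp (s * Complex.I))) 0 := by
        fun_prop
      refine nhdsWithin_le_nhds (ht.preimage_mem_nhds (isOpen_halfDomain.mem_nhds ?_))
      simpa using hz
  have h1 : (1 : ℝ) ≤ n := by exact_mod_cast hn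
  have := Real.pi_pos
  nlinarith

/-- Along a ray each inequality defining the half domain is at most quadratic in r; it holds for
small r if it is strict at the start, or is an equality with positive first derivative. -/
theorem eventually_lt_quadratic {a b c d : ℝ} (h : a < b ∨ b = a ∧ 0 < c) :
    ∀ᶠ r : ℝ in 𝓝[>] 0, a < b + r * c + r ^ 2 * d := by
  rcases h with h | ⟨rfl, hc⟩
  · have ht : ContinuousAt (fun r : ℝ => b + r * c + r ^ 2 * d) 0 := by fun_prop
    refine nhdsWithin_le_nhds (ht.eventually (lt_mem_nhds ?_))
    simpa using h
  · have ht : ContinuousAt (fun r : ℝ => c + r * d) 0 := by fun_prop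
    have := nhdsWithin_le_nhds (s := Set.Ioi 0)
      (ht.eventually (lt_mem_nhds (a := 0) (by simpa using hc)))
    filter_upwards [this, self_mem_nhdsWithin] with r hr hr0
    have hr0' : (0 : ℝ) < r := hr0
    nlinarith [mul_pos hr0' hr]

theorem eventually_mem_halfDomain {z w : ℂ}
    (h1 : -1 / 2 < z.re ∨ z.re = -1 / 2 ∧ 0 < w.re) (h2 : z.re < 0 ∨ z.re = 0 ∧ w.re < 0)
    (h3 : 1 / 7 < z.re ^ 2 + z.im ^ 2 ∨
      z.re ^ 2 + z.im ^ 2 = 1 / 7 ∧ 0 < z.re * w.re + z.im * w.im)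
    (h4 : 1 / 28 < (z.re + 1 / 2) ^ 2 + z.im ^ 2 ∨
      (z.re + 1 / 2) ^ 2 + z.im ^ 2 = 1 / 28 ∧ 0 < (z.re + 1 / 2) * w.re + z.im * w.im)
    (h5 : z ∈ uhp) : ∀ᶠ r : ℝ in 𝓝[>] 0, z + r * w ∈ halfDomain := by
  have e1 := eventually_lt_quadratic (d := 0) h1
  have e2 := eventually_lt_quadratic (a := 0) (b := -z.re) (c := -w.re) (d := 0)
    (h2.imp (fun h => by linarith) fun h => ⟨by linarith [h.1], by linarith [h.2]⟩)
  have e3 := eventually_lt_quadratic (c := 2 * (z.re * w.re + z.im * w.im))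
    (d := w.re ^ 2 + w.im ^ 2) (h3.imp id fun h => ⟨h.1, by linarith [h.2]⟩)
  have e4 := eventually_lt_quadratic (c := 2 * ((z.re + 1 / 2) * w.re + z.im * w.im))
    (d := w.re ^ 2 + w.im ^ 2) (h4.imp id fun h => ⟨h.1, by linarith [h.2]⟩)
  have e5 := eventually_lt_quadratic (a := 0) (b := z.im) (c := w.im) (d := 0) (Or.inl h5)
  filter_upwards [e1, e2, e3, e4, e5] with r r1 r2 r3 r4 r5
  have hre : (z + r * w).re = z.re + r * w.re := by simp
  have him : (z + r * w).im = z.im + r * w.im := by simp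
  simp only [halfDomain, Set.mem_ofPred_eq, hre, him]
  refine ⟨⟨by linarith, by linarith⟩, by nlinarith, by nlinarith, by linarith⟩

theorem mul_exp_re (u : ℂ) (s : ℝ) :
    (u * Complex.exp (s * Complex.I)).re = u.re * Real.cos s - u.im * Real.sin s := by
  rw [Complex.mul_re, Complex.exp_ofReal_mul_I_re, Complex.exp_ofReal_mul_I_im]

theorem mul_exp_im (u : ℂ) (s : ℝ) :
    (u * Complex.exp (s * Complex.I)).im = u.re * Real.sin s + u.im * Real.cos s := by
  rw [Complex.mul_im, Complex.exp_ofReal_mul_I_re, Complex.exp_ofReal_mul_I_im]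

theorem order_eq_one_of_lt {z u : ℂ} (hz : z ∈ uhp) (him : (haupt z).im = 0) (hu : u ≠ 0)
    (h : ∀ s ∈ Set.Ioo 0 Real.pi, ∀ᶠ r : ℝ in 𝓝[>] 0,
      z + r * (u * Complex.exp (s * Complex.I)) ∈ halfDomain) :
    analyticOrderAt (fun w => haupt w - haupt z) z = 1 := by
  obtain ⟨n, hn, hpos, hlt⟩ := exists_haupt_order hz him hu h
  have h2 : (n : ℝ) < 2 := lt_of_mul_lt_mul_right hlt Real.pi_pos.le
  have h3 : n < 2 := by exact_mod_cast h2
  have h4 : n = 1 := by omega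
  rw [hn, h4, Nat.cast_one]

theorem deriv_ne_zero_of_order {z : ℂ} (hz : z ∈ uhp)
    (h : analyticOrderAt (fun w => haupt w - haupt z) z = 1) : deriv haupt z ≠ 0 := by
  intro h0
  have h1 := (analyticAt_haupt hz).analyticOrderAt_deriv_add_one
  have h2 : analyticOrderAt (deriv haupt) z ≠ 0 := by
    rw [analyticOrderAt_ne_zero]; exact ⟨(analyticAt_haupt hz).deriv, h0⟩
  rw [h] at h1
  apply h2
  cases hx : analyticOrderAt (deriv haupt) z with
  | top => rw [hx] at h1; simp at h1
  | coe n =>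
    rw [hx] at h1
    have : n + 1 = 1 := by exact_mod_cast h1
    simp only [Nat.add_eq_right] at this
    rw [this]; rfl

section edges

variable {z : ℂ}

theorem order_re_zero (hz : z ∈ uhp) (hre : z.re = 0) (h : 1 / 7 < z.im ^ 2) :
    analyticOrderAt (fun w => haupt w - haupt z) z = 1 := by
  refine order_eq_one_of_lt (u := Complex.I) hz (haupt_im_of_re_zero hre) Complex.I_ne_zero
    fun s hs => ?_
  have hsin := Real.sin_pos_of_pos_of_lt_pi hs.1 hs.2
  refine eventually_mem_halfDomain (Or.inl (by rw [hre]; norm_num)) (Or.inr ⟨hre, ?_⟩)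
    (Or.inl (by rw [hre]; linarith)) (Or.inl (by rw [hre]; nlinarith)) hz
  rw [mul_exp_re]; simpa using hsin

theorem order_re_half (hz : z ∈ uhp) (hre : z.re = -1 / 2) (h : 1 / 28 < z.im ^ 2) :
    analyticOrderAt (fun w => haupt w - haupt z) z = 1 := by
  refine order_eq_one_of_lt (u := -Complex.I) hz (haupt_im_of_re_half hre)
    (neg_ne_zero.mpr Complex.I_ne_zero) fun s hs => ?_
  have hsin := Real.sin_pos_of_pos_of_lt_pi hs.1 hs.2
  refine eventually_mem_halfDomain (Or.inr ⟨hre, ?_⟩) (Or.inl (by rw [hre]; norm_num))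
    (Or.inl (by rw [hre]; nlinarith)) (Or.inl (by rw [hre]; nlinarith)) hz
  rw [mul_exp_re]; simpa using hsin

/-- The vector u = -iz is tangent to the circle, and u e^{is} has inner product |z|² sin s with z,
so the directions with 0 < s < π are those pointing out of the disc. -/
theorem order_circle_one (hz : z ∈ uhp) (h : z.re ^ 2 + z.im ^ 2 = 1 / 7) (h1 : -5 / 14 < z.re)
    (h2 : z.re < 0) : analyticOrderAt (fun w => haupt w - haupt z) z = 1 := by
  refine order_eq_one_of_lt (u := ⟨z.im, -z.re⟩) hz (haupt_im_of_circle_one hz h)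
    (fun h0 => h2.ne (by simpa using congrArg Complex.im h0)) fun s hs => ?_
  have hsin := Real.sin_pos_of_pos_of_lt_pi hs.1 hs.2
  refine eventually_mem_halfDomain (Or.inl (by linarith)) (Or.inl h2)
    (Or.inr ⟨h, ?_⟩) (Or.inl (by nlinarith)) hz
  rw [mul_exp_re, mul_exp_im]
  have : z.re * (z.im * Real.cos s - -z.re * Real.sin s) +
      z.im * (z.im * Real.sin s + -z.re * Real.cos s) =
      (z.re ^ 2 + z.im ^ 2) * Real.sin s := by ring
  rw [this, h]; positivity

theorem order_circle_two (hz : z ∈ uhp) (h : (z.re + 1 / 2) ^ 2 + z.im ^ 2 = 1 / 28)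
    (h1 : -1 / 2 < z.re) (h2 : z.re < -5 / 14) :
    analyticOrderAt (fun w => haupt w - haupt z) z = 1 := by
  refine order_eq_one_of_lt (u := ⟨z.im, -(z.re + 1 / 2)⟩) hz (haupt_im_of_circle_two hz h)
    (fun h0 => (show z.im ≠ 0 from ne_of_gt hz) (by simpa using congrArg Complex.re h0))
    fun s hs => ?_
  have hsin := Real.sin_pos_of_pos_of_lt_pi hs.1 hs.2
  refine eventually_mem_halfDomain (Or.inl h1) (Or.inl (by linarith))
    (Or.inl (by nlinarith)) (Or.inr ⟨h, ?_⟩) hz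
  rw [mul_exp_re, mul_exp_im]
  have : (z.re + 1 / 2) * (z.im * Real.cos s - -(z.re + 1 / 2) * Real.sin s) +
      z.im * (z.im * Real.sin s + -(z.re + 1 / 2) * Real.cos s) =
      ((z.re + 1 / 2) ^ 2 + z.im ^ 2) * Real.sin s := by ring
  rw [this, h]; positivity

end edges

/-- The elliptic point of order three. -/
def ptRho : ℂ := ⟨-5 / 14, √3 / 14⟩

theorem ptRho_mem : ptRho ∈ uhp := by simp only [uhp, ptRho, Set.mem_ofPred_eq]; positivity

theorem sqrt_three_sq : (√3 : ℝ) * √3 = 3 := Real.mul_self_sqrt (by norm_num)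

theorem inv_sqrt_seven_sq : (1 / √7 : ℝ) ^ 2 = 1 / 7 := by
  rw [div_pow, Real.sq_sqrt (by norm_num), one_pow]

theorem inv_two_sqrt_seven_sq : (1 / (2 * √7) : ℝ) ^ 2 = 1 / 28 := by
  rw [div_pow, mul_pow, Real.sq_sqrt (by norm_num)]; norm_num

theorem ptRho_circle_one : ptRho.re ^ 2 + ptRho.im ^ 2 = 1 / 7 := by
  have := sqrt_three_sq
  simp only [ptRho]; nlinarith

theorem ptRho_circle_two : (ptRho.re + 1 / 2) ^ 2 + ptRho.im ^ 2 = 1 / 28 := by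
  have := sqrt_three_sq
  simp only [ptRho]; nlinarith

/-- The corner is a right angle, so the multiplicity is at most 3. This suffices: in weight 6 the
relation for E₆² forces it to be even. The same applies at `ptR`. -/
theorem order_ptI : ∃ n : ℕ, analyticOrderAt (fun w => haupt w - haupt ptI) ptI = n ∧
    0 < n ∧ n < 4 := by
  obtain ⟨n, hn, hpos, hlt⟩ := exists_haupt_order (z := ptI) (u := Complex.I) (θ := Real.pi / 2)
    ptI_mem (haupt_im_of_re_zero rfl) Complex.I_ne_zero fun s hs => by
      have hpi := Real.pi_pos
      have hsin := Real.sin_pos_of_pos_of_lt_pi hs.1 (by linarith [hs.2])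
      have hcos := Real.cos_pos_of_mem_Ioo ⟨by linarith [hs.1], hs.2⟩
      have h7 := inv_sqrt_seven_sq
      have h7' : (0 : ℝ) < 1 / √7 := by positivity
      refine eventually_mem_halfDomain (Or.inl ?_) (Or.inr ⟨rfl, ?_⟩) (Or.inr ⟨?_, ?_⟩)
        (Or.inl ?_) ptI_mem <;> simp only [ptI, mul_exp_re, mul_exp_im, Complex.I_re, Complex.I_im]
      · norm_num
      · linarith
      · rw [h7]; norm_num
      · have := mul_pos h7' hcos
        linarith
      · rw [h7]; norm_num
  refine ⟨n, hn, hpos, ?_⟩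
  have : (n : ℝ) < 4 := by have := Real.pi_pos; nlinarith
  exact_mod_cast this

theorem order_ptR : ∃ n : ℕ, analyticOrderAt (fun w => haupt w - haupt ptR) ptR = n ∧
    0 < n ∧ n < 4 := by
  obtain ⟨n, hn, hpos, hlt⟩ := exists_haupt_order (z := ptR) (u := 1) (θ := Real.pi / 2)
    ptR_mem (haupt_im_of_re_half rfl) one_ne_zero fun s hs => by
      have hpi := Real.pi_pos
      have hsin := Real.sin_pos_of_pos_of_lt_pi hs.1 (by linarith [hs.2])
      have hcos := Real.cos_pos_of_mem_Ioo ⟨by linarith [hs.1], hs.2⟩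
      have h7 := inv_two_sqrt_seven_sq
      have h7' : (0 : ℝ) < 1 / (2 * √7) := by positivity
      refine eventually_mem_halfDomain (Or.inr ⟨rfl, ?_⟩) (Or.inl ?_) (Or.inl ?_)
        (Or.inr ⟨?_, ?_⟩) ptR_mem <;>
        simp only [ptR, mul_exp_re, mul_exp_im, Complex.one_re, Complex.one_im]
      · linarith
      · norm_num
      · rw [h7]; norm_num
      · rw [h7]; norm_num
      · have := mul_pos h7' hsin
        linarith
  refine ⟨n, hn, hpos, ?_⟩
  have : (n : ℝ) < 4 := by have := Real.pi_pos; nlinarith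
  exact_mod_cast this

/-- The corner has angle π/3, with u = -14iρ_{7,2} tangent to the first circle. The multiplicity is
below 6, and the relation for E₄³ later forces it to be divisible by 3. -/
theorem order_ptRho : ∃ n : ℕ, analyticOrderAt (fun w => haupt w - haupt ptRho) ptRho = n ∧
    0 < n ∧ n < 6 := by
  obtain ⟨n, hn, hpos, hlt⟩ := exists_haupt_order (z := ptRho) (u := ⟨√3, 5⟩) (θ := Real.pi / 3)
    ptRho_mem (haupt_im_of_circle_one ptRho_mem ptRho_circle_one)
    (fun h0 => by simpa using congrArg Complex.im h0) fun s hs => by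
      have hpi := Real.pi_pos
      have hsin := Real.sin_pos_of_pos_of_lt_pi hs.1 (by linarith [hs.2])
      have hsin' := Real.sin_pos_of_pos_of_lt_pi (x := Real.pi / 3 - s) (by linarith [hs.2])
        (by linarith [hs.1])
      rw [Real.sin_sub, Real.sin_pi_div_three, Real.cos_pi_div_three] at hsin'
      have h3 := sqrt_three_sq
      refine eventually_mem_halfDomain (Or.inl ?_) (Or.inl ?_) (Or.inr ⟨ptRho_circle_one, ?_⟩)
        (Or.inr ⟨ptRho_circle_two, ?_⟩) ptRho_mem <;>
        simp only [ptRho, mul_exp_re, mul_exp_im]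
      · norm_num
      · norm_num
      · have : -5 / 14 * (√3 * Real.cos s - 5 * Real.sin s) +
            √3 / 14 * (√3 * Real.sin s + 5 * Real.cos s) =
            (25 + √3 * √3) / 14 * Real.sin s := by ring
        rw [this, h3]; positivity
      · have : (-5 / 14 + 1 / 2) * (√3 * Real.cos s - 5 * Real.sin s) +
            √3 / 14 * (√3 * Real.sin s + 5 * Real.cos s) =
            √3 / 2 * Real.cos s + (√3 * √3 - 10) / 14 * Real.sin s := by ring
        rw [this, h3]; linarith
  refine ⟨n, hn, hpos, ?_⟩
  have : (n : ℝ) < 6 := by have := Real.pi_pos; nlinarith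
  exact_mod_cast this

/-! ### Values at the corners and monotonicity along the edges -/

/-- The Euler function is real and nonzero at real arguments and enters through fourth powers, so t
has the sign of q. -/
theorem quotQ_ofReal {x : ℝ} (hx1 : |x| < 1) :
    ∃ y : ℝ, 0 < y ∧ quotQ x = (y / x : ℝ) := by
  have hr : ∀ w : ℝ, |w| < 1 → ∃ e : ℝ, e ≠ 0 ∧ euler w = e := fun w hw => by
    have h1 : (euler w).im = 0 := by
      rw [← Complex.conj_eq_iff_im, ← euler_conj, Complex.conj_ofReal]
    have h2 : euler w = ((euler w).re : ℂ) := Complex.ext rfl (by simpa using h1)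
    refine ⟨(euler w).re, fun h0 => ?_, h2⟩
    rw [h0] at h2
    exact euler_ne_zero (q := (w : ℂ)) (by simpa using hw) (by simpa using h2)
  obtain ⟨e, he, he'⟩ := hr x hx1
  obtain ⟨f, hf, hf'⟩ := hr (x ^ 7) (by rw [abs_pow]; exact pow_lt_one₀ (abs_nonneg _) hx1 (by norm_num))
  refine ⟨e ^ 4 / f ^ 4, by positivity, ?_⟩
  push_cast at hf'
  rw [quotQ, he', hf']
  push_cast
  rw [div_div, mul_comm (x : ℂ)]

theorem quotQ_of_re_zero {z : ℂ} (hz : z ∈ uhp) (hre : z.re = 0) :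
    ∃ x : ℝ, 0 < x ∧ quotQ (nome z) = x := by
  have h : nome z = (Real.exp (-2 * Real.pi * z.im) : ℝ) := by
    rw [nome_eq, Complex.ofReal_exp]
    congr 1
    apply Complex.ext <;> simp [hre]
  have h1 := norm_nome_lt_one hz
  rw [norm_nome] at h1
  obtain ⟨y, hy, hq⟩ := quotQ_ofReal (x := Real.exp (-2 * Real.pi * z.im))
    (by rwa [abs_of_pos (Real.exp_pos _)])
  exact ⟨_, div_pos hy (Real.exp_pos _), by rw [h, hq]⟩

theorem quotQ_of_re_half {z : ℂ} (hz : z ∈ uhp) (hre : z.re = -1 / 2) :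
    ∃ x : ℝ, x < 0 ∧ quotQ (nome z) = x := by
  have h : nome z = (-Real.exp (-2 * Real.pi * z.im) : ℝ) := by
    rw [nome_eq, Complex.ofReal_neg, Complex.ofReal_exp,
      show 2 * Real.pi * Complex.I * z =
        ((-2 * Real.pi * z.im : ℝ) : ℂ) - Real.pi * Complex.I by
        apply Complex.ext <;> simp [hre]; ring,
      Complex.exp_sub, Complex.exp_pi_mul_I, div_neg, div_one]
  have h1 := norm_nome_lt_one hz
  rw [norm_nome] at h1
  obtain ⟨y, hy, hq⟩ := quotQ_ofReal (x := -Real.exp (-2 * Real.pi * z.im))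
    (by rwa [abs_neg, abs_of_pos (Real.exp_pos _)])
  exact ⟨_, div_neg_of_pos_of_neg hy (neg_lt_zero.mpr (Real.exp_pos _)), by rw [h, hq]⟩

theorem haupt_eq {z : ℂ} (hz : z ∈ uhp) :
    haupt z = quotQ (nome z) + 13 + 49 / quotQ (nome z) :=
  hauptQ_eq (nome_ne_zero z) (norm_nome_lt_one hz)

/-- At the fixed point t² = 49, and t > 0 since q > 0; hence h = 7 + 13 + 7. At `ptR` the nome is
negative and h = -7 + 13 - 7. -/
theorem haupt_ptI : haupt ptI = 27 := by
  obtain ⟨x, hx, hq⟩ := quotQ_of_re_zero ptI_mem rfl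
  have h := quotQ_invW_mul ptI_mem
  rw [invW_ptI, hq] at h
  have h' : x * x = 49 := by exact_mod_cast h
  have h7 : x = 7 := by nlinarith
  rw [haupt_eq ptI_mem, hq, h7]
  norm_num

theorem haupt_ptR : haupt ptR = -1 := by
  obtain ⟨x, hx, hq⟩ := quotQ_of_re_half ptR_mem rfl
  have h := quotQ_invV_mul ptR_mem
  rw [invV_ptR, hq] at h
  have h' : x * x = 49 := by exact_mod_cast h
  have h7 : x = -7 := by nlinarith
  rw [haupt_eq ptR_mem, hq, h7]
  norm_num

theorem haupt_ge_of_re_zero {z : ℂ} (hz : z ∈ uhp) (hre : z.re = 0) : 27 ≤ (haupt z).re := by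
  obtain ⟨x, hx, hq⟩ := quotQ_of_re_zero hz hre
  rw [haupt_eq hz, hq, show (x : ℂ) + 13 + 49 / x = ((x + 13 + 49 / x : ℝ) : ℂ) by push_cast; rfl,
    Complex.ofReal_re]
  have : x + 13 + 49 / x - 27 = (x - 7) ^ 2 / x := by field_simp; ring
  have : 0 ≤ (x - 7) ^ 2 / x := by positivity
  linarith

theorem haupt_le_of_re_half {z : ℂ} (hz : z ∈ uhp) (hre : z.re = -1 / 2) :
    (haupt z).re ≤ -1 := by
  obtain ⟨x, hx, hq⟩ := quotQ_of_re_half hz hre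
  rw [haupt_eq hz, hq, show (x : ℂ) + 13 + 49 / x = ((x + 13 + 49 / x : ℝ) : ℂ) by push_cast; rfl,
    Complex.ofReal_re]
  have hx0 := hx.ne
  have : x + 13 + 49 / x - -1 = (x + 7) ^ 2 / x := by field_simp; ring
  have : (x + 7) ^ 2 / x ≤ 0 := div_nonpos_of_nonneg_of_nonpos (sq_nonneg _) hx.le
  linarith

/-- The Hauptmodul is injective along a path on which it is real with nonzero derivative. -/
theorem haupt_injOn_path {s : ℝ → ℂ} {a b : ℝ} (hc : ContinuousOn s (Set.Icc a b))
    (hm : ∀ x ∈ Set.Icc a b, s x ∈ uhp ∧ (haupt (s x)).im = 0)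
    (hd : ∀ x ∈ Set.Ioo a b, ∃ s', HasDerivAt s s' x ∧ s' ≠ 0 ∧
      analyticOrderAt (fun w => haupt w - haupt (s x)) (s x) = 1) :
    Set.InjOn (fun x => (haupt (s x)).re) (Set.Icc a b) := by
  have hcont : ContinuousOn (fun x => (haupt (s x)).re) (Set.Icc a b) :=
    Complex.continuous_re.comp_continuousOn
      (differentiableOn_haupt.continuousOn.comp hc fun x hx => (hm x hx).1)
  have key : ∀ x ∈ Set.Icc a b, ∀ y ∈ Set.Icc a b, x < y →
      (haupt (s x)).re ≠ (haupt (s y)).re := by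
    intro x hx y hy hxy heq
    have hsub : Set.Icc x y ⊆ Set.Icc a b := Set.Icc_subset_Icc hx.1 hy.2
    -- As Im h vanishes along the path, the derivative of h along it is real, and it is nonzero by
    -- the chain rule; Rolle's theorem then excludes equal values.
    have hder : ∀ w ∈ Set.Ioo a b, ∃ f' : ℝ, f' ≠ 0 ∧
        HasDerivAt (fun x => (haupt (s x)).re) f' w := by
      intro w hw
      obtain ⟨s', hs, hs0, ho⟩ := hd w hw
      have hu := (hm w (Set.Ioo_subset_Icc_self hw)).1
      have h1 : HasDerivAt (fun x => haupt (s x)) (s' * deriv haupt (s w)) w :=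
        ((analyticAt_haupt hu).differentiableAt.hasDerivAt).scomp w hs
      have hre := Complex.reCLM.hasFDerivAt.comp_hasDerivAt w h1
      have him := Complex.imCLM.hasFDerivAt.comp_hasDerivAt w h1
      have him0 : HasDerivAt (fun x => (haupt (s x)).im) 0 w := by
        refine (hasDerivAt_const w (0 : ℝ)).congr_of_eventuallyEq ?_
        filter_upwards [Ioo_mem_nhds hw.1 hw.2] with v hv
        exact (hm v (Set.Ioo_subset_Icc_self hv)).2
      have him' : (s' * deriv haupt (s w)).im = 0 := HasDerivAt.unique him him0
      refine ⟨_, fun h0 => ?_, hre⟩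
      have : s' * deriv haupt (s w) = 0 := Complex.ext h0 him'
      exact mul_ne_zero hs0 (deriv_ne_zero_of_order hu ho) this
    choose! f' hf0 hf' using hder
    obtain ⟨c, hcm, hc0⟩ := exists_hasDerivAt_eq_zero hxy (hcont.mono hsub) heq
      fun w hw => hf' w ⟨hx.1.trans_lt hw.1, hw.2.trans_le hy.2⟩
    exact hf0 c ⟨hx.1.trans_lt hcm.1, hcm.2.trans_le hy.2⟩ hc0
  intro x hx y hy heq
  rcases lt_trichotomy x y with h | h | h
  · exact absurd heq (key x hx y hy h)
  · exact h
  · exact absurd heq.symm (key y hy x hx h)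

/-- The weak inequality is t + 49/t ≥ 14; equality would repeat the value at i/√7, against
injectivity along the imaginary axis. -/
theorem haupt_gt_of_re_zero {z : ℂ} (hz : z ∈ uhp) (hre : z.re = 0) (him : 1 / √7 < z.im) :
    27 < (haupt z).re := by
  refine (haupt_ge_of_re_zero hz hre).lt_of_ne fun h => ?_
  have h7 : (0 : ℝ) < 1 / √7 := by positivity
  have hsq := inv_sqrt_seven_sq
  have hz' : z = (⟨0, z.im⟩ : ℂ) := Complex.ext hre rfl
  have hs : ∀ y, HasDerivAt (fun y : ℝ => (y : ℂ) * Complex.I) Complex.I y := fun y => by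
    simpa using (Complex.ofRealCLM.hasDerivAt (x := y)).mul_const Complex.I
  have heq : ∀ y : ℝ, (⟨0, y⟩ : ℂ) = y * Complex.I := fun y => by
    apply Complex.ext <;> simp
  have hinj := haupt_injOn_path (s := fun y : ℝ => (y : ℂ) * Complex.I) (a := 1 / √7) (b := z.im)
    (fun y _ => (hs y).continuousAt.continuousWithinAt)
    (fun y hy => by
      have hy0 : 0 < y := h7.trans_le hy.1
      exact ⟨by simpa [uhp] using hy0, haupt_im_of_re_zero (by simp)⟩)
    (fun y hy => by
      have hy0 : 0 < y := h7.trans hy.1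
      refine ⟨_, hs y, Complex.I_ne_zero, order_re_zero (by simpa [uhp] using hy0) (by simp) ?_⟩
      have : (1 / √7) ^ 2 < y ^ 2 := pow_lt_pow_left₀ hy.1 h7.le (by norm_num)
      simpa [hsq] using this)
  have := hinj (Set.right_mem_Icc.mpr him.le) (Set.left_mem_Icc.mpr him.le) (by
    simp only [← heq, ← hz', ← h]
    change 27 = (haupt ptI).re
    rw [haupt_ptI]; rfl)
  exact him.ne' this

theorem haupt_lt_of_re_half {z : ℂ} (hz : z ∈ uhp) (hre : z.re = -1 / 2)
    (him : 1 / (2 * √7) < z.im) : (haupt z).re < -1 := by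
  refine (haupt_le_of_re_half hz hre).lt_of_ne fun h => ?_
  have h7 : (0 : ℝ) < 1 / (2 * √7) := by positivity
  have hsq := inv_two_sqrt_seven_sq
  have hz' : z = (⟨-1 / 2, z.im⟩ : ℂ) := Complex.ext hre rfl
  have hs : ∀ y, HasDerivAt (fun y : ℝ => ((-1 / 2 : ℝ) : ℂ) + (y : ℂ) * Complex.I) Complex.I y :=
    fun y => by
      simpa using ((Complex.ofRealCLM.hasDerivAt (x := y)).mul_const Complex.I).const_add
        ((-1 / 2 : ℝ) : ℂ)
  have heq : ∀ y : ℝ, (⟨-1 / 2, y⟩ : ℂ) = ((-1 / 2 : ℝ) : ℂ) + y * Complex.I := fun y => by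
    apply Complex.ext
    · rw [Complex.add_re, Complex.ofReal_re]; simp
    · rw [Complex.add_im, Complex.ofReal_im]; simp
  have hinj := haupt_injOn_path (s := fun y : ℝ => ((-1 / 2 : ℝ) : ℂ) + (y : ℂ) * Complex.I)
    (a := 1 / (2 * √7)) (b := z.im)
    (fun y _ => (hs y).continuousAt.continuousWithinAt)
    (fun y hy => by
      have hy0 : 0 < y := h7.trans_le hy.1
      rw [← heq]
      exact ⟨hy0, haupt_im_of_re_half rfl⟩)
    (fun y hy => by
      have hy0 : 0 < y := h7.trans hy.1
      refine ⟨_, hs y, Complex.I_ne_zero, ?_⟩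
      rw [← heq]
      refine order_re_half hy0 rfl ?_
      have : (1 / (2 * √7)) ^ 2 < y ^ 2 := pow_lt_pow_left₀ hy.1 h7.le (by norm_num)
      rwa [hsq] at this)
  have := hinj (Set.right_mem_Icc.mpr him.le) (Set.left_mem_Icc.mpr him.le) (by
    simp only [← heq, ← hz', h]
    change -1 = (haupt ptR).re
    rw [haupt_ptR]; rfl)
  exact him.ne' this

/-- The point above `x` on the circle of centre `-m` and radius `√ρ`. -/
def circlePt (m ρ x : ℝ) : ℂ := ⟨x, √(ρ - (x + m) ^ 2)⟩

theorem circlePt_eq (m ρ x : ℝ) :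
    circlePt m ρ x = (x : ℂ) + (√(ρ - (x + m) ^ 2) : ℝ) * Complex.I := by
  apply Complex.ext <;> simp [circlePt]

theorem continuous_circlePt (m ρ : ℝ) : Continuous (circlePt m ρ) := by
  rw [show circlePt m ρ = _ from funext (circlePt_eq m ρ)]
  fun_prop

theorem circlePt_circle {m ρ x : ℝ} (h : 0 ≤ ρ - (x + m) ^ 2) :
    ((circlePt m ρ x).re + m) ^ 2 + (circlePt m ρ x).im ^ 2 = ρ := by
  simp only [circlePt]; rw [Real.sq_sqrt h]; ring

theorem circlePt_mem {m ρ x : ℝ} (h : 0 < ρ - (x + m) ^ 2) : circlePt m ρ x ∈ uhp :=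
  Real.sqrt_pos.mpr h

theorem eq_circlePt {m ρ : ℝ} {z : ℂ} (hz : z ∈ uhp) (h : (z.re + m) ^ 2 + z.im ^ 2 = ρ) :
    z = circlePt m ρ z.re := by
  refine Complex.ext rfl ?_
  simp only [circlePt]
  rw [show ρ - (z.re + m) ^ 2 = z.im ^ 2 by linarith, Real.sqrt_sq (le_of_lt hz)]

theorem hasDerivAt_circlePt {m ρ x : ℝ} (h : 0 < ρ - (x + m) ^ 2) :
    ∃ s', HasDerivAt (circlePt m ρ) s' x ∧ s' ≠ 0 := by
  have hd : DifferentiableAt ℝ (fun x : ℝ => √(ρ - (x + m) ^ 2)) x :=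
    DifferentiableAt.sqrt (by fun_prop) h.ne'
  have h1 := (Complex.ofRealCLM.hasDerivAt (x := x)).add
    (hd.hasDerivAt.ofReal_comp.mul_const Complex.I)
  rw [show circlePt m ρ = _ from funext (circlePt_eq m ρ)]
  refine ⟨_, h1, fun h0 => ?_⟩
  have := congrArg Complex.re h0
  simp at this

theorem circle_one_pos {x : ℝ} (h1 : -5 / 14 ≤ x) (h2 : x ≤ 0) : 0 < 1 / 7 - (x + 0) ^ 2 := by
  nlinarith

theorem circle_two_pos {x : ℝ} (h1 : -1 / 2 ≤ x) (h2 : x ≤ -5 / 14) :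
    0 < 1 / 28 - (x + 1 / 2) ^ 2 := by
  nlinarith

theorem haupt_injOn_circle_one :
    Set.InjOn (fun x => (haupt (circlePt 0 (1 / 7) x)).re) (Set.Icc (-5 / 14) 0) := by
  have hcirc : ∀ x ∈ Set.Icc (-5 / 14 : ℝ) 0, (circlePt 0 (1 / 7) x).re ^ 2 +
      (circlePt 0 (1 / 7) x).im ^ 2 = 1 / 7 := fun x hx => by
    simpa using circlePt_circle (circle_one_pos hx.1 hx.2).le
  refine haupt_injOn_path (continuous_circlePt 0 (1 / 7)).continuousOn (fun x hx => ?_)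
    fun x hx => ?_
  · have hu := circlePt_mem (circle_one_pos hx.1 hx.2)
    exact ⟨hu, haupt_im_of_circle_one hu (hcirc x hx)⟩
  · have hp := circle_one_pos hx.1.le hx.2.le
    obtain ⟨s', hs, hs0⟩ := hasDerivAt_circlePt hp
    exact ⟨s', hs, hs0, order_circle_one (circlePt_mem hp)
      (hcirc x (Set.Ioo_subset_Icc_self hx)) hx.1 hx.2⟩

theorem haupt_injOn_circle_two :
    Set.InjOn (fun x => (haupt (circlePt (1 / 2) (1 / 28) x)).re)
      (Set.Icc (-1 / 2) (-5 / 14)) := by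
  refine haupt_injOn_path (continuous_circlePt _ _).continuousOn (fun x hx => ?_) fun x hx => ?_
  · have hp := circle_two_pos hx.1 hx.2
    have hu := circlePt_mem hp
    exact ⟨hu, haupt_im_of_circle_two hu (circlePt_circle hp.le)⟩
  · have hp := circle_two_pos hx.1.le hx.2.le
    obtain ⟨s', hs, hs0⟩ := hasDerivAt_circlePt hp
    exact ⟨s', hs, hs0, order_circle_two (circlePt_mem hp) (circlePt_circle hp.le) hx.1 hx.2⟩

theorem circlePt_zero : circlePt 0 (1 / 7) 0 = ptI := by
  refine Complex.ext rfl ?_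
  simp [circlePt, ptI]

theorem circlePt_neg_half : circlePt (1 / 2) (1 / 28) (-1 / 2) = ptR := by
  refine Complex.ext rfl ?_
  simp only [circlePt, ptR]
  rw [show (1 / 28 : ℝ) - (-1 / 2 + 1 / 2) ^ 2 = (1 / (2 * √7)) ^ 2 by
    rw [inv_two_sqrt_seven_sq]; norm_num, Real.sqrt_sq (by positivity)]

theorem circlePt_one_ptRho : circlePt 0 (1 / 7) (-5 / 14) = ptRho :=
  (eq_circlePt ptRho_mem (by simpa using ptRho_circle_one)).symm

theorem circlePt_two_ptRho : circlePt (1 / 2) (1 / 28) (-5 / 14) = ptRho :=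
  (eq_circlePt ptRho_mem ptRho_circle_two).symm

/-! ### The arcs and the elliptic point of order three -/

/-- The Eisenstein series of weight four vanishes at the elliptic point of order three. -/
theorem frickeQ_four_ptRho (hk : 3 ≤ 4) : frickeQ 4 hk (nome ptRho) = 0 := by
  have h3 := sqrt_three_sq
  have hW := frickeQ_invW hk (by decide) ptRho_mem
  have hV := frickeQ_invV hk (by decide) ptRho_mem
  -- ρ_{7,2} lies on both circles, where both involutions are reflections, so its images differ by a
  -- translation. A nonzero value would then force ρ⁴ = (2ρ + 1)⁴, which fails on real parts.
  have heq : invV ptRho = invW ptRho - 1 := by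
    rw [invV_eq_neg_conj ptRho_mem ptRho_circle_two, invW_eq_neg_conj ptRho_circle_one]
    simp; ring
  rw [heq, nome_sub_one, hW] at hV
  by_contra h0
  have h1 : ptRho ^ 4 = (2 * ptRho + 1) ^ 4 := by
    have := mul_right_cancel₀ h0 hV
    exact mul_left_cancel₀ (by norm_num) this
  have hs : (√3 : ℂ) * √3 = 3 := by exact_mod_cast h3
  have hρ : ptRho = (-5 + √3 * Complex.I) / 14 := by
    apply Complex.ext
    · simp [ptRho]
    · simp [ptRho]
  have hr2 : ptRho ^ 2 = (11 - 5 * √3 * Complex.I) / 98 := by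
    rw [hρ]; linear_combination (1 / 196 : ℂ) * (√3 : ℂ) * √3 * Complex.I_sq - (1 / 196 : ℂ) * hs
  have hr2' : (2 * ptRho + 1) ^ 2 = (1 + 4 * √3 * Complex.I) / 49 := by
    rw [hρ]; linear_combination (1 / 49 : ℂ) * (√3 : ℂ) * √3 * Complex.I_sq - (1 / 49 : ℂ) * hs
  have h2 : ((11 - 5 * √3 * Complex.I) / 98 : ℂ) ^ 2 = ((1 + 4 * √3 * Complex.I) / 49) ^ 2 := by
    rw [← hr2, ← hr2', ← pow_mul, ← pow_mul]; exact h1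
  have h4 := congrArg Complex.re h2
  simp [pow_two] at h4
  nlinarith

theorem haupt_ptRho_cases : haupt ptRho = 0 ∨ haupt ptRho = 16 / 5 := by
  have h := frickeQ_four_cube (by norm_num) ptRho_mem
  rw [frickeQ_four_ptRho] at h
  have hp := prodQ_ne_zero (nome_ne_zero ptRho) (norm_nome_lt_one ptRho_mem)
  have h' : haupt ptRho * (haupt ptRho - 16 / 5) ^ 3 = 0 := by
    have := mul_eq_zero.mp (h.symm.trans (by norm_num))
    exact this.resolve_left hp
  rcases mul_eq_zero.mp h' with h | h
  · exact Or.inl h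
  · exact Or.inr (sub_eq_zero.mp (pow_eq_zero_iff (by norm_num) |>.mp h))

/-- The first arc, in terms of real parts. -/
def arcOne : Set ℂ :=
  {z | z ∈ uhp ∧ z.re ^ 2 + z.im ^ 2 = 1 / 7 ∧ -5 / 14 < z.re ∧ z.re < 0}

/-- The second arc, in terms of real parts. -/
def arcTwo : Set ℂ :=
  {z | z ∈ uhp ∧ (z.re + 1 / 2) ^ 2 + z.im ^ 2 = 1 / 28 ∧ -1 / 2 < z.re ∧ z.re < -5 / 14}

theorem eq_circlePt_of_arcOne {z : ℂ} (hz : z ∈ arcOne) : z = circlePt 0 (1 / 7) z.re :=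
  eq_circlePt hz.1 (by simpa using hz.2.1)

theorem eq_circlePt_of_arcTwo {z : ℂ} (hz : z ∈ arcTwo) :
    z = circlePt (1 / 2) (1 / 28) z.re :=
  eq_circlePt hz.1 hz.2.1

theorem circlePt_mem_arcOne {x : ℝ} (hx : x ∈ Set.Ioo (-5 / 14 : ℝ) 0) :
    circlePt 0 (1 / 7) x ∈ arcOne := by
  have h := circle_one_pos hx.1.le hx.2.le
  exact ⟨circlePt_mem h, by simpa using circlePt_circle h.le, hx.1, hx.2⟩

theorem circlePt_mem_arcTwo {x : ℝ} (hx : x ∈ Set.Ioo (-1 / 2 : ℝ) (-5 / 14)) :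
    circlePt (1 / 2) (1 / 28) x ∈ arcTwo := by
  have h := circle_two_pos hx.1.le hx.2.le
  exact ⟨circlePt_mem h, circlePt_circle h.le, hx.1, hx.2⟩

theorem arcs_subset_uhp {z : ℂ} (hz : z ∈ arcOne ∪ arcTwo) : z ∈ uhp := hz.elim (·.1) (·.1)

theorem order_arcs {z : ℂ} (hz : z ∈ arcOne ∪ arcTwo) :
    analyticOrderAt (fun w => haupt w - haupt z) z = 1 := by
  rcases hz with hz | hz
  · exact order_circle_one hz.1 hz.2.1 hz.2.2.1 hz.2.2.2
  · exact order_circle_two hz.1 hz.2.1 hz.2.2.1 hz.2.2.2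

theorem haupt_im_arcs {z : ℂ} (hz : z ∈ arcOne ∪ arcTwo) : (haupt z).im = 0 := by
  rcases hz with hz | hz
  · exact haupt_im_of_circle_one hz.1 hz.2.1
  · exact haupt_im_of_circle_two hz.1 hz.2.1

/-- Both candidate values lie in this interval, so the direction of monotonicity on the arcs is
settled before the value itself is known. -/
theorem ptRho_re_mem : (haupt ptRho).re ∈ Set.Ioo (-1 : ℝ) 27 := by
  rcases haupt_ptRho_cases with h | h <;> rw [h] <;> norm_num

theorem continuousOn_haupt_circlePt {m ρ a b : ℝ}
    (h : ∀ x ∈ Set.Icc a b, 0 < ρ - (x + m) ^ 2) :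
    ContinuousOn (fun x => (haupt (circlePt m ρ x)).re) (Set.Icc a b) :=
  Complex.continuous_re.comp_continuousOn (differentiableOn_haupt.continuousOn.comp
    (continuous_circlePt m ρ).continuousOn fun x hx => circlePt_mem (h x hx))

theorem strictMonoOn_circle_one :
    StrictMonoOn (fun x => (haupt (circlePt 0 (1 / 7) x)).re) (Set.Icc (-5 / 14) 0) := by
  refine (continuousOn_haupt_circlePt fun x hx =>
    circle_one_pos hx.1 hx.2).strictMonoOn_of_injOn_Icc (by norm_num) ?_ haupt_injOn_circle_one
  simp only [circlePt_zero, circlePt_one_ptRho, haupt_ptI]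
  exact ptRho_re_mem.2.le

theorem strictMonoOn_circle_two :
    StrictMonoOn (fun x => (haupt (circlePt (1 / 2) (1 / 28) x)).re)
      (Set.Icc (-1 / 2) (-5 / 14)) := by
  refine (continuousOn_haupt_circlePt fun x hx =>
    circle_two_pos hx.1 hx.2).strictMonoOn_of_injOn_Icc (by norm_num) ?_ haupt_injOn_circle_two
  simp only [circlePt_neg_half, circlePt_two_ptRho, haupt_ptR]
  exact ptRho_re_mem.1.le

theorem haupt_arcOne_mem {z : ℂ} (hz : z ∈ arcOne) :
    (haupt ptRho).re < (haupt z).re ∧ (haupt z).re < 27 := by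
  have h1 : -5 / 14 < z.re := hz.2.2.1
  have h2 : z.re < 0 := hz.2.2.2
  have hm := strictMonoOn_circle_one
  have a := hm (Set.left_mem_Icc.mpr (by norm_num)) ⟨h1.le, h2.le⟩ h1
  have b := hm ⟨h1.le, h2.le⟩ (Set.right_mem_Icc.mpr (by norm_num)) h2
  simp only [circlePt_zero, circlePt_one_ptRho, haupt_ptI, ← eq_circlePt_of_arcOne hz] at a b
  exact ⟨a, b⟩

theorem haupt_arcTwo_mem {z : ℂ} (hz : z ∈ arcTwo) :
    -1 < (haupt z).re ∧ (haupt z).re < (haupt ptRho).re := by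
  have h1 : -1 / 2 < z.re := hz.2.2.1
  have h2 : z.re < -5 / 14 := hz.2.2.2
  have hm := strictMonoOn_circle_two
  have a := hm (Set.left_mem_Icc.mpr (by norm_num)) ⟨h1.le, h2.le⟩ h1
  have b := hm ⟨h1.le, h2.le⟩ (Set.right_mem_Icc.mpr (by norm_num)) h2
  simp only [circlePt_neg_half, circlePt_two_ptRho, haupt_ptR, ← eq_circlePt_of_arcTwo hz] at a b
  exact ⟨a, b⟩

theorem haupt_injOn_arcs : Set.InjOn haupt (arcOne ∪ arcTwo) := by
  rintro z (hz | hz) w (hw | hw) h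
  · have := strictMonoOn_circle_one.injOn ⟨hz.2.2.1.le, hz.2.2.2.le⟩ ⟨hw.2.2.1.le, hw.2.2.2.le⟩
      (by simp only [← eq_circlePt_of_arcOne hz, ← eq_circlePt_of_arcOne hw, h])
    rw [eq_circlePt_of_arcOne hz, eq_circlePt_of_arcOne hw, this]
  · have := (haupt_arcOne_mem hz).1.trans (h ▸ (haupt_arcTwo_mem hw).2)
    exact absurd this (lt_irrefl _)
  · have := (haupt_arcOne_mem hw).1.trans (h ▸ (haupt_arcTwo_mem hz).2)
    exact absurd this (lt_irrefl _)
  · have := strictMonoOn_circle_two.injOn ⟨hz.2.2.1.le, hz.2.2.2.le⟩ ⟨hw.2.2.1.le, hw.2.2.2.le⟩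
      (by simp only [← eq_circlePt_of_arcTwo hz, ← eq_circlePt_of_arcTwo hw, h])
    rw [eq_circlePt_of_arcTwo hz, eq_circlePt_of_arcTwo hw, this]

theorem exists_arcs {c : ℝ} (h1 : -1 < c) (h2 : c < 27) (h3 : c ≠ (haupt ptRho).re) :
    ∃ z ∈ arcOne ∪ arcTwo, haupt z = c := by
  suffices ∃ z ∈ arcOne ∪ arcTwo, (haupt z).re = c by
    obtain ⟨z, hz, h⟩ := this
    exact ⟨z, hz, Complex.ext (by simpa using h) (by simpa using haupt_im_arcs hz)⟩
  rcases lt_or_gt_of_ne h3 with h3 | h3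
  · have := intermediate_value_Ioo (by norm_num : (-1 / 2 : ℝ) ≤ -5 / 14)
      (continuousOn_haupt_circlePt (m := 1 / 2) (ρ := 1 / 28) fun x hx => circle_two_pos hx.1 hx.2)
    simp only [circlePt_neg_half, circlePt_two_ptRho, haupt_ptR] at this
    obtain ⟨x, hx, h⟩ := this ⟨by simpa using h1, h3⟩
    exact ⟨_, Or.inr (circlePt_mem_arcTwo hx), h⟩
  · have := intermediate_value_Ioo (by norm_num : (-5 / 14 : ℝ) ≤ 0)
      (continuousOn_haupt_circlePt (m := 0) (ρ := 1 / 7) fun x hx => circle_one_pos hx.1 hx.2)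
    simp only [circlePt_zero, circlePt_one_ptRho, haupt_ptI] at this
    obtain ⟨x, hx, h⟩ := this ⟨h3, by simpa using h2⟩
    exact ⟨_, Or.inl (circlePt_mem_arcOne hx), h⟩

/-! ### Orders of vanishing and the value at the order three point -/

section orders

variable {z : ℂ}

theorem analyticAt_frickeQ_nome {k : ℕ} (hk : 3 ≤ k) (hz : z ∈ uhp) :
    AnalyticAt ℂ (fun w => frickeQ k hk (nome w)) z :=
  (differentiableOn_comp_nome ((differentiableOn_frickeQ hk).mono
    Set.sdiff_subset)).analyticAt (isOpen_uhp.mem_nhds hz)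

theorem analyticAt_prodQ_nome (hz : z ∈ uhp) : AnalyticAt ℂ (fun w => prodQ (nome w)) z :=
  (differentiableOn_comp_nome (differentiableOn_prodQ.mono
    Set.sdiff_subset)).analyticAt (isOpen_uhp.mem_nhds hz)

theorem order_prodQ_nome (hz : z ∈ uhp) :
    analyticOrderAt (fun w => prodQ (nome w)) z = 0 :=
  (analyticAt_prodQ_nome hz).analyticOrderAt_eq_zero.mpr
    (prodQ_ne_zero (nome_ne_zero z) (norm_nome_lt_one hz))

theorem analyticAt_haupt_sub (hz : z ∈ uhp) (c : ℂ) : AnalyticAt ℂ (fun w => haupt w - c) z :=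
  (analyticAt_haupt hz).sub analyticAt_const

theorem order_haupt_sub_of_ne (hz : z ∈ uhp) {c : ℂ} (h : haupt z ≠ c) :
    analyticOrderAt (fun w => haupt w - c) z = 0 :=
  (analyticAt_haupt_sub hz c).analyticOrderAt_eq_zero.mpr (sub_ne_zero.mpr h)

theorem order_frickeQ_four (hk : 3 ≤ 4) (hz : z ∈ uhp) :
    3 • analyticOrderAt (fun w => frickeQ 4 hk (nome w)) z =
      analyticOrderAt (fun w => haupt w - 0) z +
        3 • analyticOrderAt (fun w => haupt w - 16 / 5) z := by
  have h0 := analyticAt_haupt_sub hz 0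
  have h1 := analyticAt_haupt_sub hz (16 / 5)
  rw [← analyticOrderAt_pow (analyticAt_frickeQ_nome hk hz), ← analyticOrderAt_pow h1,
    ← analyticOrderAt_mul h0 (h1.pow 3), ← zero_add (analyticOrderAt (_ * _) z),
    ← order_prodQ_nome hz, ← analyticOrderAt_mul (analyticAt_prodQ_nome hz) (h0.mul (h1.pow 3))]
  refine analyticOrderAt_congr ?_
  filter_upwards [isOpen_uhp.mem_nhds hz] with w hw
  simpa [haupt] using frickeQ_four_cube hk hw

theorem order_frickeQ_six (hk : 3 ≤ 6) (hz : z ∈ uhp) :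
    2 • analyticOrderAt (fun w => frickeQ 6 hk (nome w)) z =
      analyticOrderAt (fun w => haupt w - 27) z + (analyticOrderAt (fun w => haupt w - -1) z +
        2 • analyticOrderAt (fun w => haupt w - 20 / 43) z) := by
  have h0 := analyticAt_haupt_sub hz 27
  have h1 := analyticAt_haupt_sub hz (-1)
  have h2 := analyticAt_haupt_sub hz (20 / 43)
  rw [← analyticOrderAt_pow (analyticAt_frickeQ_nome hk hz), ← analyticOrderAt_pow h2,
    ← analyticOrderAt_mul h1 (h2.pow 2), ← analyticOrderAt_mul h0 (h1.mul (h2.pow 2)),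
    ← zero_add (analyticOrderAt (_ * _) z), ← order_prodQ_nome hz,
    ← analyticOrderAt_mul (analyticAt_prodQ_nome hz) (h0.mul (h1.mul (h2.pow 2)))]
  refine analyticOrderAt_congr ?_
  filter_upwards [isOpen_uhp.mem_nhds hz] with w hw
  simpa [haupt] using frickeQ_six_sq hk hw

theorem exists_nat_of_nsmul_eq {x : ℕ∞} {n m : ℕ} (hn : n ≠ 0) (h : n • x = (m : ℕ∞)) :
    ∃ y : ℕ, x = y ∧ n * y = m := by
  cases x with
  | top =>
    rw [nsmul_eq_mul, ENat.mul_top (by exact_mod_cast hn)] at h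
    exact absurd h (ENat.top_ne_natCast _)
  | coe y =>
    rw [nsmul_eq_mul] at h
    exact ⟨y, rfl, by exact_mod_cast h⟩

end orders

/-- If the value were 16/5, then 0 would be taken at a point of an open arc with multiplicity 1, and
three times the order of E₄ there would equal 1. -/
theorem haupt_ptRho : haupt ptRho = 0 := by
  refine haupt_ptRho_cases.resolve_right fun h => ?_
  obtain ⟨z, hz, hz0⟩ := exists_arcs (c := 0) (by norm_num) (by norm_num) (by
    rw [h]; norm_num)
  have hu := arcs_subset_uhp hz
  rw [Complex.ofReal_zero] at hz0
  have h1 := order_frickeQ_four (by norm_num) hu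
  have h2 := order_arcs hz
  rw [hz0] at h2
  rw [h2, order_haupt_sub_of_ne hu (c := 16 / 5) (by rw [hz0]; norm_num), smul_zero,
    add_zero] at h1
  obtain ⟨y, -, hy⟩ := exists_nat_of_nsmul_eq (n := 3) (m := 1) (by norm_num)
    (by rw [h1, Nat.cast_one])
  omega

theorem exists_arcs' {c : ℝ} (h1 : -1 < c) (h2 : c < 27) (h3 : c ≠ 0) :
    ∃ z ∈ arcOne ∪ arcTwo, haupt z = c :=
  exists_arcs h1 h2 (by rwa [haupt_ptRho, Complex.zero_re])

theorem haupt_arcs_mem {z : ℂ} (hz : z ∈ arcOne ∪ arcTwo) :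
    -1 < (haupt z).re ∧ (haupt z).re < 27 ∧ (haupt z).re ≠ 0 := by
  have h0 : (haupt ptRho).re = 0 := by rw [haupt_ptRho, Complex.zero_re]
  rcases hz with hz | hz
  · have h := haupt_arcOne_mem hz
    rw [h0] at h
    exact ⟨by linarith [h.1], h.2, h.1.ne'⟩
  · have h := haupt_arcTwo_mem hz
    rw [h0] at h
    exact ⟨h.1, by linarith [h.2], h.2.ne⟩

/-! ### Arguments of points on the arcs -/

section angles

theorem sin_alpha : Real.sin alpha = 5 / (2 * √7) := by
  have hc : 0 < Real.cos alpha := Real.cos_arctan_pos _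
  have h3 : (0 : ℝ) < √3 := by positivity
  have ht : Real.sin alpha / Real.cos alpha = 5 / √3 := by
    rw [← Real.tan_eq_sin_div_cos, alpha, Real.tan_arctan]
  have hs : Real.sin alpha * √3 = 5 * Real.cos alpha := by
    rw [div_eq_div_iff hc.ne' h3.ne'] at ht; exact ht
  have hpos : 0 < Real.sin alpha := by
    have : 0 < Real.sin alpha * √3 := by rw [hs]; positivity
    exact pos_of_mul_pos_left this h3.le
  have hsq : Real.sin alpha ^ 2 = (5 / (2 * √7)) ^ 2 := by
    have h1 := Real.sin_sq_add_cos_sq alpha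
    have h2 : Real.sin alpha ^ 2 * 3 = 25 * Real.cos alpha ^ 2 := by
      have := congrArg (· ^ 2) hs
      simp only [mul_pow, Real.sq_sqrt (show (0 : ℝ) ≤ 3 by norm_num)] at this
      linarith
    rw [div_pow, mul_pow, Real.sq_sqrt (by norm_num)]
    linarith
  exact (pow_left_inj₀ hpos.le (by positivity) (by norm_num)).mp hsq

/-- Together with `sin_alpha` this places the common endpoint of the arcs: (1/√7)(-sin α) = -5/14
and (1/(2√7))(2/√7) = 1/7 = -5/14 + 1/2. -/
theorem cos_alpha_sub : Real.cos (alpha - Real.pi / 6) = 2 / √7 := by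
  have hc : 0 < Real.cos alpha := Real.cos_arctan_pos _
  have h3 : (0 : ℝ) < √3 := by positivity
  have ht : Real.sin alpha / Real.cos alpha = 5 / √3 := by
    rw [← Real.tan_eq_sin_div_cos, alpha, Real.tan_arctan]
  have hs : Real.sin alpha * √3 = 5 * Real.cos alpha := by
    rw [div_eq_div_iff hc.ne' h3.ne'] at ht; exact ht
  have hcos : Real.cos alpha = Real.sin alpha * √3 / 5 := by linarith
  rw [Real.cos_sub, Real.cos_pi_div_six, Real.sin_pi_div_six, hcos, sin_alpha]
  have h := sqrt_three_sq
  have h7 : (√7 : ℝ) ≠ 0 := by positivity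
  field_simp
  nlinarith

theorem alpha_mem : Real.pi / 6 < alpha ∧ alpha < Real.pi / 2 := by
  have h2 : alpha < Real.pi / 2 := Real.arctan_lt_pi_div_two _
  refine ⟨?_, h2⟩
  by_contra! h
  have hpi := Real.pi_pos
  have h1 : -(Real.pi / 2) < alpha := Real.neg_pi_div_two_lt_arctan _
  have := Real.sin_le_sin_of_le_of_le_pi_div_two h1.le (by linarith) h
  rw [sin_alpha, Real.sin_pi_div_six, div_le_div_iff₀ (by positivity) (by norm_num)] at this
  have h7 : (√7 : ℝ) < 5 := by
    rw [Real.sqrt_lt' (by norm_num)]; norm_num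
  linarith

theorem arg_mem_of_im_pos {w : ℂ} (hw : 0 < w.im) : Complex.arg w ∈ Set.Icc 0 Real.pi :=
  ⟨Complex.arg_nonneg_iff.mpr hw.le, Complex.arg_le_pi w⟩

/-- Cosine is strictly decreasing on [0, π], so bounds on the argument become bounds on the real
part. -/
theorem lt_arg_iff {w : ℂ} (hw : 0 < w.im) {θ : ℝ} (hθ : θ ∈ Set.Icc 0 Real.pi) :
    θ < Complex.arg w ↔ w.re < ‖w‖ * Real.cos θ := by
  have h0 : w ≠ 0 := ne_zero_of_im_pos hw
  rw [← Real.strictAntiOn_cos.lt_iff_gt (arg_mem_of_im_pos hw) hθ, Complex.cos_arg h0,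
    div_lt_iff₀ (norm_pos_iff.mpr h0), mul_comm]

theorem arg_lt_iff {w : ℂ} (hw : 0 < w.im) {θ : ℝ} (hθ : θ ∈ Set.Icc 0 Real.pi) :
    Complex.arg w < θ ↔ ‖w‖ * Real.cos θ < w.re := by
  have h0 : w ≠ 0 := ne_zero_of_im_pos hw
  rw [← Real.strictAntiOn_cos.lt_iff_gt hθ (arg_mem_of_im_pos hw), Complex.cos_arg h0,
    lt_div_iff₀ (norm_pos_iff.mpr h0), mul_comm]

theorem norm_eq_inv_sqrt_seven_iff (w : ℂ) :
    ‖w‖ = 1 / √7 ↔ w.re ^ 2 + w.im ^ 2 = 1 / 7 := by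
  rw [← norm_sq_eq, ← inv_sqrt_seven_sq, pow_left_inj₀ (norm_nonneg _) (by positivity) (by norm_num)]

theorem norm_eq_inv_two_sqrt_seven_iff (w : ℂ) :
    ‖w‖ = 1 / (2 * √7) ↔ w.re ^ 2 + w.im ^ 2 = 1 / 28 := by
  rw [← norm_sq_eq, ← inv_two_sqrt_seven_sq,
    pow_left_inj₀ (norm_nonneg _) (by positivity) (by norm_num)]

theorem mem_arc1_iff (z : ℍ) : z ∈ arc1 ↔ (z : ℂ) ∈ arcOne := by
  have hpi := Real.pi_pos
  have hα := alpha_mem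
  have hz : 0 < (z : ℂ).im := z.2
  simp only [arc1, arcOne, Set.mem_ofPred_eq]
  rw [lt_arg_iff hz ⟨by linarith, by linarith⟩, arg_lt_iff hz ⟨by linarith, by linarith⟩,
    add_comm, Real.cos_add_pi_div_two, Real.cos_pi_div_two, mul_zero, sin_alpha,
    norm_eq_inv_sqrt_seven_iff]
  constructor
  · rintro ⟨h1, h2, h3⟩
    rw [(norm_eq_inv_sqrt_seven_iff _).mpr h1] at h3
    refine ⟨hz, h1, ?_, h2⟩
    have : 1 / √7 * -(5 / (2 * √7)) = (-5 / 2 : ℝ) * (1 / √7) ^ 2 := by field_simp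
    rw [this, inv_sqrt_seven_sq] at h3
    linarith
  · rintro ⟨-, h1, h2, h3⟩
    refine ⟨h1, h3, ?_⟩
    rw [(norm_eq_inv_sqrt_seven_iff _).mpr h1]
    have : 1 / √7 * -(5 / (2 * √7)) = (-5 / 2 : ℝ) * (1 / √7) ^ 2 := by field_simp
    rw [this, inv_sqrt_seven_sq]
    linarith

theorem mem_arc2_iff (z : ℍ) : z ∈ arc2 ↔ (z : ℂ) ∈ arcTwo := by
  have hpi := Real.pi_pos
  have hα := alpha_mem
  have hz : 0 < ((z : ℂ) + 1 / 2).im := by simpa using z.2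
  have hre : ((z : ℂ) + 1 / 2).re = (z : ℂ).re + 1 / 2 := by simp
  have him : ((z : ℂ) + 1 / 2).im = (z : ℂ).im := by simp
  have hmul : 1 / (2 * √7) * (2 / √7) = ((1 / √7) ^ 2 : ℝ) := by field_simp
  simp only [arc2, arcTwo, Set.mem_ofPred_eq]
  rw [lt_arg_iff hz ⟨by linarith, by linarith⟩, arg_lt_iff hz ⟨by linarith, by linarith⟩,
    Real.cos_pi_div_two, mul_zero, cos_alpha_sub, norm_eq_inv_two_sqrt_seven_iff, hre, him]
  constructor
  · rintro ⟨h1, h2, h3⟩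
    rw [(norm_eq_inv_two_sqrt_seven_iff _).mpr (by rwa [hre, him]), hmul,
      inv_sqrt_seven_sq] at h2
    exact ⟨z.2, h1, by linarith, by linarith⟩
  · rintro ⟨-, h1, h2, h3⟩
    rw [(norm_eq_inv_two_sqrt_seven_iff _).mpr (by rwa [hre, him]), hmul, inv_sqrt_seven_sq]
    exact ⟨h1, by linarith, by linarith⟩

theorem mem_arcs_iff (z : ℍ) : z ∈ arc1 ∪ arc2 ↔ (z : ℂ) ∈ arcOne ∪ arcTwo := by
  rw [Set.mem_union, Set.mem_union, mem_arc1_iff, mem_arc2_iff]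

end angles

/-! ### Locating zeros in the fundamental domain -/

theorem coe_ellI : (ellI : ℂ) = ptI := rfl

theorem coe_rho1 : (rho1 : ℂ) = ptR := rfl

theorem coe_rho2 : (rho2 : ℂ) = ptRho := rfl

/-- Points of the closed left half of the fundamental domain where the Hauptmodul takes a real
value between `-1` and `27` lie on the lower boundary. -/
theorem lower_boundary_of_left {z : ℂ} (hz : z ∈ uhp) (h1 : 1 / 7 ≤ z.re ^ 2 + z.im ^ 2)
    (h2 : 1 / 28 ≤ (z.re + 1 / 2) ^ 2 + z.im ^ 2) (h3 : -1 / 2 ≤ z.re) (h4 : z.re ≤ 0)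
    (him : (haupt z).im = 0) (hlo : -1 ≤ (haupt z).re) (hhi : (haupt z).re ≤ 27) :
    z = ptI ∨ z = ptR ∨ z = ptRho ∨ z ∈ arcOne ∪ arcTwo := by
  have hzim : 0 < z.im := hz
  rcases h3.lt_or_eq with h3' | h3'
  swap
  · right; left
    have h5 : (1 / (2 * √7)) ^ 2 ≤ z.im ^ 2 := by
      rw [inv_two_sqrt_seven_sq]; rw [← h3'] at h2; linarith
    have h6 : 1 / (2 * √7) ≤ z.im := (pow_le_pow_iff_left₀ (by positivity) hzim.le
      (by norm_num)).mp h5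
    rcases h6.lt_or_eq with h6 | h6
    · have := haupt_lt_of_re_half hz h3'.symm h6
      linarith
    · exact Complex.ext h3'.symm h6.symm
  rcases h4.lt_or_eq with h4' | h4'
  swap
  · left
    have h5 : (1 / √7) ^ 2 ≤ z.im ^ 2 := by
      rw [inv_sqrt_seven_sq]; rw [h4'] at h1; linarith
    have h6 : 1 / √7 ≤ z.im := (pow_le_pow_iff_left₀ (by positivity) hzim.le
      (by norm_num)).mp h5
    rcases h6.lt_or_eq with h6 | h6
    · have := haupt_gt_of_re_zero hz h4' h6
      linarith
    · exact Complex.ext h4' h6.symm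
  right; right
  rcases h1.lt_or_eq with h1' | h1'
  · rcases h2.lt_or_eq with h2' | h2'
    · have := haupt_im_pos (z := z) ⟨⟨h3', h4'⟩, h1', h2', hz⟩
      linarith
    -- The two circle equations differ by the linear relation x + 1/4 = 1/28 - 1/7, so x = -5/14
    -- separates the arcs.
    · have h5 : z.re < -5 / 14 := by nlinarith
      exact Or.inr (Or.inr ⟨hz, h2'.symm, h3', h5⟩)
  · have h5 : -5 / 14 ≤ z.re := by nlinarith
    rcases h5.lt_or_eq with h5 | h5
    · exact Or.inr (Or.inl ⟨hz, h1'.symm, h5, h4'⟩)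
    · left
      rw [eq_circlePt (m := 0) (ρ := 1 / 7) hz (by simpa using h1'.symm), ← h5, circlePt_one_ptRho]

/-- The right half contributes nothing: z ↦ -z̄ carries its points off the imaginary axis into the
half domain, where h is not real, and on the axis above i/√7 h exceeds 27. -/
theorem lower_boundary_of_fundDomain {z : ℍ} (hz : z ∈ fundDomain) (him : (haupt z).im = 0)
    (hlo : -1 ≤ (haupt z).re) (hhi : (haupt z).re ≤ 27) :
    z = ellI ∨ z = rho1 ∨ z = rho2 ∨ z ∈ arc1 ∪ arc2 := by
  have h7 : (0 : ℝ) ≤ 1 / √7 := by positivity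
  have h27 : (0 : ℝ) ≤ 1 / (2 * √7) := by positivity
  suffices h : (z : ℂ) = ptI ∨ (z : ℂ) = ptR ∨ (z : ℂ) = ptRho ∨ (z : ℂ) ∈ arcOne ∪ arcTwo by
    rw [mem_arcs_iff]
    rcases h with h | h | h | h
    · exact Or.inl (UpperHalfPlane.ext h)
    · exact Or.inr (Or.inl (UpperHalfPlane.ext h))
    · exact Or.inr (Or.inr (Or.inl (UpperHalfPlane.ext h)))
    · exact Or.inr (Or.inr (Or.inr h))
  rcases hz with ⟨h1, h2, h3, h4⟩ | ⟨h1, h2, h3, h4⟩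
  · have h1' := pow_le_pow_left₀ h7 h1 2
    have h2' := pow_le_pow_left₀ h27 h2 2
    rw [inv_sqrt_seven_sq, norm_sq_eq] at h1'
    rw [inv_two_sqrt_seven_sq, norm_sq_eq] at h2'
    exact lower_boundary_of_left z.2 h1' (by simpa using h2') h3 h4 him hlo hhi
  · exfalso
    have h1' := pow_lt_pow_left₀ h1 h7 (n := 2) (by norm_num)
    have h2' := pow_lt_pow_left₀ h2 h27 (n := 2) (by norm_num)
    rw [inv_sqrt_seven_sq, norm_sq_eq] at h1'
    rw [inv_two_sqrt_seven_sq, norm_sq_eq] at h2'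
    have h2'' : 1 / 28 < ((z : ℂ).re - 1 / 2) ^ 2 + (z : ℂ).im ^ 2 := by simpa using h2'
    have hzim : 0 < (z : ℂ).im := z.2
    have h3' : 0 ≤ (z : ℂ).re := h3
    have h4' : (z : ℂ).re < 1 / 2 := h4
    rcases h3'.lt_or_eq with h5 | h5
    · have := haupt_im_pos (z := -(starRingEnd ℂ) (z : ℂ))
        ⟨⟨by simp only [Complex.neg_re, Complex.conj_re]; linarith,
          by simp only [Complex.neg_re, Complex.conj_re]; linarith⟩,
          by simp only [Complex.neg_re, Complex.conj_re, Complex.neg_im, Complex.conj_im]; nlinarith,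
          by simp only [Complex.neg_re, Complex.conj_re, Complex.neg_im, Complex.conj_im]; nlinarith,
          by simpa using hzim⟩
      rw [haupt_conj, Complex.conj_im, him] at this
      simp at this
    · rw [← h5] at h1'
      have h6 : (1 / √7) ^ 2 < (z : ℂ).im ^ 2 := by rw [inv_sqrt_seven_sq]; linarith
      have h6' : 1 / √7 < (z : ℂ).im := lt_of_pow_lt_pow_left₀ 2 hzim.le h6
      have := haupt_gt_of_re_zero z.2 h5.symm h6'
      linarith

theorem orderAt_eisenstein {k : ℕ} (hk : 3 ≤ k) (z : ℍ) :
    orderAt (eisenstein k hk) z = analyticOrderAt (fun w => frickeQ k hk (nome w)) (z : ℂ) := by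
  refine analyticOrderAt_congr ?_
  filter_upwards [isOpen_uhp.mem_nhds (show (z : ℂ) ∈ uhp from z.2)] with w hw
  rw [Function.comp_apply, ofComplex_apply_of_im_pos hw, eisenstein_eq_frickeQ]

theorem HasJet.apply_zero {f : ℂ → ℂ} {a b c d e : ℂ} (h : HasJet f a b c d e) : f 0 = a := by
  obtain ⟨C, hC⟩ := h.bound
  simpa [sub_eq_zero] using hC.self_of_nhds

/-- The constant term is the limit at i∞, which is 1 because both E_k(z) and E_k(7z) tend to 1. -/
theorem orderAtInfty_eisenstein {k : ℕ} (hk : 3 ≤ k) (hk2 : Even k) :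
    orderAtInfty (eisenstein k hk) = 0 := by
  have hcont : ContinuousAt (frickeQ k hk) 0 :=
    ((differentiableOn_frickeQ hk).differentiableAt
      (Metric.isOpen_ball.mem_nhds (Metric.mem_ball_self one_pos))).continuousAt
  have h0 : frickeQ k hk 0 = 1 := (hasJet_frickeQ hk hk2 _ rfl).apply_zero
  have ht : Tendsto (eisenstein k hk) atImInfty (𝓝 1) := by
    have := hcont.tendsto.comp (qParam_tendsto_atImInfty one_pos)
    rw [h0] at this
    exact this.congr fun z => (eisenstein_eq_frickeQ hk z).symm
  have hper : Function.Periodic (eisenstein k hk ∘ ofComplex) (1 : ℝ) := by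
    intro w
    by_cases hw : 0 < w.im
    · have hw' : 0 < (w + (1 : ℝ)).im := by simpa using hw
      simp only [Function.comp_apply, ofComplex_apply_of_im_pos hw, ofComplex_apply_of_im_pos hw',
        eisenstein_eq_frickeQ]
      congr 1
      simpa using nome_add_one w
    -- Off the upper half plane `ofComplex` takes a constant default value, so periodicity holds
    -- there too.
    · have hw' : (w + (1 : ℝ)).im ≤ 0 := by simpa using hw
      simp only [Function.comp_apply, ofComplex_apply_of_im_nonpos hw',
        ofComplex_apply_of_im_nonpos (not_lt.mp hw)]
  have hana := analyticAt_cuspFunction_zero one_pos hper (mdifferentiable_eisenstein k hk)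
    (ht.isBigO_one ℝ)
  have hcoeff := qExpansion_coeff_zero one_pos hana hper
  rw [valueAtInfty, ht.limUnder_eq] at hcoeff
  have := (PowerSeries.order_eq_nat (φ := qExpansion 1 (eisenstein k hk)) (n := 0)).mpr
    ⟨by rw [hcoeff]; exact one_ne_zero, fun i hi => absurd hi (Nat.not_lt_zero i)⟩
  simpa [orderAtInfty] using this

/-- If the Fricke Eisenstein series vanishes only where the Hauptmodul takes an elliptic value or
a value in a finite set `R` of regular values, and simply at the simple `R`-points, then its zeros
are located by `R` and by the orders at the elliptic points. -/
theorem zeroLocation_of {k : ℕ} (hk : 3 ≤ k) (hk2 : Even k) {R : Finset ℝ} {n0 n1 n2 : ℕ}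
    (hR : ∀ c ∈ R, -1 < c ∧ c < 27 ∧ c ≠ 0)
    (hzero : ∀ z ∈ uhp, frickeQ k hk (nome z) = 0 →
      (∃ c ∈ R, haupt z = c) ∨ haupt z = 27 ∨ haupt z = -1 ∨ haupt z = 0)
    (hsimple : ∀ z ∈ uhp, ∀ c ∈ R, haupt z = c →
      analyticOrderAt (fun w => haupt w - haupt z) z = 1 →
      analyticOrderAt (fun w => frickeQ k hk (nome w)) z = 1)
    (h0 : analyticOrderAt (fun w => frickeQ k hk (nome w)) ptI = n0)
    (h1 : analyticOrderAt (fun w => frickeQ k hk (nome w)) ptR = n1)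
    (h2 : analyticOrderAt (fun w => frickeQ k hk (nome w)) ptRho = n2) :
    ZeroLocation (eisenstein k hk) 0 n0 n1 n2 R.card := by
  have hval : ∀ z ∈ arcOne ∪ arcTwo, frickeQ k hk (nome z) = 0 → ∃ c ∈ R, haupt z = c := by
    intro z hz h
    obtain ⟨ha, hb, hc⟩ := haupt_arcs_mem hz
    rcases hzero z (arcs_subset_uhp hz) h with h | h | h | h
    · exact h
    · exact absurd hb (by rw [h]; norm_num)
    · exact absurd ha (by rw [h]; norm_num)
    · exact absurd (by rw [h, Complex.zero_re]) hc
  have horder : ∀ z ∈ arcOne ∪ arcTwo, frickeQ k hk (nome z) = 0 →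
      analyticOrderAt (fun w => frickeQ k hk (nome w)) z = 1 := by
    intro z hz h
    obtain ⟨c, hc, hcz⟩ := hval z hz h
    exact hsimple z (arcs_subset_uhp hz) c hc hcz (order_arcs hz)
  have hvanish : ∀ z ∈ uhp, analyticOrderAt (fun w => frickeQ k hk (nome w)) z = 1 →
      frickeQ k hk (nome z) = 0 := by
    intro z hz h
    by_contra hne
    rw [(analyticAt_frickeQ_nome hk hz).analyticOrderAt_eq_zero.mpr hne] at h
    exact zero_ne_one h
  refine ⟨by simpa using orderAtInfty_eisenstein hk hk2, ?_, ?_, ?_, ?_, ?_⟩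
  · rw [orderAt_eisenstein, coe_ellI, h0]
  · rw [orderAt_eisenstein, coe_rho1, h1]
  · rw [orderAt_eisenstein, coe_rho2, h2]
  -- The real part of h maps the simple zeros on the arcs bijectively onto R, so their number is the
  -- cardinality of R.
  · set S : Set ℍ := {z : ℍ | z ∈ arc1 ∪ arc2 ∧ orderAt (eisenstein k hk) z = 1} with hS
    have hmem : ∀ z : ℍ, z ∈ S ↔ (z : ℂ) ∈ arcOne ∪ arcTwo ∧
        analyticOrderAt (fun w => frickeQ k hk (nome w)) (z : ℂ) = 1 := fun z => by
      rw [hS, Set.mem_ofPred_eq, mem_arcs_iff, orderAt_eisenstein]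
    have hinj : Set.InjOn (fun z : ℍ => (haupt z).re) S := by
      intro z hz w hw h
      have hz' := ((hmem z).mp hz).1
      have hw' := ((hmem w).mp hw).1
      exact UpperHalfPlane.ext (haupt_injOn_arcs hz' hw'
        (Complex.ext h (by rw [haupt_im_arcs hz', haupt_im_arcs hw'])))
    have himg : (fun z : ℍ => (haupt z).re) '' S = R := by
      ext c
      constructor
      · rintro ⟨z, hz, rfl⟩
        obtain ⟨hz', hz1⟩ := (hmem z).mp hz
        obtain ⟨c, hc, hcz⟩ := hval z hz' (hvanish z z.2 hz1)
        simpa [hcz] using hc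
      · intro hc
        obtain ⟨ha, hb, hd⟩ := hR c hc
        obtain ⟨z, hz, hzc⟩ := exists_arcs' ha hb hd
        refine ⟨⟨z, arcs_subset_uhp hz⟩, (hmem _).mpr ⟨hz, ?_⟩, by simp [hzc]⟩
        exact hsimple z (arcs_subset_uhp hz) c hc hzc (order_arcs hz)
    rw [← hinj.ncard_image, himg, Set.ncard_coe_finset]
  · intro z hz hz0
    rw [eisenstein_eq_frickeQ] at hz0
    have hreal : (haupt z).im = 0 ∧ -1 ≤ (haupt z).re ∧ (haupt z).re ≤ 27 := by
      rcases hzero z z.2 hz0 with ⟨c, hc, h⟩ | h | h | h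
      · obtain ⟨ha, hb, -⟩ := hR c hc
        rw [h]
        exact ⟨Complex.ofReal_im c, ha.le, hb.le⟩
      all_goals rw [h]; norm_num
    rcases lower_boundary_of_fundDomain hz hreal.1 hreal.2.1 hreal.2.2 with h | h | h | h
    · exact Or.inl h
    · exact Or.inr (Or.inl h)
    · exact Or.inr (Or.inr (Or.inl h))
    · refine Or.inr (Or.inr (Or.inr ⟨h, ?_⟩))
      rw [orderAt_eisenstein]
      exact horder z ((mem_arcs_iff z).mp h) hz0

/-! ### The three weights -/

theorem uhp_ptI : ptI ∈ uhp := ellI.2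

theorem uhp_ptR : ptR ∈ uhp := rho1.2

theorem order_eq_zero_of_ne {k : ℕ} {hk : 3 ≤ k} {z : ℂ} (hz : z ∈ uhp)
    (h : frickeQ k hk (nome z) ≠ 0) : analyticOrderAt (fun w => frickeQ k hk (nome w)) z = 0 :=
  (analyticAt_frickeQ_nome hk hz).analyticOrderAt_eq_zero.mpr h

theorem frickeQ_four_eq_zero_iff (hk : 3 ≤ 4) {z : ℂ} (hz : z ∈ uhp) :
    frickeQ 4 hk (nome z) = 0 ↔ haupt z = 0 ∨ haupt z = 16 / 5 := by
  have h := frickeQ_four_cube hk hz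
  rw [← pow_eq_zero_iff (three_ne_zero), h, mul_eq_zero, mul_eq_zero,
    or_iff_right (prodQ_ne_zero (nome_ne_zero z) (norm_nome_lt_one hz)),
    pow_eq_zero_iff three_ne_zero, sub_eq_zero]
  rfl

theorem frickeQ_six_eq_zero_iff (hk : 3 ≤ 6) {z : ℂ} (hz : z ∈ uhp) :
    frickeQ 6 hk (nome z) = 0 ↔ haupt z = 27 ∨ haupt z = -1 ∨ haupt z = 20 / 43 := by
  have h := frickeQ_six_sq hk hz
  rw [← pow_eq_zero_iff two_ne_zero, h, mul_eq_zero, mul_eq_zero, mul_eq_zero,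
    or_iff_right (prodQ_ne_zero (nome_ne_zero z) (norm_nome_lt_one hz)),
    pow_eq_zero_iff two_ne_zero, sub_eq_zero, sub_eq_zero, sub_eq_zero]
  rfl

theorem zeroLocation_four (hk : 3 ≤ 4) : ZeroLocation (eisenstein 4 hk) 0 0 0 1 1 := by
  have hc : ((16 / 5 : ℝ) : ℂ) = 16 / 5 := by push_cast; rfl
  refine zeroLocation_of hk (by decide) (R := {16 / 5}) (n0 := 0) (n1 := 0) (n2 := 1)
    ?_ ?_ ?_ ?_ ?_ ?_
  · intro c hc
    rw [Finset.mem_singleton.mp hc]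
    norm_num
  · intro z hz h
    rcases (frickeQ_four_eq_zero_iff hk hz).mp h with h | h
    · exact Or.inr (Or.inr (Or.inr h))
    · exact Or.inl ⟨_, Finset.mem_singleton_self _, by rw [h, hc]⟩
  · intro z hz c hcR hcz h1
    rw [Finset.mem_singleton.mp hcR, hc] at hcz
    have h := order_frickeQ_four hk hz
    rw [order_haupt_sub_of_ne hz (by rw [hcz]; norm_num), zero_add, ← hcz, h1] at h
    obtain ⟨y, hy, hy3⟩ := exists_nat_of_nsmul_eq (n := 3) (m := 3) (by norm_num) (by rw [h]; rfl)
    rw [hy, show y = 1 by omega, Nat.cast_one]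
  · refine order_eq_zero_of_ne uhp_ptI fun h => ?_
    rw [frickeQ_four_eq_zero_iff hk uhp_ptI, haupt_ptI] at h
    norm_num at h
  · refine order_eq_zero_of_ne uhp_ptR fun h => ?_
    rw [frickeQ_four_eq_zero_iff hk uhp_ptR, haupt_ptR] at h
    norm_num at h
  · obtain ⟨n, hn, hn0, hn6⟩ := order_ptRho
    have h := order_frickeQ_four hk ptRho_mem
    rw [haupt_ptRho] at hn
    rw [hn, order_haupt_sub_of_ne ptRho_mem (by rw [haupt_ptRho]; norm_num), smul_zero,
      add_zero] at h
    -- Here 3·ord(E₄) is the multiplicity n of h, and 0 < n < 6 leaves only n = 3.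
    obtain ⟨y, hy, hy3⟩ := exists_nat_of_nsmul_eq (by norm_num) h
    rw [hy, show y = 1 by omega]

theorem zeroLocation_six (hk : 3 ≤ 6) : ZeroLocation (eisenstein 6 hk) 0 1 1 0 1 := by
  have hc : ((20 / 43 : ℝ) : ℂ) = 20 / 43 := by push_cast; rfl
  refine zeroLocation_of hk (by decide) (R := {20 / 43}) (n0 := 1) (n1 := 1) (n2 := 0)
    ?_ ?_ ?_ ?_ ?_ ?_
  · intro c hc
    rw [Finset.mem_singleton.mp hc]
    norm_num
  · intro z hz h
    rcases (frickeQ_six_eq_zero_iff hk hz).mp h with h | h | h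
    · exact Or.inr (Or.inl h)
    · exact Or.inr (Or.inr (Or.inl h))
    · exact Or.inl ⟨_, Finset.mem_singleton_self _, by rw [h, hc]⟩
  · intro z hz c hcR hcz h1
    rw [Finset.mem_singleton.mp hcR, hc] at hcz
    have h := order_frickeQ_six hk hz
    rw [order_haupt_sub_of_ne hz (c := 27) (by rw [hcz]; norm_num),
      order_haupt_sub_of_ne hz (c := -1) (by rw [hcz]; norm_num), zero_add, zero_add, ← hcz,
      h1] at h
    obtain ⟨y, hy, hy2⟩ := exists_nat_of_nsmul_eq (n := 2) (m := 2) (by norm_num) (by rw [h]; rfl)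
    rw [hy, show y = 1 by omega, Nat.cast_one]
  · obtain ⟨n, hn, hn0, hn4⟩ := order_ptI
    have h := order_frickeQ_six hk uhp_ptI
    rw [haupt_ptI] at hn
    rw [hn, order_haupt_sub_of_ne uhp_ptI (c := -1) (by rw [haupt_ptI]; norm_num),
      order_haupt_sub_of_ne uhp_ptI (c := 20 / 43) (by rw [haupt_ptI]; norm_num), smul_zero,
      add_zero, add_zero] at h
    -- Here 2·ord(E₆) is the multiplicity n of h, and 0 < n < 4 leaves only n = 2.
    obtain ⟨y, hy, hy2⟩ := exists_nat_of_nsmul_eq (by norm_num) h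
    rw [hy, show y = 1 by omega]
  · obtain ⟨n, hn, hn0, hn4⟩ := order_ptR
    have h := order_frickeQ_six hk uhp_ptR
    rw [haupt_ptR] at hn
    rw [hn, order_haupt_sub_of_ne uhp_ptR (c := 27) (by rw [haupt_ptR]; norm_num),
      order_haupt_sub_of_ne uhp_ptR (c := 20 / 43) (by rw [haupt_ptR]; norm_num), smul_zero,
      add_zero, zero_add] at h
    obtain ⟨y, hy, hy2⟩ := exists_nat_of_nsmul_eq (by norm_num) h
    rw [hy, show y = 1 by omega]
  · refine order_eq_zero_of_ne ptRho_mem fun h => ?_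
    rw [frickeQ_six_eq_zero_iff hk ptRho_mem, haupt_ptRho] at h
    norm_num at h

/-- A monic quartic with four distinct roots is the product of the linear factors. -/
theorem quartic_factor {K : Type*} [Field K] {a b c d r₁ r₂ r₃ r₄ : K}
    (h₁ : r₁ ^ 4 + a * r₁ ^ 3 + b * r₁ ^ 2 + c * r₁ + d = 0)
    (h₂ : r₂ ^ 4 + a * r₂ ^ 3 + b * r₂ ^ 2 + c * r₂ + d = 0)
    (h₃ : r₃ ^ 4 + a * r₃ ^ 3 + b * r₃ ^ 2 + c * r₃ + d = 0)
    (h₄ : r₄ ^ 4 + a * r₄ ^ 3 + b * r₄ ^ 2 + c * r₄ + d = 0)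
    (h₁₂ : r₁ ≠ r₂) (h₁₃ : r₁ ≠ r₃) (h₁₄ : r₁ ≠ r₄) (h₂₃ : r₂ ≠ r₃) (h₂₄ : r₂ ≠ r₄)
    (h₃₄ : r₃ ≠ r₄) (x : K) :
    x ^ 4 + a * x ^ 3 + b * x ^ 2 + c * x + d =
      (x - r₁) * ((x - r₂) * ((x - r₃) * (x - r₄))) := by
  -- Divided differences: subtracting the equations of two roots and cancelling their difference
  -- lowers the degree by one each time, and Newton's interpolation formula reassembles the quartic.
  have first : ∀ s, s ^ 4 + a * s ^ 3 + b * s ^ 2 + c * s + d = 0 → r₁ ≠ s →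
      (r₁ ^ 3 + r₁ ^ 2 * s + r₁ * s ^ 2 + s ^ 3) + a * (r₁ ^ 2 + r₁ * s + s ^ 2) +
        b * (r₁ + s) + c = 0 := fun s hs hne =>
    mul_left_cancel₀ (sub_ne_zero.mpr hne) (by linear_combination h₁ - hs)
  have f₂ := first r₂ h₂ h₁₂
  have second : ∀ s, s ^ 4 + a * s ^ 3 + b * s ^ 2 + c * s + d = 0 → r₁ ≠ s → r₂ ≠ s →
      (r₁ ^ 2 + r₂ ^ 2 + s ^ 2 + r₁ * r₂ + r₁ * s + r₂ * s) + a * (r₁ + r₂ + s) + b = 0 :=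
    fun s hs hne hne' =>
      mul_left_cancel₀ (sub_ne_zero.mpr hne') (by linear_combination f₂ - first s hs hne)
  have g₃ := second r₃ h₃ h₁₃ h₂₃
  have e : r₁ + r₂ + r₃ + r₄ + a = 0 :=
    mul_left_cancel₀ (sub_ne_zero.mpr h₃₄)
      (by linear_combination g₃ - second r₄ h₄ h₁₄ h₂₄)
  linear_combination h₁ + (x - r₁) * f₂ + (x - r₁) * (x - r₂) * g₃ +
    (x - r₁) * (x - r₂) * (x - r₃) * e

/-- The quartic whose roots are the values of the Hauptmodul at the zeros in weight twelve. -/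
def quarticTwelve (x : ℝ) : ℝ :=
  x ^ 4 + -15008016 / 625355 * x ^ 3 + 31042176 / 625355 * x ^ 2 + 33039872 / 625355 * x +
    190080 / 125071

/-- The quartic has signs +, -, + at -1, -1/2, 0 and again at 1, 10, 27. The roots are thus
distinct, lie in (-1, 27) and avoid the corner value 0. -/
theorem exists_quarticTwelve_roots : ∃ r₁ r₂ r₃ r₄ : ℝ,
    (-1 < r₁ ∧ r₁ < -1 / 2) ∧ (-1 / 2 < r₂ ∧ r₂ < 0) ∧ (1 < r₃ ∧ r₃ < 10) ∧ (10 < r₄ ∧ r₄ < 27) ∧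
    quarticTwelve r₁ = 0 ∧ quarticTwelve r₂ = 0 ∧ quarticTwelve r₃ = 0 ∧ quarticTwelve r₄ = 0 := by
  have hc : Continuous quarticTwelve := by unfold quarticTwelve; fun_prop
  obtain ⟨r₁, h₁, e₁⟩ := intermediate_value_Ioo' (by norm_num : (-1 : ℝ) ≤ -1 / 2)
    hc.continuousOn (show (0 : ℝ) ∈ _ by norm_num [quarticTwelve])
  obtain ⟨r₂, h₂, e₂⟩ := intermediate_value_Ioo (by norm_num : (-1 / 2 : ℝ) ≤ 0)
    hc.continuousOn (show (0 : ℝ) ∈ _ by norm_num [quarticTwelve])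
  obtain ⟨r₃, h₃, e₃⟩ := intermediate_value_Ioo' (by norm_num : (1 : ℝ) ≤ 10)
    hc.continuousOn (show (0 : ℝ) ∈ _ by norm_num [quarticTwelve])
  obtain ⟨r₄, h₄, e₄⟩ := intermediate_value_Ioo (by norm_num : (10 : ℝ) ≤ 27)
    hc.continuousOn (show (0 : ℝ) ∈ _ by norm_num [quarticTwelve])
  exact ⟨r₁, r₂, r₃, r₄, h₁, h₂, h₃, h₄, e₁, e₂, e₃, e₄⟩

/-- All four roots are simple and differ from 27, -1 and 0, so E₁₂ vanishes at no elliptic point and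
simply at one point of the arcs for each root. -/
theorem zeroLocation_twelve (hk : 3 ≤ 12) : ZeroLocation (eisenstein 12 hk) 0 0 0 0 4 := by
  obtain ⟨r₁, r₂, r₃, r₄, h₁, h₂, h₃, h₄, e₁, e₂, e₃, e₄⟩ := exists_quarticTwelve_roots
  have n₁₂ : r₁ ≠ r₂ := ne_of_lt (by linarith [h₁.2, h₂.1])
  have n₁₃ : r₁ ≠ r₃ := ne_of_lt (by linarith [h₁.2, h₃.1])
  have n₁₄ : r₁ ≠ r₄ := ne_of_lt (by linarith [h₁.2, h₄.1])
  have n₂₃ : r₂ ≠ r₃ := ne_of_lt (by linarith [h₂.2, h₃.1])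
  have n₂₄ : r₂ ≠ r₄ := ne_of_lt (by linarith [h₂.2, h₄.1])
  have n₃₄ : r₃ ≠ r₄ := ne_of_lt (by linarith [h₃.2, h₄.1])
  have cast : ∀ r : ℝ, quarticTwelve r = 0 → (r : ℂ) ^ 4 + -15008016 / 625355 * (r : ℂ) ^ 3 +
      31042176 / 625355 * (r : ℂ) ^ 2 + 33039872 / 625355 * (r : ℂ) + 190080 / 125071 = 0 := by
    intro r hr
    simpa [quarticTwelve] using congrArg (fun x : ℝ => (x : ℂ)) hr
  have hfac : ∀ z ∈ uhp, frickeQ 12 hk (nome z) = prodQ (nome z) * ((haupt z - r₁) *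
      ((haupt z - r₂) * ((haupt z - r₃) * (haupt z - r₄)))) := by
    intro z hz
    rw [frickeQ_twelve hk hz, ← quartic_factor (cast r₁ e₁) (cast r₂ e₂) (cast r₃ e₃) (cast r₄ e₄)
      (by exact_mod_cast n₁₂) (by exact_mod_cast n₁₃) (by exact_mod_cast n₁₄)
      (by exact_mod_cast n₂₃) (by exact_mod_cast n₂₄) (by exact_mod_cast n₃₄)]
    rfl
  have hiff : ∀ z ∈ uhp, frickeQ 12 hk (nome z) = 0 ↔
      haupt z = r₁ ∨ haupt z = r₂ ∨ haupt z = r₃ ∨ haupt z = r₄ := by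
    intro z hz
    rw [hfac z hz, mul_eq_zero, or_iff_right (prodQ_ne_zero (nome_ne_zero z) (norm_nome_lt_one hz))]
    simp only [mul_eq_zero, sub_eq_zero]
  have hord : ∀ z ∈ uhp, analyticOrderAt (fun w => frickeQ 12 hk (nome w)) z =
      analyticOrderAt (fun w => haupt w - r₁) z + (analyticOrderAt (fun w => haupt w - r₂) z +
        (analyticOrderAt (fun w => haupt w - r₃) z +
          analyticOrderAt (fun w => haupt w - r₄) z)) := by
    intro z hz
    have a₁ := analyticAt_haupt_sub hz r₁
    have a₂ := analyticAt_haupt_sub hz r₂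
    have a₃ := analyticAt_haupt_sub hz r₃
    have a₄ := analyticAt_haupt_sub hz r₄
    rw [← analyticOrderAt_mul a₃ a₄, ← analyticOrderAt_mul a₂ (a₃.mul a₄),
      ← analyticOrderAt_mul a₁ (a₂.mul (a₃.mul a₄)), ← zero_add (analyticOrderAt (_ * _) z),
      ← order_prodQ_nome hz,
      ← analyticOrderAt_mul (analyticAt_prodQ_nome hz) (a₁.mul (a₂.mul (a₃.mul a₄)))]
    refine analyticOrderAt_congr ?_
    filter_upwards [isOpen_uhp.mem_nhds hz] with w hw
    exact hfac w hw
  have hreg : ∀ {z : ℂ} {c : ℝ}, z ∈ uhp → haupt z = c → c ≠ r₁ → c ≠ r₂ → c ≠ r₃ → c ≠ r₄ →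
      analyticOrderAt (fun w => frickeQ 12 hk (nome w)) z = 0 := by
    intro z c hz h c₁ c₂ c₃ c₄
    refine order_eq_zero_of_ne hz fun h0 => ?_
    rw [hiff z hz, h] at h0
    norm_cast at h0
    tauto
  have hcard : ({r₁, r₂, r₃, r₄} : Finset ℝ).card = 4 := by
    rw [Finset.card_insert_of_notMem (by simp [n₁₂, n₁₃, n₁₄]),
      Finset.card_insert_of_notMem (by simp [n₂₃, n₂₄]), Finset.card_pair n₃₄]
  rw [← hcard]
  refine zeroLocation_of hk (by decide) (n0 := 0) (n1 := 0) (n2 := 0) ?_ ?_ ?_ ?_ ?_ ?_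
  · intro c hc
    simp only [Finset.mem_insert, Finset.mem_singleton] at hc
    rcases hc with rfl | rfl | rfl | rfl
    · exact ⟨h₁.1, by linarith [h₁.2], ne_of_lt (by linarith [h₁.2])⟩
    · exact ⟨by linarith [h₂.1], by linarith [h₂.2], h₂.2.ne⟩
    · exact ⟨by linarith [h₃.1], by linarith [h₃.2], ne_of_gt (by linarith [h₃.1])⟩
    · exact ⟨by linarith [h₄.1], h₄.2, ne_of_gt (by linarith [h₄.1])⟩
  · intro z hz h
    left
    rcases (hiff z hz).mp h with h | h | h | h
    · exact ⟨r₁, by simp, h⟩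
    · exact ⟨r₂, by simp, h⟩
    · exact ⟨r₃, by simp, h⟩
    · exact ⟨r₄, by simp, h⟩
  · intro z hz c hcR hcz hz1
    have off : ∀ r : ℝ, c ≠ r → analyticOrderAt (fun w => haupt w - r) z = 0 := fun r hr =>
      order_haupt_sub_of_ne hz (by rw [hcz]; exact_mod_cast hr)
    rw [hcz] at hz1
    rw [hord z hz]
    simp only [Finset.mem_insert, Finset.mem_singleton] at hcR
    rcases hcR with rfl | rfl | rfl | rfl
    · rw [hz1, off _ n₁₂, off _ n₁₃, off _ n₁₄]; rfl
    · rw [hz1, off _ n₁₂.symm, off _ n₂₃, off _ n₂₄]; rfl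
    · rw [hz1, off _ n₁₃.symm, off _ n₂₃.symm, off _ n₃₄]; rfl
    · rw [hz1, off _ n₁₄.symm, off _ n₂₄.symm, off _ n₃₄.symm]; rfl
  · refine hreg (c := 27) uhp_ptI (by rw [haupt_ptI]; norm_num) ?_ ?_ ?_ ?_ <;>
      refine ne_of_gt ?_ <;> linarith [h₁.2, h₂.2, h₃.2, h₄.2]
  · refine hreg (c := -1) uhp_ptR (by rw [haupt_ptR]; norm_num) ?_ ?_ ?_ ?_ <;>
      refine ne_of_lt ?_ <;> linarith [h₁.1, h₂.1, h₃.1, h₄.1]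
  · refine hreg (c := 0) ptRho_mem (by rw [haupt_ptRho]; norm_num) (ne_of_gt ?_) (ne_of_gt ?_)
      (ne_of_lt ?_) (ne_of_lt ?_) <;> linarith [h₁.2, h₂.2, h₃.1, h₄.1]

end Fricke7

end

theorem mainTheorem12 :
    Fricke7.ZeroLocation (Fricke7.eisenstein 4 (by norm_num)) 0 0 0 1 1 ∧
    Fricke7.ZeroLocation (Fricke7.eisenstein 6 (by norm_num)) 0 1 1 0 1 ∧
    Fricke7.ZeroLocation (Fricke7.eisenstein 12 (by norm_num)) 0 0 0 0 4 :=
  ⟨Fricke7.zeroLocation_four _, Fricke7.zeroLocation_six _, Fricke7.zeroLocation_twelve _⟩
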